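/- **Existence and uniqueness of global $C^{k,\alpha}_{\mathrm{loc}}$ Sternberg linearizations.** *Conventions.* Let $k\in\mathbb N_{\ge 1}\cup\{\infty\}$ and $0\le\alpha\le 1$. A map $f\colon M\to N$ of smooth manifolds is of class $C^{k,\alpha}_{\mathrm{loc}}$ if it is $C^k$ and, when $k<\infty$, around every $x\in M$ and $f(x)\in N$ there are charts in which all $k$-th partial derivatives of the coordinate expression of $f$ are Hölder continuous with exponent $\alpha$; $C^{\infty,\alpha}_{\mathrm{loc}}$ means $C^\infty$. A $C^{k,\alpha}_{\mathrm{loc}}$ diffeomorphism is a bijection which is, together with its inverse, of class $C^{k,\alpha}_{\mathrm{loc}}$. Let $X,Y$ be linear endomorphisms of finite-dimensional spaces; eigenvalues are those of the complexifications. If $\mu_1,\dots,\mu_d$ and $\lambda_1,\dots,\lambda_n$ are the eigenvalues of $X$ and $Y$, repeated with multiplicity, then $(X,Y)$ is $k$-nonresonant if $\mu_i\ne\lambda_1^{m_1}\cdots\lambda_n^{m_n}$ for all $i$ and all $m\in\mathbb N_{\ge 0}^n$ with $2\le m_1+\dots+m_n\le k$ (for $k=\infty$: for all $m$ with $2\le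 m_1+\dots+m_n$). If $X,Y$ are invertible and $Y$ has spectral radius less than $1$, the spectral spread is $$\nu(X,Y)=\max_{\mu\in\operatorname{spec}(X),\ \lambda\in\operatorname{spec}(Y)}\frac{\ln|\mu|}{\ln|\lambda|}$$ (and $\nu(X,Y)=0$ on zero-dimensional spaces). *Statement.* Let $Q$ be a smooth finite-dimensional manifold, let $\mathbb T=\mathbb Z$ or $\mathbb T=\mathbb R$, and let $\Phi\colon Q\times\mathbb T\to Q$ be a dynamical system (that is, $\Phi^0=\mathrm{id}$ and $\Phi^{s+t}=\Phi^s\circ\Phi^t$) of class $C^{k,\alpha}_{\mathrm{loc}}$. Let $x_0\in Q$ be a fixed point of $\Phi$ which is globally attracting (Lyapunov stable, and $\Phi^t(x)\to x_0$ as $t\to+\infty$ for every $x\in Q$) and hyperbolic ($\mathsf D_{x_0}\Phi^1$ has no eigenvalue of modulus $1$). Assume that $\nu(\mathsf D_{x_0}\Phi^1,\mathsf D_{x_0}\Phi^1)<k+\alpha$ and that $(\mathsf D_{x_0}\Phi^1,\mathsf D_{x_0}\Phi^1)$ is $k$-nonresonant. Then there exists a $C^{k,\alpha}_{\mathrm{loc}}$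 diffeomorphism $\psi\colon Q\to\mathsf T_{x_0}Q$ satisfying $$\psi\circ\Phi^t=\mathsf D_{x_0}\Phi^t\,\psi\quad\text{for all } t\in\mathbb T,\qquad \mathsf D_{x_0}\psi=\mathrm{id}_{\mathsf T_{x_0}Q},$$ where $\mathsf T_{\psi(x_0)}(\mathsf T_{x_0}Q)$ is identified with $\mathsf T_{x_0}Q$ in the canonical way. It is unique; indeed every map $\psi'\colon Q\to\mathsf T_{x_0}Q$ of class $C^{k,\alpha}_{\mathrm{loc}}$ which satisfies these two conditions is equal to $\psi$. -/

import Mathlib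

open Set Filter Topology
open scoped Manifold ContDiff NNReal ENNReal TensorProduct

noncomputable section

namespace Sternberg

/-! ### Maps of class `C^{k,α}_loc` -/

section Regularity

variable {E H M : Type*} [NormedAddCommGroup E] [NormedSpace ℝ E] [TopologicalSpace H]
  [TopologicalSpace M] [ChartedSpace H M]
variable {E' H' N : Type*} [NormedAddCommGroup E'] [NormedSpace ℝ E'] [TopologicalSpace H']
  [TopologicalSpace N] [ChartedSpace H' N]

/-- `f : M → N` is of class `C^{k,α}_loc`: it is `C^k` and, if `k` is finite, around every point
`x` there are smooth charts `e ∋ x` of `M` and `e' ∋ f x` of `N` such that the `k`-th derivative of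
the coordinate expression `e' ∘ f ∘ e⁻¹` (the array of all `k`-th partial derivatives) is Hölder
continuous with exponent `α` on its whole domain of definition `e (e.source ∩ f⁻¹ e'.source)`.
For `k = ∞` this is just `C^∞`. -/
def IsCkaLoc (I : ModelWithCorners ℝ E H) (I' : ModelWithCorners ℝ E' H') (k : ℕ∞) (α : ℝ≥0)
    (f : M → N) : Prop :=
  ContMDiff I I' k f ∧
    ∀ j : ℕ, (j : ℕ∞) = k → ∀ x : M,
      ∃ e ∈ IsManifold.maximalAtlas I ∞ M, ∃ e' ∈ IsManifold.maximalAtlas I' ∞ N,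
        x ∈ e.source ∧ f x ∈ e'.source ∧
          let D : Set E := e.extend I '' (e.source ∩ f ⁻¹' e'.source)
          ∃ C : ℝ≥0,
            HolderOnWith C α
              (iteratedFDerivWithin ℝ j (e'.extend I' ∘ f ∘ (e.extend I).symm) D) D

/-- `f : M → N` is a `C^{k,α}_loc` diffeomorphism: a bijection such that both `f` and its inverse
are of class `C^{k,α}_loc`. -/
def IsCkaDiffeo (I : ModelWithCorners ℝ E H) (I' : ModelWithCorners ℝ E' H') (k : ℕ∞) (α : ℝ≥0)
    (f : M → N) : Prop :=
  IsCkaLoc I I' k α f ∧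
    ∃ g : N → M, Function.LeftInverse g f ∧ Function.RightInverse g f ∧ IsCkaLoc I' I k α g

end Regularity

/-! ### Nonresonance and spectral spread -/

section Spectrum

variable {V W : Type*} [AddCommGroup V] [Module ℂ V] [Module.Finite ℂ V]
  [AddCommGroup W] [Module ℂ W] [Module.Finite ℂ W]

/-- The eigenvalues of `X`, repeated with (algebraic) multiplicity. -/
def eigenvalues (X : Module.End ℂ V) : Multiset ℂ := X.charpoly.roots

/-- `(X, Y)` is `k`-nonresonant: no eigenvalue `μ` of `X` is a product `∏ i, λ i ^ m i` over the
eigenvalues `λ i` of `Y`, which are listed with multiplicity (the index `i` ranges over that list),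
with exponents of total degree `2 ≤ ∑ i, m i ≤ k`. For `k = ∞` there is no upper bound. -/
def IsNonresonant (X : Module.End ℂ V) (Y : Module.End ℂ W) (k : ℕ∞) : Prop :=
  ∀ μ ∈ eigenvalues X, ∀ m : (eigenvalues Y).ToType → ℕ,
    2 ≤ ∑ i, m i → ((∑ i, m i : ℕ) : ℕ∞) ≤ k → μ ≠ ∏ i, (i.1 : ℂ) ^ m i

/-- The spectral spread `ν(X, Y)`, the largest of the finitely many quotients `ln |μ| / ln |z|` with
`μ ∈ spec X` and `z ∈ spec Y`. -/
def spread (X : Module.End ℂ V) (Y : Module.End ℂ W) : ℝ :=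
  sSup {r : ℝ | ∃ μ ∈ spectrum ℂ X, ∃ z ∈ spectrum ℂ Y, r = Real.log ‖μ‖ / Real.log ‖z‖}

end Spectrum

/-! ### Dynamical systems with a globally attracting hyperbolic fixed point -/

section Dynamics

variable {T : Type*} [AddGroup T] [One T] [Preorder T] [TopologicalSpace T]
variable {E : Type*} [NormedAddCommGroup E] [NormedSpace ℝ E]
variable {Q : Type*} [TopologicalSpace Q] [ChartedSpace E Q]

/-- The derivative `D_{x₀} f : T_{x₀} Q → T_{x₀} Q` at a fixed point `x₀` of `f`. In Mathlib the
tangent space `TangentSpace 𝓘(ℝ, E) x₀` is by definition the model space `E`, the identification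
being the one given by the preferred chart at `x₀`; since `f x₀ = x₀`, this is the same for source
and target. So `T_{x₀} Q` is written `E` in what follows. -/
def derivAtFixedPoint (f : Q → Q) (x₀ : Q) : E →L[ℝ] E :=
  (mfderiv 𝓘(ℝ, E) 𝓘(ℝ, E) f x₀ :
    TangentSpace 𝓘(ℝ, E) x₀ →L[ℝ] TangentSpace 𝓘(ℝ, E) (f x₀))

/-- The complexification of `D_{x₀} f`. -/
def complexDeriv (f : Q → Q) (x₀ : Q) : Module.End ℂ (ℂ ⊗[ℝ] E) :=
  LinearMap.baseChange ℂ (derivAtFixedPoint (E := E) f x₀ : E →ₗ[ℝ] E)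

/-- `x₀` is a globally attracting (that is, globally asymptotically stable) fixed point of `Φ`:
it is fixed, Lyapunov stable, and every forward orbit converges to it. -/
structure IsGloballyAttractingFixedPoint (Φ : Flow T Q) (x₀ : Q) : Prop where
  fixed : ∀ t : T, Φ t x₀ = x₀
  stable : ∀ U ∈ 𝓝 x₀, ∃ V ∈ 𝓝 x₀, ∀ x ∈ V, ∀ t : T, 0 ≤ t → Φ t x ∈ U
  attracting : ∀ x : Q, Tendsto (fun t : T => Φ t x) atTop (𝓝 x₀)

/-- The fixed point `x₀` of `Φ` is hyperbolic: no eigenvalue of `D_{x₀} Φ¹` has modulus one. -/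
def IsHyperbolicFixedPoint (Φ : Flow T Q) (x₀ : Q) : Prop :=
  ∀ μ ∈ spectrum ℂ (complexDeriv (E := E) (Φ 1) x₀), ‖μ‖ ≠ 1

/-- The hypotheses on the fixed point `x₀` in the linearization theorem: it is globally attracting
and hyperbolic, `ν(D_{x₀} Φ¹, D_{x₀} Φ¹) < k + α`, and `(D_{x₀} Φ¹, D_{x₀} Φ¹)` is `k`-nonresonant. -/
structure SternbergCondition [FiniteDimensional ℝ E] (Φ : Flow T Q) (x₀ : Q) (k : ℕ∞) (α : ℝ≥0) :
    Prop where
  attracting : IsGloballyAttractingFixedPoint Φ x₀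
  hyperbolic : IsHyperbolicFixedPoint (E := E) Φ x₀
  spread_lt : ((spread (complexDeriv (E := E) (Φ 1) x₀) (complexDeriv (E := E) (Φ 1) x₀) : ℝ) : EReal) <
    (((k : ℝ≥0∞) + (α : ℝ≥0∞) : ℝ≥0∞) : EReal)
  nonresonant : IsNonresonant (complexDeriv (E := E) (Φ 1) x₀) (complexDeriv (E := E) (Φ 1) x₀) k

/-- `ψ : Q → T_{x₀} Q = E` satisfies `ψ ∘ Φᵗ = D_{x₀} Φᵗ ∘ ψ` for all `t`, and `D_{x₀} ψ` is the
identity of `T_{x₀} Q`. -/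
def IsLinearization (Φ : Flow T Q) (x₀ : Q) (ψ : Q → E) : Prop :=
  (∀ (t : T) (x : Q), ψ (Φ t x) = derivAtFixedPoint (E := E) (Φ t) x₀ (ψ x)) ∧
    mfderiv 𝓘(ℝ, E) 𝓘(ℝ, E) ψ x₀ = ContinuousLinearMap.id ℝ E

/-- There is a `C^{k,α}_loc` diffeomorphism `ψ : Q → T_{x₀} Q = E` which linearizes `Φ` in the sense
of `IsLinearization`, and it is the only such map, even among all `C^{k,α}_loc` maps. -/
def HasUniqueLinearization (Φ : Flow T Q) (x₀ : Q) (k : ℕ∞) (α : ℝ≥0) : Prop :=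
  ∃ ψ : Q → E,
    (IsCkaDiffeo 𝓘(ℝ, E) 𝓘(ℝ, E) k α ψ ∧ IsLinearization Φ x₀ ψ) ∧
      ∀ ψ' : Q → E,
        IsCkaLoc 𝓘(ℝ, E) 𝓘(ℝ, E) k α ψ' → IsLinearization Φ x₀ ψ' → ψ' = ψ

/-- A discrete-time dynamical system of class `C^{k,α}_loc`: as time is discrete, this means that
every time-`n` map is `C^{k,α}_loc`. -/
def IsCkaCascade (E : Type*) [NormedAddCommGroup E] [NormedSpace ℝ E] {Q : Type*}
    [TopologicalSpace Q] [ChartedSpace E Q] (Φ : Flow ℤ Q) (k : ℕ∞) (α : ℝ≥0) : Prop :=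
  ∀ n : ℤ, IsCkaLoc 𝓘(ℝ, E) 𝓘(ℝ, E) k α (Φ n)

/-- A flow of class `C^{k,α}_loc`, as a map `Q × ℝ → Q`. -/
def IsCkaFlow (E : Type*) [NormedAddCommGroup E] [NormedSpace ℝ E] {Q : Type*}
    [TopologicalSpace Q] [ChartedSpace E Q] (Φ : Flow ℝ Q) (k : ℕ∞) (α : ℝ≥0) : Prop :=
  IsCkaLoc (𝓘(ℝ, E).prod 𝓘(ℝ, ℝ)) 𝓘(ℝ, E) k α (fun p : Q × ℝ => Φ p.2 p.1)

end Dynamics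

end Sternberg

end

/-!
The linearization `ψ` is constructed near `x₀` for an iterate of `Φ¹` and carried to the whole of `Q`
by the dynamics. In coordinates centred at `x₀` (`coordMap`) let `F` be the expression of `Φ¹`, and
`A = D F 0`. Two facts on the spectrum enter. By `norm_le_one_of_stable` all eigenvalues of `A` lie in
the closed unit disc, hence in the open one by hyperbolicity; and then `ν(A, A) < k + α` says that
`|z| ^ (k + α) < |μ|` for all eigenvalues `z`, `μ`. So by Gelfand's formula some `Aᴺ` contracts at a
rate `r` with `‖A⁻ᴺ‖ r ^ (k + α) < 1` (`exists_pow_contraction`).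

Local existence, for finite `k` (`exists_local_linearization`). The eigenvalues of
`K ↦ A⁻¹ ∘ K ∘ (A × ⋯ × A)` on `j`-linear maps are the numbers `μ⁻¹ λ₁ ⋯ λⱼ`, so nonresonance makes
the homological equation solvable in the degrees `2 ≤ j ≤ k` (`multilinear_eq_zero_of_nonresonant`),
and there is a polynomial `P`, tangent to the identity, for which `A⁻ᴺ ∘ P ∘ Fᴺ - P` vanishes together
with its derivatives up to order `k` (`exists_formal_linearization`); it is then `O(‖x‖ ^ (k + α))`.
Now `P + φ` linearizes `Fᴺ` if `φ = A⁻ᴺ ∘ φ ∘ Fᴺ + (A⁻ᴺ ∘ P ∘ Fᴺ - P)`. Among the maps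
of order `O(‖x‖ ^ (k + α))` this equation is a contraction with the constant `‖A⁻ᴺ‖ r ^ (k + α)`, and
so are the equations satisfied by the derivatives of `φ` and by its Hölder quotients, because a
derivative gains a factor `r` and loses one order of vanishing. The classes `WeightedHolder` record
the order of vanishing and the regularity simultaneously (`exists_solution`,
`weightedHolder_of_solution`).

Flat maps are rigid (`eq_zero_of_flat`): if `χ = D ∘ χ ∘ Φᴺ` with `‖D‖ r ^ (k + α) < 1` and
`χ = O(‖x‖ ^ (k + α))`, iteration along an orbit gives `χ = 0`. Applied to
`A⁻¹ ∘ ψ ∘ Φ¹ - ψ` this shows that the linearization of `Φᴺ` linearizes `Φ¹` (`exists_conjugacy`);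
applied to the difference of two linearizations, whose `k`-jets at `x₀` agree by nonresonance
(`iteratedFDeriv_eq_zero_of_semiconj`), it gives uniqueness (`eq_of_isLinearization`).

Since all orbits of `Φ` and of `A` enter every neighbourhood of the fixed point, the local conjugacy,
its regularity and its inverse extend to all of `Q` and of the tangent space (`exists_extension`,
`isCkaDiffeo_of_conjugacy`). For `k = ∞` the linearizations of different finite orders coincide by
uniqueness (`hasUniqueLinearization_of_top`). For a flow, `D Φ⁻ᵗ ∘ ψ ∘ Φᵗ` is another linearization of
`Φ¹`, so that it equals `ψ` (`hasUniqueLinearization_real`).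
-/


set_option linter.unusedSectionVars false

namespace Sternberg

/-! ### Weighted Hölder classes on a ball -/

section WeightedClass

universe u

variable {E : Type u} [NormedAddCommGroup E] [NormedSpace ℝ E]

/-- `WeightedHolder α δ j p f`: on the ball of radius `δ` around `0`, the map `f` is `j` times
differentiable, its derivatives satisfy `‖Dⁱ f x‖ ≤ C ‖x‖ ^ (p - i)⁺` for `i ≤ j`, and `Dʲ f` is
continuous and Hölder of exponent `α`, with local Hölder constant of the order of
`‖x‖ ^ (p - j - α)⁺`. The truncation of the exponents allows weights `p < j + α`; in particular the
weight `0` only expresses boundedness and Hölder continuity. The definition is recursive, through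
the total derivative `E → (E →L[ℝ] W)`, for which `E` and `W` have to live in the same universe. -/
def WeightedHolder (α δ : ℝ) : ℕ → ∀ {W : Type u} [NormedAddCommGroup W] [NormedSpace ℝ W],
    ℝ → (E → W) → Prop
  | 0, _, _, _, p, f => ContinuousOn f (Metric.ball 0 δ) ∧ ∃ C : ℝ, 0 ≤ C ∧
      (∀ x ∈ Metric.ball (0 : E) δ, ‖f x‖ ≤ C * ‖x‖ ^ (max p 0)) ∧
      ∀ x ∈ Metric.ball (0 : E) δ, ∀ y ∈ Metric.ball (0 : E) δ,
        ‖f x - f y‖ ≤ C * (max ‖x‖ ‖y‖) ^ (max (p - α) 0) * ‖x - y‖ ^ α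
  | j + 1, _, _, _, p, f =>
      (∃ C : ℝ, 0 ≤ C ∧ ∀ x ∈ Metric.ball (0 : E) δ, ‖f x‖ ≤ C * ‖x‖ ^ (max p 0)) ∧
      (∀ x ∈ Metric.ball (0 : E) δ, DifferentiableAt ℝ f x) ∧
      WeightedHolder α δ j (p - 1) (fderiv ℝ f)

variable {W W₁ W₂ W₃ : Type u} [NormedAddCommGroup W] [NormedSpace ℝ W]
  [NormedAddCommGroup W₁] [NormedSpace ℝ W₁] [NormedAddCommGroup W₂] [NormedSpace ℝ W₂]
  [NormedAddCommGroup W₃] [NormedSpace ℝ W₃]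
variable {α δ : ℝ}

theorem rpow_le_rpow_of_le_one {m a b : ℝ} (hm : 0 ≤ m) (hm1 : m ≤ 1) (hb : 0 ≤ b)
    (hab : b ≤ a) : m ^ a ≤ m ^ b :=
  Real.rpow_le_rpow_of_exponent_ge_of_imp hm hm1 hab fun _ h0 => by linarith

namespace WeightedHolder

theorem congr {j : ℕ} {p : ℝ} {f g : E → W} (hf : WeightedHolder α δ j p f)
    (h : ∀ x ∈ Metric.ball (0 : E) δ, f x = g x) : WeightedHolder α δ j p g := by
  induction j generalizing W p with
  | zero =>
    obtain ⟨hc, C, h0, h1, h2⟩ := hf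
    refine ⟨hc.congr fun x hx => (h x hx).symm, C, h0, fun x hx => h x hx ▸ h1 x hx,
      fun x hx y hy => h x hx ▸ h y hy ▸ h2 x hx y hy⟩
  | succ j ih =>
    obtain ⟨⟨C, h0, h1⟩, h2, h3⟩ := hf
    have he : ∀ x ∈ Metric.ball (0 : E) δ, f =ᶠ[𝓝 x] g := fun x hx =>
      Filter.eventually_of_mem (Metric.isOpen_ball.mem_nhds hx) h
    exact ⟨⟨C, h0, fun x hx => h x hx ▸ h1 x hx⟩,
      fun x hx => (he x hx).differentiableAt_iff.1 (h2 x hx),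
      ih h3 fun x hx => (he x hx).fderiv_eq⟩

theorem bound {j : ℕ} {p : ℝ} {f : E → W} (hf : WeightedHolder α δ j p f) :
    ∃ C : ℝ, 0 ≤ C ∧ ∀ x ∈ Metric.ball (0 : E) δ, ‖f x‖ ≤ C * ‖x‖ ^ (max p 0) := by
  cases j with
  | zero => obtain ⟨-, C, h0, h1, -⟩ := hf; exact ⟨C, h0, h1⟩
  | succ j => exact hf.1

theorem continuousOn {j : ℕ} {p : ℝ} {f : E → W} (hf : WeightedHolder α δ j p f) :
    ContinuousOn f (Metric.ball 0 δ) := by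
  cases j with
  | zero => exact hf.1
  | succ j => exact fun x hx => (hf.2.1 x hx).continuousAt.continuousWithinAt

theorem restrict {j : ℕ} {p δ' : ℝ} {f : E → W} (hf : WeightedHolder α δ j p f) (h : δ' ≤ δ) :
    WeightedHolder α δ' j p f := by
  have hs := Metric.ball_subset_ball (x := (0 : E)) h
  induction j generalizing W p with
  | zero =>
    obtain ⟨hc, C, h0, h1, h2⟩ := hf
    exact ⟨hc.mono hs, C, h0, fun x hx => h1 x (hs hx), fun x hx y hy => h2 x (hs hx) y (hs hy)⟩
  | succ j ih =>
    obtain ⟨⟨C, h0, h1⟩, h2, h3⟩ := hf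
    exact ⟨⟨C, h0, fun x hx => h1 x (hs hx)⟩, fun x hx => h2 x (hs hx), ih h3⟩

/-- On a ball of radius at most `1` the weight can be lowered; because of the truncation all weights
`q ≤ 0` are even equivalent, which is the second alternative. -/
theorem mono_weight (hα : 0 ≤ α) (hδ : δ ≤ 1) {j : ℕ} {p q : ℝ} {f : E → W}
    (hf : WeightedHolder α δ j p f) (h : q ≤ p ∨ q ≤ 0) : WeightedHolder α δ j q f := by
  have key : ∀ {m p q a : ℝ}, 0 ≤ m → m ≤ 1 → 0 ≤ a → q ≤ p ∨ q ≤ 0 →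
      m ^ (max (p - a) 0) ≤ m ^ (max (q - a) 0) := by
    intro m p q a hm hm1 ha h
    refine rpow_le_rpow_of_le_one hm hm1 (le_max_right _ _) ?_
    rcases h with h | h
    · exact max_le_max (by linarith) le_rfl
    · rw [max_eq_right (by linarith : q - a ≤ 0)]; exact le_max_right _ _
  have key0 : ∀ {p q : ℝ}, q ≤ p ∨ q ≤ 0 → ∀ x ∈ Metric.ball (0 : E) δ,
      ‖x‖ ^ (max p 0) ≤ ‖x‖ ^ (max q 0) := by
    intro p q h x hx
    simpa using key (norm_nonneg x) ((mem_ball_zero_iff.1 hx).le.trans hδ) le_rfl h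
  induction j generalizing W p q with
  | zero =>
    obtain ⟨hc, C, h0, h1, h2⟩ := hf
    refine ⟨hc, C, h0, fun x hx => (h1 x hx).trans (mul_le_mul_of_nonneg_left (key0 h x hx) h0),
      fun x hx y hy => (h2 x hx y hy).trans ?_⟩
    have hm : max ‖x‖ ‖y‖ ≤ 1 :=
      max_le ((mem_ball_zero_iff.1 hx).le.trans hδ) ((mem_ball_zero_iff.1 hy).le.trans hδ)
    have := key (by positivity) hm hα h
    gcongr ?_ * _
    gcongr C * ?_
  | succ j ih =>
    obtain ⟨⟨C, h0, h1⟩, h2, h3⟩ := hf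
    exact ⟨⟨C, h0, fun x hx => (h1 x hx).trans (mul_le_mul_of_nonneg_left (key0 h x hx) h0)⟩, h2,
      ih h3 (h.imp (by intro; linarith) (by intro; linarith))⟩

/-- On the ball spanned by two points, the mean value inequality with the weighted bound of the
derivative. -/
theorem norm_sub_le {p C : ℝ} {f : E → W} {δ : ℝ} (hp : 0 ≤ p) (hC : 0 ≤ C)
    (hd : ∀ x ∈ Metric.ball (0 : E) δ, DifferentiableAt ℝ f x)
    (hb : ∀ x ∈ Metric.ball (0 : E) δ, ‖fderiv ℝ f x‖ ≤ C * ‖x‖ ^ p)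
    {x y : E} (hx : x ∈ Metric.ball (0 : E) δ) (hy : y ∈ Metric.ball (0 : E) δ) :
    ‖f x - f y‖ ≤ C * (max ‖x‖ ‖y‖) ^ p * ‖x - y‖ := by
  have hsub : Metric.closedBall (0 : E) (max ‖x‖ ‖y‖) ⊆ Metric.ball 0 δ := by
    intro z hz
    rw [mem_ball_zero_iff] at *
    rw [mem_closedBall_zero_iff] at hz
    exact hz.trans_lt (max_lt hx hy)
  refine (convex_closedBall (0 : E) (max ‖x‖ ‖y‖)).norm_image_sub_le_of_norm_fderiv_le (𝕜 := ℝ)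
    (fun z hz => hd z (hsub hz)) (fun z hz => (hb z (hsub hz)).trans ?_) ?_ ?_
  · gcongr
    exact mem_closedBall_zero_iff.1 hz
  · simp
  · simp

/-- A Lipschitz estimate implies a Hölder estimate, with a gain of `1 - α` in the weight, because
`‖x - y‖ ≤ 2 max ‖x‖ ‖y‖`. -/
theorem holder_of_lipschitz (hα : 0 ≤ α) (hα1 : α ≤ 1) {m a b : ℝ} {x y : E}
    (hm : max ‖x‖ ‖y‖ ≤ 1) (hb : 0 ≤ b) (hab : b ≤ a + (1 - α)) (hmm : m = max ‖x‖ ‖y‖) :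
    m ^ a * ‖x - y‖ ≤ 2 * m ^ b * ‖x - y‖ ^ α := by
  subst hmm
  set m := max ‖x‖ ‖y‖ with hm'
  have hm0 : 0 ≤ m := by positivity
  rcases hm0.eq_or_lt with h0 | h0
  · have hx : ‖x‖ ≤ 0 := h0 ▸ le_max_left _ _
    have hy : ‖y‖ ≤ 0 := h0 ▸ le_max_right _ _
    have : x - y = 0 := by rw [norm_le_zero_iff.1 hx, norm_le_zero_iff.1 hy, sub_zero]
    rw [this, norm_zero, mul_zero]
    positivity
  have hd : ‖x - y‖ ≤ 2 * m := by
    refine (_root_.norm_sub_le x y).trans ?_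
    linarith [le_max_left ‖x‖ ‖y‖, le_max_right ‖x‖ ‖y‖]
  have h1 : ‖x - y‖ ≤ (2 * m) ^ (1 - α) * ‖x - y‖ ^ α := by
    rcases (norm_nonneg (x - y)).eq_or_lt with h | h
    · rw [← h]; positivity
    calc ‖x - y‖ = ‖x - y‖ ^ (1 - α) * ‖x - y‖ ^ α := by
          rw [← Real.rpow_add h]; simp
      _ ≤ _ := by gcongr
  calc m ^ a * ‖x - y‖ ≤ m ^ a * ((2 * m) ^ (1 - α) * ‖x - y‖ ^ α) := by gcongr
    _ = 2 ^ (1 - α) * m ^ (a + (1 - α)) * ‖x - y‖ ^ α := by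
      rw [Real.mul_rpow (by norm_num) hm0, Real.rpow_add h0]; ring
    _ ≤ 2 * m ^ b * ‖x - y‖ ^ α := by
      have h2 : (2 : ℝ) ^ (1 - α) ≤ 2 := by
        calc (2 : ℝ) ^ (1 - α) ≤ 2 ^ (1 : ℝ) :=
              Real.rpow_le_rpow_of_exponent_le (by norm_num) (by linarith)
          _ = 2 := Real.rpow_one _
      have h3 := rpow_le_rpow_of_le_one hm0 hm hb hab
      have : (2 : ℝ) ^ (1 - α) * m ^ (a + (1 - α)) ≤ 2 * m ^ b :=
        mul_le_mul h2 h3 (by positivity) (by norm_num)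
      exact mul_le_mul_of_nonneg_right this (by positivity)

theorem of_succ (hα : 0 ≤ α) (hα1 : α ≤ 1) (hδ : δ ≤ 1) {j : ℕ} {p : ℝ} {f : E → W}
    (hf : WeightedHolder α δ (j + 1) p f) : WeightedHolder α δ j p f := by
  induction j generalizing W p with
  | zero =>
    obtain ⟨⟨C, h0, h1⟩, h2, h3⟩ := hf
    obtain ⟨C', h0', h1'⟩ := h3.bound
    refine ⟨fun x hx => (h2 x hx).continuousAt.continuousWithinAt, C + 2 * C', by positivity,
      fun x hx => (h1 x hx).trans (by gcongr; linarith), fun x hx y hy => ?_⟩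
    have hm : max ‖x‖ ‖y‖ ≤ 1 :=
      max_le ((mem_ball_zero_iff.1 hx).le.trans hδ) ((mem_ball_zero_iff.1 hy).le.trans hδ)
    have ha : 0 ≤ max (p - 1) 0 := le_max_right _ _
    have := norm_sub_le ha h0' h2 h1' hx hy
    have h' := holder_of_lipschitz (x := x) (y := y) (a := max (p - 1) 0) hα hα1 hm
      (le_max_right (p - α) 0) (max_le (by linarith [le_max_left (p - 1) 0]) (by linarith)) rfl
    calc _ ≤ C' * (max ‖x‖ ‖y‖ ^ (max (p - 1) 0) * ‖x - y‖) := by rw [← mul_assoc]; exact this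
      _ ≤ C' * (2 * max ‖x‖ ‖y‖ ^ (max (p - α) 0) * ‖x - y‖ ^ α) := by gcongr
      _ = (2 * C') * max ‖x‖ ‖y‖ ^ (max (p - α) 0) * ‖x - y‖ ^ α := by ring
      _ ≤ _ := by gcongr; linarith
  | succ j ih => exact ⟨hf.1, hf.2.1, ih hf.2.2⟩

theorem const (c : W) (j : ℕ) {p : ℝ} (hp : p ≤ 0) :
    WeightedHolder α δ j p (fun _ : E => c) := by
  induction j generalizing W p with
  | zero =>
    refine ⟨continuousOn_const, ‖c‖, norm_nonneg _, fun x hx => by simp [hp], fun x hx y hy => ?_⟩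
    rw [sub_self, norm_zero]; positivity
  | succ j ih =>
    refine ⟨⟨‖c‖, norm_nonneg _, fun x hx => by simp [hp]⟩, fun x _ => by fun_prop, ?_⟩
    rw [fderiv_fun_const]
    exact ih 0 (by linarith)

theorem add {j : ℕ} {p : ℝ} {f g : E → W} (hf : WeightedHolder α δ j p f)
    (hg : WeightedHolder α δ j p g) : WeightedHolder α δ j p (fun x => f x + g x) := by
  induction j generalizing W p with
  | zero =>
    obtain ⟨hc, C, h0, h1, h2⟩ := hf
    obtain ⟨hc', C', h0', h1', h2'⟩ := hg
    refine ⟨hc.add hc', C + C', by positivity, fun x hx => ?_, fun x hx y hy => ?_⟩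
    · rw [add_mul]; exact norm_add_le_of_le (h1 x hx) (h1' x hx)
    · rw [add_mul, add_mul, add_sub_add_comm]
      exact norm_add_le_of_le (h2 x hx y hy) (h2' x hx y hy)
  | succ j ih =>
    obtain ⟨⟨C, h0, h1⟩, h2, h3⟩ := hf
    obtain ⟨⟨C', h0', h1'⟩, h2', h3'⟩ := hg
    refine ⟨⟨C + C', by positivity, fun x hx => ?_⟩, fun x hx => (h2 x hx).add (h2' x hx), ?_⟩
    · rw [add_mul]; exact norm_add_le_of_le (h1 x hx) (h1' x hx)
    · exact (ih h3 h3').congr fun x hx => (fderiv_fun_add (h2 x hx) (h2' x hx)).symm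

/-- The product rule: weights add. -/
theorem bilin (hα : 0 ≤ α) (hα1 : α ≤ 1) (hδ : δ ≤ 1) (B : W₁ →L[ℝ] W₂ →L[ℝ] W₃) {j : ℕ}
    {p q : ℝ} {f : E → W₁} {g : E → W₂} (hf : WeightedHolder α δ j p f)
    (hg : WeightedHolder α δ j q g) :
    WeightedHolder α δ j (p + q) (fun x => B (f x) (g x)) := by
  have pw : ∀ {m a b c : ℝ}, 0 ≤ m → m ≤ 1 → 0 ≤ a → 0 ≤ b → 0 ≤ c → c ≤ a + b →
      m ^ a * m ^ b ≤ m ^ c := by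
    intro m a b c hm hm1 ha hb hc h
    rw [← Real.rpow_add_of_nonneg hm ha hb]
    exact rpow_le_rpow_of_le_one hm hm1 hc h
  have bd : ∀ {W₁ W₂ W₃ : Type u} [NormedAddCommGroup W₁] [NormedSpace ℝ W₁]
      [NormedAddCommGroup W₂] [NormedSpace ℝ W₂] [NormedAddCommGroup W₃] [NormedSpace ℝ W₃]
      (B : W₁ →L[ℝ] W₂ →L[ℝ] W₃) {p q : ℝ} {f : E → W₁} {g : E → W₂} (C C' : ℝ), 0 ≤ C →
      ∀ x ∈ Metric.ball (0 : E) δ, ‖f x‖ ≤ C * ‖x‖ ^ (max p 0) → ‖g x‖ ≤ C' * ‖x‖ ^ (max q 0) →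
      0 ≤ C' → ‖B (f x) (g x)‖ ≤ ‖B‖ * C * C' * ‖x‖ ^ (max (p + q) 0) := by
    intro W₁ W₂ W₃ _ _ _ _ _ _ B p q f g C C' h0 x hx h1 h1' h0'
    have hx1 := (mem_ball_zero_iff.1 hx).le.trans hδ
    calc ‖B (f x) (g x)‖ ≤ ‖B‖ * ‖f x‖ * ‖g x‖ := B.le_opNorm₂ _ _
      _ ≤ ‖B‖ * (C * ‖x‖ ^ (max p 0)) * (C' * ‖x‖ ^ (max q 0)) := by gcongr
      _ = ‖B‖ * C * C' * (‖x‖ ^ (max p 0) * ‖x‖ ^ (max q 0)) := by ring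
      _ ≤ _ := by
        gcongr
        exact pw (norm_nonneg _) hx1 (le_max_right _ _) (le_max_right _ _) (le_max_right _ _)
          (max_le (add_le_add (le_max_left _ _) (le_max_left _ _)) (by positivity))
  induction j generalizing W₁ W₂ W₃ p q with
  | zero =>
    obtain ⟨hc, C, h0, h1, h2⟩ := hf
    obtain ⟨hc', C', h0', h1', h2'⟩ := hg
    have hcc : ContinuousOn (fun x => B (f x) (g x)) (Metric.ball 0 δ) :=
      (B.continuous.comp_continuousOn hc).clm_apply hc'
    refine ⟨hcc, 2 * (‖B‖ * C * C'), by positivity,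
      fun x hx => (bd B C C' h0 x hx (h1 x hx) (h1' x hx) h0').trans ?_, fun x hx y hy => ?_⟩
    · refine mul_le_mul_of_nonneg_right ?_ (by positivity)
      linarith [show 0 ≤ ‖B‖ * C * C' by positivity]
    have hm1 : max ‖x‖ ‖y‖ ≤ 1 :=
      max_le ((mem_ball_zero_iff.1 hx).le.trans hδ) ((mem_ball_zero_iff.1 hy).le.trans hδ)
    set m := max ‖x‖ ‖y‖ with hm
    have hm0 : 0 ≤ m := by positivity
    have e1 : ‖f x‖ ≤ C * m ^ (max p 0) := (h1 x hx).trans (by gcongr; exact le_max_left _ _)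
    have e2 : ‖g y‖ ≤ C' * m ^ (max q 0) := (h1' y hy).trans (by gcongr; exact le_max_right _ _)
    have : B (f x) (g x) - B (f y) (g y) = B (f x) (g x - g y) + B (f x - f y) (g y) := by
      simp
    rw [this]
    have w1 : m ^ (max p 0) * m ^ (max (q - α) 0) ≤ m ^ (max (p + q - α) 0) :=
      pw hm0 hm1 (le_max_right _ _) (le_max_right _ _) (le_max_right _ _)
        (max_le (by linarith [le_max_left p 0, le_max_left (q - α) 0]) (by positivity))
    have w2 : m ^ (max (p - α) 0) * m ^ (max q 0) ≤ m ^ (max (p + q - α) 0) :=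
      pw hm0 hm1 (le_max_right _ _) (le_max_right _ _) (le_max_right _ _)
        (max_le (by linarith [le_max_left q 0, le_max_left (p - α) 0]) (by positivity))
    calc _ ≤ ‖B‖ * ‖f x‖ * ‖g x - g y‖ + ‖B‖ * ‖f x - f y‖ * ‖g y‖ :=
          norm_add_le_of_le (B.le_opNorm₂ _ _) (B.le_opNorm₂ _ _)
      _ ≤ ‖B‖ * (C * m ^ (max p 0)) * (C' * m ^ (max (q - α) 0) * ‖x - y‖ ^ α) +
          ‖B‖ * (C * m ^ (max (p - α) 0) * ‖x - y‖ ^ α) * (C' * m ^ (max q 0)) := by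
        gcongr
        · exact h2' x hx y hy
        · exact h2 x hx y hy
      _ = ‖B‖ * C * C' * (m ^ (max p 0) * m ^ (max (q - α) 0)) * ‖x - y‖ ^ α +
          ‖B‖ * C * C' * (m ^ (max (p - α) 0) * m ^ (max q 0)) * ‖x - y‖ ^ α := by ring
      _ ≤ ‖B‖ * C * C' * m ^ (max (p + q - α) 0) * ‖x - y‖ ^ α +
          ‖B‖ * C * C' * m ^ (max (p + q - α) 0) * ‖x - y‖ ^ α := by gcongr
      _ = _ := by ring
  | succ j ih =>
    have hf' := of_succ hα hα1 hδ hf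
    have hg' := of_succ hα hα1 hδ hg
    obtain ⟨⟨C, h0, h1⟩, h2, h3⟩ := hf
    obtain ⟨⟨C', h0', h1'⟩, h2', h3'⟩ := hg
    refine ⟨⟨‖B‖ * C * C', by positivity, fun x hx => bd B C C' h0 x hx (h1 x hx) (h1' x hx) h0'⟩,
      fun x hx => (B.hasFDerivAt_of_bilinear (h2 x hx).hasFDerivAt
        (h2' x hx).hasFDerivAt).differentiableAt, ?_⟩
    have a1 := ih (B.precompR E) hf' h3'
    have a2 := ih (B.precompL E) h3 hg'
    rw [show p + (q - 1) = p + q - 1 by ring] at a1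
    rw [show p - 1 + q = p + q - 1 by ring] at a2
    exact (a1.add a2).congr fun x hx => (B.hasFDerivAt_of_bilinear (h2 x hx).hasFDerivAt
        (h2' x hx).hasFDerivAt).fderiv.symm

theorem clm_comp (hα : 0 ≤ α) (hα1 : α ≤ 1) (hδ : δ ≤ 1) (L : W₁ →L[ℝ] W₂) {j : ℕ}
    {p : ℝ} {f : E → W₁} (hf : WeightedHolder α δ j p f) :
    WeightedHolder α δ j p (fun x => L (f x)) := by
  have := bilin hα hα1 hδ (ContinuousLinearMap.id ℝ (W₁ →L[ℝ] W₂)).flip hf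
    (const (α := α) (δ := δ) L j le_rfl)
  simpa using this

theorem sub (hα : 0 ≤ α) (hα1 : α ≤ 1) (hδ : δ ≤ 1) {j : ℕ} {p : ℝ} {f g : E → W}
    (hf : WeightedHolder α δ j p f)
    (hg : WeightedHolder α δ j p g) : WeightedHolder α δ j p (fun x => f x - g x) := by
  have := hf.add (clm_comp hα hα1 hδ (-ContinuousLinearMap.id ℝ W) hg)
  simpa [sub_eq_add_neg] using this

/-- Composition on the right with a Lipschitz map of weight `1` preserves the weight. The inner map
has to be Lipschitz by hypothesis, since for `j = 0` it is not so by its class. -/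
theorem comp {E' : Type u} [NormedAddCommGroup E'] [NormedSpace ℝ E'] {δ' K : ℝ}
    (hα : 0 ≤ α) (hα1 : α ≤ 1) (hδ : δ ≤ 1) (hK : 0 ≤ K) {j : ℕ} {p : ℝ}
    {f : E' → W} {F : E → E'}
    (hmaps : ∀ x ∈ Metric.ball (0 : E) δ, F x ∈ Metric.ball (0 : E') δ')
    (hn : ∀ x ∈ Metric.ball (0 : E) δ, ‖F x‖ ≤ K * ‖x‖)
    (hl : ∀ x ∈ Metric.ball (0 : E) δ, ∀ y ∈ Metric.ball (0 : E) δ, ‖F x - F y‖ ≤ K * ‖x - y‖)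
    (hf : WeightedHolder α δ' j p f) (hF : WeightedHolder α δ j 1 F) :
    WeightedHolder α δ j p (fun x => f (F x)) := by
  have bd : ∀ {W : Type u} [NormedAddCommGroup W] {f : E' → W} {C p : ℝ}, 0 ≤ C →
      (∀ x ∈ Metric.ball (0 : E') δ', ‖f x‖ ≤ C * ‖x‖ ^ (max p 0)) →
      ∀ x ∈ Metric.ball (0 : E) δ, ‖f (F x)‖ ≤ C * K ^ (max p 0) * ‖x‖ ^ (max p 0) := by
    intro W _ f C p h0 h1 x hx
    refine (h1 _ (hmaps x hx)).trans ?_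
    rw [mul_assoc, ← Real.mul_rpow hK (norm_nonneg _)]
    gcongr
    exact hn x hx
  induction j generalizing W p with
  | zero =>
    obtain ⟨hc, C, h0, h1, h2⟩ := hf
    refine ⟨hc.comp hF.continuousOn hmaps, C * K ^ (max p 0) +
      C * K ^ (max (p - α) 0) * K ^ α, by positivity,
      fun x hx => (bd h0 h1 x hx).trans ?_, fun x hx y hy => (h2 _ (hmaps x hx) _
        (hmaps y hy)).trans ?_⟩
    · gcongr
      have : 0 ≤ C * K ^ (max (p - α) 0) * K ^ α := by positivity
      linarith
    · calc _ ≤ C * (K * max ‖x‖ ‖y‖) ^ (max (p - α) 0) * (K * ‖x - y‖) ^ α := by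
            gcongr
            · exact max_le ((hn x hx).trans (by gcongr; exact le_max_left _ _))
                ((hn y hy).trans (by gcongr; exact le_max_right _ _))
            · exact hl x hx y hy
        _ = C * K ^ (max (p - α) 0) * K ^ α * max ‖x‖ ‖y‖ ^ (max (p - α) 0) * ‖x - y‖ ^ α := by
            rw [Real.mul_rpow hK (by positivity), Real.mul_rpow hK (by positivity)]; ring
        _ ≤ _ := by
            gcongr
            have : 0 ≤ C * K ^ (max p 0) := by positivity
            linarith
  | succ j ih =>
    have hF' := of_succ hα hα1 hδ hF
    obtain ⟨⟨C, h0, h1⟩, h2, h3⟩ := hf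
    obtain ⟨-, d2, d3⟩ := hF
    have hd : ∀ x ∈ Metric.ball (0 : E) δ, HasFDerivAt (fun x => f (F x))
        ((fderiv ℝ f (F x)).comp (fderiv ℝ F x)) x := fun x hx =>
      (h2 _ (hmaps x hx)).hasFDerivAt.comp x (d2 x hx).hasFDerivAt
    refine ⟨⟨_, by positivity, bd h0 h1⟩, fun x hx => (hd x hx).differentiableAt, ?_⟩
    have := bilin hα hα1 hδ (ContinuousLinearMap.compL ℝ E E' W) (ih h3 hF') d3
    rw [sub_self, add_zero] at this
    exact this.congr fun x hx => (hd x hx).fderiv.symm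

/-- If all derivatives up to order `j` vanish at `0`, then the weight can be raised to `j + α`. -/
theorem of_iteratedFDeriv_eq_zero (hα : 0 ≤ α) (hδ : δ ≤ 1) (hδ0 : 0 < δ) {j : ℕ}
    {f : E → W} (hf : WeightedHolder α δ j 0 f) (h0 : ∀ i ≤ j, iteratedFDeriv ℝ i f 0 = 0) :
    WeightedHolder α δ j (j + α) f := by
  have z : (0 : E) ∈ Metric.ball (0 : E) δ := by simpa using hδ0
  induction j generalizing W with
  | zero =>
    obtain ⟨hc, C, hC, h1, h2⟩ := hf
    have f0 : f 0 = 0 := by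
      simpa using DFunLike.congr_fun (h0 0 le_rfl) 0
    refine ⟨hc, C, hC, fun x hx => ?_, fun x hx y hy => (h2 x hx y hy).trans ?_⟩
    · have := h2 x hx 0 z
      simpa [f0, hα] using this
    · simp [hα]
  | succ j ih =>
    obtain ⟨-, h2, h3⟩ := hf
    have f0 : f 0 = 0 := by
      simpa using DFunLike.congr_fun (h0 0 (Nat.zero_le _)) 0
    have := ih (mono_weight hα hδ h3 (Or.inr le_rfl)) fun i hi => by
      have := h0 (i + 1) (by omega)
      rw [← norm_eq_zero, norm_iteratedFDeriv_fderiv, this, norm_zero]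
    obtain ⟨C, hC, h4⟩ := this.bound
    refine ⟨⟨C, hC, fun x hx => ?_⟩, h2, by push_cast; convert this using 1; ring⟩
    have := norm_sub_le (by positivity) hC h2 h4 hx z
    rw [f0] at this
    simp only [sub_zero, norm_zero, norm_nonneg, sup_of_le_left] at this
    refine this.trans (le_of_eq ?_)
    have hj : (0 : ℝ) ≤ j + α := by positivity
    rw [max_eq_left hj, mul_assoc, max_eq_left (by push_cast; linarith)]
    push_cast
    rw [show (j : ℝ) + 1 + α = (j + α) + 1 by ring,
      Real.rpow_add_of_nonneg (norm_nonneg _) hj zero_le_one, Real.rpow_one]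

end WeightedHolder

end WeightedClass

/-! ### The linearized conjugacy equation over a contraction -/

section FunctionalEquation

universe u

variable {E : Type u} [NormedAddCommGroup E] [NormedSpace ℝ E]
variable {W : Type u} [NormedAddCommGroup W] [NormedSpace ℝ W]

/-- The Picard iterates, started at `0`, of the equation `φ x = L x (φ (F x)) + R x`. -/
def picardIter (L : E → W →L[ℝ] W) (F : E → E) (R : E → W) : ℕ → E → W
  | 0 => fun _ => 0
  | n + 1 => fun x => L x (picardIter L F R n (F x)) + R x

variable {L : E → W →L[ℝ] W} {F : E → E} {R φ : E → W} {δ r l p C : ℝ}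

theorem picardIter_succ (n : ℕ) (x : E) :
    picardIter L F R (n + 1) x = L x (picardIter L F R n (F x)) + R x := rfl

/-- The contraction estimate: `φ ↦ L · (φ ∘ F)` has norm at most `l r ^ p` on maps of order
`‖x‖ ^ p`. -/
theorem norm_clm_apply_le_of_contraction (hr : 0 ≤ r) (hp : 0 ≤ p)
    (hn : ∀ x ∈ Metric.ball (0 : E) δ, ‖F x‖ ≤ r * ‖x‖)
    (hL : ∀ x ∈ Metric.ball (0 : E) δ, ‖L x‖ ≤ l) {w : W} {x : E}
    (hx : x ∈ Metric.ball (0 : E) δ) (hC : 0 ≤ C) (hw : ‖w‖ ≤ C * ‖F x‖ ^ p) :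
    ‖L x w‖ ≤ C * (l * r ^ p) * ‖x‖ ^ p := by
  have hl : 0 ≤ l := (norm_nonneg _).trans (hL x hx)
  calc ‖L x w‖ ≤ ‖L x‖ * ‖w‖ := (L x).le_opNorm w
    _ ≤ l * (C * (r * ‖x‖) ^ p) := by
      gcongr
      · exact hL x hx
      · exact hw.trans (by gcongr; exact hn x hx)
    _ = _ := by rw [Real.mul_rpow hr (norm_nonneg _)]; ring

/-- The Picard iterates converge to any solution of order `‖x‖ ^ p`, at the rate `(l r ^ p) ^ n`. -/
theorem picardIter_sub_le (hr : 0 ≤ r) (hp : 0 ≤ p) (hC : 0 ≤ C) (hl : 0 ≤ l)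
    (hmaps : ∀ x ∈ Metric.ball (0 : E) δ, F x ∈ Metric.ball (0 : E) δ)
    (hn : ∀ x ∈ Metric.ball (0 : E) δ, ‖F x‖ ≤ r * ‖x‖)
    (hL : ∀ x ∈ Metric.ball (0 : E) δ, ‖L x‖ ≤ l)
    (hφ : ∀ x ∈ Metric.ball (0 : E) δ, φ x = L x (φ (F x)) + R x)
    (hb : ∀ x ∈ Metric.ball (0 : E) δ, ‖φ x‖ ≤ C * ‖x‖ ^ p) (n : ℕ) :
    ∀ x ∈ Metric.ball (0 : E) δ,
      ‖picardIter L F R n x - φ x‖ ≤ C * (l * r ^ p) ^ n * ‖x‖ ^ p := by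
  induction n with
  | zero => intro x hx; simpa [picardIter] using hb x hx
  | succ n ih =>
    intro x hx
    have : picardIter L F R (n + 1) x - φ x = L x (picardIter L F R n (F x) - φ (F x)) := by
      rw [picardIter_succ, hφ x hx, map_sub, add_sub_add_right_eq_sub]
    rw [this, pow_succ, ← mul_assoc]
    exact norm_clm_apply_le_of_contraction hr hp hn hL hx (by positivity) (ih _ (hmaps x hx))

/-- If `l r ^ p < 1`, then the equation has a solution of order `‖x‖ ^ p`, the limit of the Picard
iterates. -/
theorem exists_solution [CompleteSpace W] (hr : 0 ≤ r) (hp : 0 ≤ p) (hC : 0 ≤ C) (hl : 0 ≤ l)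
    (hθ : l * r ^ p < 1)
    (hmaps : ∀ x ∈ Metric.ball (0 : E) δ, F x ∈ Metric.ball (0 : E) δ)
    (hn : ∀ x ∈ Metric.ball (0 : E) δ, ‖F x‖ ≤ r * ‖x‖)
    (hL : ∀ x ∈ Metric.ball (0 : E) δ, ‖L x‖ ≤ l)
    (hR : ∀ x ∈ Metric.ball (0 : E) δ, ‖R x‖ ≤ C * ‖x‖ ^ p) :
    ∃ φ : E → W, (∀ x ∈ Metric.ball (0 : E) δ, φ x = L x (φ (F x)) + R x) ∧
      ∃ C' : ℝ, 0 ≤ C' ∧ ∀ x ∈ Metric.ball (0 : E) δ, ‖φ x‖ ≤ C' * ‖x‖ ^ p := by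
  set θ := l * r ^ p with hθd
  have hθ0 : 0 ≤ θ := by positivity
  have step : ∀ n, ∀ x ∈ Metric.ball (0 : E) δ,
      ‖picardIter L F R (n + 1) x - picardIter L F R n x‖ ≤ C * θ ^ n * ‖x‖ ^ p := by
    intro n
    induction n with
    | zero => intro x hx; simpa [picardIter] using hR x hx
    | succ n ih =>
      intro x hx
      have : picardIter L F R (n + 1 + 1) x - picardIter L F R (n + 1) x =
          L x (picardIter L F R (n + 1) (F x) - picardIter L F R n (F x)) := by
        rw [map_sub, picardIter_succ (n + 1), picardIter_succ n x, add_sub_add_right_eq_sub]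
      rw [this, pow_succ, ← mul_assoc]
      exact norm_clm_apply_le_of_contraction hr hp hn hL hx (by positivity) (ih _ (hmaps x hx))
  have step' : ∀ x ∈ Metric.ball (0 : E) δ, ∀ n,
      dist (picardIter L F R n x) (picardIter L F R (n + 1) x) ≤ (C * ‖x‖ ^ p) * θ ^ n := by
    intro x hx n
    rw [dist_comm, dist_eq_norm]
    exact (step n x hx).trans (le_of_eq (by ring))
  have lim : ∀ x : E, ∃ w : W, x ∈ Metric.ball (0 : E) δ →
      Tendsto (fun n => picardIter L F R n x) atTop (𝓝 w) := by
    intro x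
    by_cases hx : x ∈ Metric.ball (0 : E) δ
    · obtain ⟨w, hw⟩ := cauchySeq_tendsto_of_complete
        (cauchySeq_of_le_geometric θ _ hθ (step' x hx))
      exact ⟨w, fun _ => hw⟩
    · exact ⟨0, fun h => absurd h hx⟩
  choose φ hφ using lim
  refine ⟨φ, fun x hx => ?_, C / (1 - θ), div_nonneg hC (by linarith), fun x hx => ?_⟩
  · have h1 := (hφ x hx).comp (tendsto_add_atTop_nat 1)
    have h2 : Tendsto (fun n => L x (picardIter L F R n (F x)) + R x) atTop
        (𝓝 (L x (φ (F x)) + R x)) :=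
      (((L x).continuous.tendsto _).comp (hφ _ (hmaps x hx))).add_const _
    exact tendsto_nhds_unique h1 h2
  · have := dist_le_of_le_geometric_of_tendsto₀ θ _ hθ (step' x hx) (hφ x hx)
    rw [picardIter, dist_zero_left] at this
    exact this.trans (le_of_eq (by ring))

theorem tendstoUniformlyOn_of_norm_sub_le {f : ℕ → E → W} {g : E → W} {s : Set E} {u : ℕ → ℝ}
    (hu : Tendsto u atTop (𝓝 0)) (h : ∀ n, ∀ x ∈ s, ‖f n x - g x‖ ≤ u n) :
    TendstoUniformlyOn f g atTop s := by
  rw [Metric.tendstoUniformlyOn_iff]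
  intro ε hε
  filter_upwards [hu.eventually_lt_const hε] with n hn x hx
  rw [dist_comm, dist_eq_norm]
  exact (h n x hx).trans_lt hn

variable {α : ℝ}

theorem picardIter_continuousOn
    (hmaps : ∀ x ∈ Metric.ball (0 : E) δ, F x ∈ Metric.ball (0 : E) δ)
    (hF : ContinuousOn F (Metric.ball 0 δ)) (hL : ContinuousOn L (Metric.ball 0 δ))
    (hR : ContinuousOn R (Metric.ball 0 δ)) (n : ℕ) :
    ContinuousOn (picardIter L F R n) (Metric.ball 0 δ) := by
  induction n with
  | zero => exact continuousOn_const
  | succ n ih => exact (hL.clm_apply (ih.comp hF hmaps)).add hR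

/-- The case without derivatives: the Picard iterates satisfy a common Hölder estimate. -/
theorem weightedHolder_zero_of_solution (hα : 0 ≤ α) (hδ : δ ≤ 1) (hr : 0 < r)
    (hr1 : r < 1) (hl : 0 ≤ l) (hp : α ≤ p) (hθ : l * r ^ p < 1)
    (hmaps : ∀ x ∈ Metric.ball (0 : E) δ, F x ∈ Metric.ball (0 : E) δ)
    (hn : ∀ x ∈ Metric.ball (0 : E) δ, ‖F x‖ ≤ r * ‖x‖)
    (hlip : ∀ x ∈ Metric.ball (0 : E) δ, ∀ y ∈ Metric.ball (0 : E) δ, ‖F x - F y‖ ≤ r * ‖x - y‖)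
    (hF : ContinuousOn F (Metric.ball 0 δ))
    (hL : ∀ x ∈ Metric.ball (0 : E) δ, ‖L x‖ ≤ l) (hLj : WeightedHolder α δ 0 0 L)
    (hRj : WeightedHolder α δ 0 p R)
    (hφ : ∀ x ∈ Metric.ball (0 : E) δ, φ x = L x (φ (F x)) + R x)
    (hb : ∃ C : ℝ, 0 ≤ C ∧ ∀ x ∈ Metric.ball (0 : E) δ, ‖φ x‖ ≤ C * ‖x‖ ^ p) :
    WeightedHolder α δ 0 p φ := by
  obtain ⟨C₀, hC₀, hb⟩ := hb
  have hp0 : 0 ≤ p := hα.trans hp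
  obtain ⟨cL, CL, hCL, -, hL2⟩ := hLj
  obtain ⟨cR, CR, hCR, -, hR2⟩ := hRj
  have conv := picardIter_sub_le hr.le hp0 hC₀ hl hmaps hn hL hφ hb
  set θ := l * r ^ p with hθd
  have hθ0 : 0 ≤ θ := by positivity
  have hu : Tendsto (fun n : ℕ => C₀ * θ ^ n) atTop (𝓝 0) := by
    simpa using (tendsto_pow_atTop_nhds_zero_of_lt_one hθ0 hθ).const_mul C₀
  have hx1 : ∀ x ∈ Metric.ball (0 : E) δ, ‖x‖ ≤ 1 := fun x hx =>
    (mem_ball_zero_iff.1 hx).le.trans hδ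
  have unif : TendstoUniformlyOn (picardIter L F R) φ atTop (Metric.ball 0 δ) := by
    refine tendstoUniformlyOn_of_norm_sub_le hu fun n x hx => (conv n x hx).trans ?_
    exact mul_le_of_le_one_right (by positivity) (Real.rpow_le_one (norm_nonneg _) (hx1 x hx) hp0)
  -- the fixed point of `H ↦ H θ + 2 C_L C₀ + C_R`: if an iterate has the Hölder constant `H`, the
  -- right-hand side is the Hölder constant of the next one
  set H := (2 * CL * C₀ + CR) / (1 - θ) with hH
  have hH0 : 0 ≤ H := div_nonneg (by positivity) (by linarith)
  have hHθ : H * θ + 2 * CL * C₀ + CR = H := by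
    have : H * (1 - θ) = 2 * CL * C₀ + CR := div_mul_cancel₀ _ (by linarith)
    linarith
  have hpα : 0 ≤ p - α := by linarith
  have hold : ∀ n, ∀ x ∈ Metric.ball (0 : E) δ, ∀ y ∈ Metric.ball (0 : E) δ,
      ‖picardIter L F R n x - picardIter L F R n y‖ ≤
        H * (max ‖x‖ ‖y‖) ^ (p - α) * ‖x - y‖ ^ α := by
    intro n
    induction n with
    | zero => intro x hx y hy; simp only [picardIter, sub_self, norm_zero]; positivity
    | succ n ih =>
      intro x hx y hy
      have hm1 : max ‖x‖ ‖y‖ ≤ 1 := max_le (hx1 x hx) (hx1 y hy)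
      have hxm : ‖x‖ ≤ max ‖x‖ ‖y‖ := le_max_left _ _
      have hym : ‖y‖ ≤ max ‖x‖ ‖y‖ := le_max_right _ _
      set m := max ‖x‖ ‖y‖ with hm
      have hm0 : 0 ≤ m := by positivity
      have hFx : ‖F x‖ ≤ r * m := (hn x hx).trans (by gcongr)
      have hFy : ‖F y‖ ≤ r * m := (hn y hy).trans (by gcongr)
      have e1 : ‖L x (picardIter L F R n (F x) - picardIter L F R n (F y))‖ ≤
          H * θ * (m ^ (p - α) * ‖x - y‖ ^ α) := by
        calc _ ≤ ‖L x‖ * ‖picardIter L F R n (F x) - picardIter L F R n (F y)‖ :=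
              (L x).le_opNorm _
          _ ≤ l * (H * (r * m) ^ (p - α) * (r * ‖x - y‖) ^ α) := by
            gcongr
            · exact hL x hx
            · refine (ih _ (hmaps x hx) _ (hmaps y hy)).trans ?_
              gcongr
              · exact max_le hFx hFy
              · exact hlip x hx y hy
          _ = H * (l * (r ^ (p - α) * r ^ α)) * (m ^ (p - α) * ‖x - y‖ ^ α) := by
            rw [Real.mul_rpow hr.le hm0, Real.mul_rpow hr.le (norm_nonneg _)]; ring
          _ = _ := by rw [← Real.rpow_add hr, sub_add_cancel]
      have e2 : ‖picardIter L F R n (F y)‖ ≤ 2 * C₀ * m ^ (p - α) := by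
        have h1 := conv n _ (hmaps y hy)
        have h2 := hb _ (hmaps y hy)
        have h3 : C₀ * θ ^ n * ‖F y‖ ^ p ≤ C₀ * 1 * ‖F y‖ ^ p := by
          gcongr; exact pow_le_one₀ hθ0 hθ.le
        have h4 : ‖F y‖ ^ p ≤ m ^ (p - α) := by
          calc ‖F y‖ ^ p ≤ m ^ p := by
                gcongr
                exact hFy.trans (mul_le_of_le_one_left hm0 hr1.le)
            _ ≤ _ := rpow_le_rpow_of_le_one hm0 hm1 hpα (by linarith)
        calc _ = ‖(picardIter L F R n (F y) - φ (F y)) + φ (F y)‖ := by simp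
          _ ≤ C₀ * 1 * ‖F y‖ ^ p + C₀ * ‖F y‖ ^ p := norm_add_le_of_le (h1.trans h3) h2
          _ = 2 * C₀ * ‖F y‖ ^ p := by ring
          _ ≤ _ := by gcongr
      have e3 : ‖(L x - L y) (picardIter L F R n (F y))‖ ≤
          2 * CL * C₀ * (m ^ (p - α) * ‖x - y‖ ^ α) := by
        have := hL2 x hx y hy
        rw [max_eq_right (by linarith : 0 - α ≤ 0), Real.rpow_zero, mul_one] at this
        calc _ ≤ ‖L x - L y‖ * ‖picardIter L F R n (F y)‖ := (L x - L y).le_opNorm _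
          _ ≤ (CL * ‖x - y‖ ^ α) * (2 * C₀ * m ^ (p - α)) := by gcongr
          _ = _ := by ring
      have e4 : ‖R x - R y‖ ≤ CR * (m ^ (p - α) * ‖x - y‖ ^ α) := by
        have := hR2 x hx y hy
        rwa [max_eq_left hpα, mul_assoc] at this
      have : picardIter L F R (n + 1) x - picardIter L F R (n + 1) y =
          L x (picardIter L F R n (F x) - picardIter L F R n (F y)) +
          (L x - L y) (picardIter L F R n (F y)) + (R x - R y) := by
        rw [picardIter_succ, picardIter_succ, map_sub, sub_apply]; abel
      rw [this]
      calc _ ≤ _ := norm_add_le_of_le (norm_add_le_of_le e1 e3) e4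
        _ = (H * θ + 2 * CL * C₀ + CR) * (m ^ (p - α) * ‖x - y‖ ^ α) := by ring
        _ = _ := by rw [hHθ]; ring
  refine ⟨unif.continuousOn (Frequently.of_forall (picardIter_continuousOn hmaps hF cL cR)),
    C₀ + H, by positivity, fun x hx => ?_, fun x hx y hy => ?_⟩
  · rw [max_eq_left hp0]
    exact (hb x hx).trans (by gcongr; linarith)
  · rw [max_eq_left hpα]
    have hlim := ((unif.tendsto_at hx).sub (unif.tendsto_at hy)).norm
    refine (le_of_tendsto' hlim fun n => hold n x hx y hy).trans ?_
    gcongr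
    linarith

/-- Any solution of weight `p` is as regular as the data. Its derivative is the solution of the
derived equation `φ₁ x = L x ∘ φ₁ (F x) ∘ DF x + R₁ x` with `R₁ x = DR x + DL x (·) (φ (F x))`,
of weight `p - 1`; the Picard iterates of `φ` converge to `φ` together with their derivatives. -/
theorem weightedHolder_of_solution [CompleteSpace W] (hα : 0 ≤ α) (hα1 : α ≤ 1) (hδ : δ ≤ 1)
    (hr : 0 < r) (hr1 : r < 1) (hl : 0 ≤ l) {j : ℕ} (hp : j + α ≤ p) (hθ : l * r ^ p < 1)
    (hmaps : ∀ x ∈ Metric.ball (0 : E) δ, F x ∈ Metric.ball (0 : E) δ)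
    (hn : ∀ x ∈ Metric.ball (0 : E) δ, ‖F x‖ ≤ r * ‖x‖)
    (hlip : ∀ x ∈ Metric.ball (0 : E) δ, ∀ y ∈ Metric.ball (0 : E) δ, ‖F x - F y‖ ≤ r * ‖x - y‖)
    (hF : WeightedHolder α δ j 1 F)
    (hL : ∀ x ∈ Metric.ball (0 : E) δ, ‖L x‖ ≤ l) (hLj : WeightedHolder α δ j 0 L)
    (hRj : WeightedHolder α δ j p R)
    (hφ : ∀ x ∈ Metric.ball (0 : E) δ, φ x = L x (φ (F x)) + R x)
    (hb : ∃ C : ℝ, 0 ≤ C ∧ ∀ x ∈ Metric.ball (0 : E) δ, ‖φ x‖ ≤ C * ‖x‖ ^ p) :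
    WeightedHolder α δ j p φ := by
  induction j generalizing W p l with
  | zero =>
    exact weightedHolder_zero_of_solution hα hδ hr hr1 hl (by simpa using hp) hθ hmaps hn hlip
      hF.continuousOn hL hLj hRj hφ hb
  | succ j ih =>
    push_cast at hp
    have hj : (0 : ℝ) ≤ j := Nat.cast_nonneg j
    have hφj : WeightedHolder α δ j p φ := ih hl (by linarith) hθ (.of_succ hα hα1 hδ hF) hL
      (.of_succ hα hα1 hδ hLj) (.of_succ hα hα1 hδ hRj) hφ hb
    have hF' := WeightedHolder.of_succ hα hα1 hδ hF
    have hLj' := WeightedHolder.of_succ hα hα1 hδ hLj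
    obtain ⟨-, dF, jF⟩ := hF
    obtain ⟨-, dL, jL⟩ := hLj
    obtain ⟨-, dR, jR⟩ := hRj
    obtain ⟨C₀, hC₀, hb⟩ := hb
    have hp0 : 0 ≤ p := by linarith
    have hp1 : 0 ≤ p - 1 := by linarith
    have conv := picardIter_sub_le hr.le hp0 hC₀ hl hmaps hn hL hφ hb
    have hθ' : l * r * r ^ (p - 1) < 1 := by
      rwa [mul_assoc, ← Real.rpow_one_add' hr.le (by linarith), add_sub_cancel]
    have hθe : l * r * r ^ (p - 1) = l * r ^ p := by
      rw [mul_assoc, ← Real.rpow_one_add' hr.le (by linarith), add_sub_cancel]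
    have hx1 : ∀ x ∈ Metric.ball (0 : E) δ, ‖x‖ ≤ 1 := fun x hx =>
      (mem_ball_zero_iff.1 hx).le.trans hδ
    -- the coefficient and the inhomogeneity of the derived equation
    let B : (W →L[ℝ] W) →L[ℝ] (E →L[ℝ] E) →L[ℝ] ((E →L[ℝ] W) →L[ℝ] (E →L[ℝ] W)) :=
      (ContinuousLinearMap.compL ℝ (E →L[ℝ] W) (E →L[ℝ] W) (E →L[ℝ] W)).bilinearComp
        (ContinuousLinearMap.compL ℝ E W W) (ContinuousLinearMap.compL ℝ E E W).flip
    have hB : ∀ a d ξ, B a d ξ = a.comp (ξ.comp d) := fun a d ξ => rfl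
    let fl : (E →L[ℝ] W →L[ℝ] W) →L[ℝ] W →L[ℝ] (E →L[ℝ] W) :=
      (ContinuousLinearMap.flipₗᵢ ℝ E W W).toContinuousLinearEquiv.toContinuousLinearMap
    have hfl : ∀ a w v, fl a w v = a v w := fun a w v => rfl
    let L₁ : E → (E →L[ℝ] W) →L[ℝ] (E →L[ℝ] W) := fun x => B (L x) (fderiv ℝ F x)
    let R₁ : E → (E →L[ℝ] W) := fun x => fderiv ℝ R x + fl (fderiv ℝ L x) (φ (F x))
    have hL₁j : WeightedHolder α δ j 0 L₁ := by
      have := WeightedHolder.bilin (W₃ := (E →L[ℝ] W) →L[ℝ] (E →L[ℝ] W)) hα hα1 hδ B hLj' jF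
      rwa [sub_self, add_zero] at this
    have hR₁j : WeightedHolder α δ j (p - 1) R₁ := by
      have h1 := WeightedHolder.comp hα hα1 hδ hr.le hmaps hn hlip hφj hF'
      have h2 := WeightedHolder.bilin (W₃ := E →L[ℝ] W) hα hα1 hδ fl jL h1
      rw [show (0 : ℝ) - 1 + p = p - 1 by ring] at h2
      exact jR.add h2
    have hdF : ∀ x ∈ Metric.ball (0 : E) δ, ‖fderiv ℝ F x‖ ≤ r := by
      intro x hx
      refine norm_fderiv_le_of_lip' ℝ hr.le ?_
      filter_upwards [Metric.isOpen_ball.mem_nhds hx] with y hy using hlip y hy x hx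
    have hL₁ : ∀ x ∈ Metric.ball (0 : E) δ, ‖L₁ x‖ ≤ l * r := by
      intro x hx
      refine ContinuousLinearMap.opNorm_le_bound _ (by positivity) fun ξ => ?_
      calc ‖(L x).comp (ξ.comp (fderiv ℝ F x))‖ ≤ ‖L x‖ * (‖ξ‖ * ‖fderiv ℝ F x‖) :=
            (ContinuousLinearMap.opNorm_comp_le _ _).trans
              (by gcongr; exact ContinuousLinearMap.opNorm_comp_le _ _)
        _ ≤ l * (‖ξ‖ * r) := by gcongr; exacts [hL x hx, hdF x hx]
        _ = _ := by ring
    obtain ⟨CR, hCR, hRb⟩ := hR₁j.bound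
    rw [max_eq_left hp1] at hRb
    obtain ⟨φ₁, hφ₁, C₁, hC₁, hb₁⟩ := exists_solution hr.le hp1 hCR (by positivity) hθ' hmaps hn
      hL₁ hRb
    have hφ₁j : WeightedHolder α δ j (p - 1) φ₁ := ih (by positivity) (by linarith) hθ' hF'
      hL₁ hL₁j hR₁j hφ₁ ⟨C₁, hC₁, hb₁⟩
    -- the derivatives of the Picard iterates
    have hd : ∀ n, ∀ x ∈ Metric.ball (0 : E) δ, DifferentiableAt ℝ (picardIter L F R n) x ∧
        fderiv ℝ (picardIter L F R (n + 1)) x = L₁ x (fderiv ℝ (picardIter L F R n) (F x)) +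
          (fderiv ℝ R x + fl (fderiv ℝ L x) (picardIter L F R n (F x))) := by
      have key : ∀ n, (∀ x ∈ Metric.ball (0 : E) δ, DifferentiableAt ℝ (picardIter L F R n) x) →
          ∀ x ∈ Metric.ball (0 : E) δ, HasFDerivAt (picardIter L F R (n + 1))
            (L₁ x (fderiv ℝ (picardIter L F R n) (F x)) +
              (fderiv ℝ R x + fl (fderiv ℝ L x) (picardIter L F R n (F x)))) x := by
        intro n hdn x hx
        have h1 := ((hdn _ (hmaps x hx)).hasFDerivAt.comp x (dF x hx).hasFDerivAt)
        have h2 := ((dL x hx).hasFDerivAt.clm_apply h1).add (dR x hx).hasFDerivAt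
        refine h2.congr_fderiv ?_
        ext v
        simp only [L₁, hB, hfl, add_apply, ContinuousLinearMap.comp_apply,
          ContinuousLinearMap.flip_apply, Function.comp_apply]
        abel
      have hdn : ∀ n, ∀ x ∈ Metric.ball (0 : E) δ, DifferentiableAt ℝ (picardIter L F R n) x := by
        intro n
        induction n with
        | zero => intro x _; exact differentiableAt_const _
        | succ n ihn => exact fun x hx => (key n ihn x hx).differentiableAt
      exact fun n x hx => ⟨hdn n x hx, (key n (hdn n) x hx).fderiv⟩
    obtain ⟨CL, hCL, hLb⟩ := jL.bound
    simp only [zero_sub, Left.neg_nonpos_iff, zero_le_one, sup_of_le_right, Real.rpow_zero,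
      mul_one] at hLb
    set θ := l * r ^ p with hθd
    have hθ0 : 0 ≤ θ := by positivity
    -- the derivatives converge at a rate `η` strictly between `θ` and `1`, which makes room for the
    -- error `C_L C₀ θⁿ` due to the replacement of `φ` by the iterates in `R₁`
    set η := (1 + θ) / 2 with hη
    have hη1 : η < 1 := by rw [hη]; linarith
    have hηθ : 0 < η - θ := by rw [hη]; linarith
    have hη0 : 0 ≤ η := by linarith
    set K := C₁ + CL * C₀ / (η - θ) with hK
    have hK0 : 0 ≤ K := by positivity
    have hKη : θ * K + CL * C₀ ≤ K * η := by
      have : CL * C₀ / (η - θ) * (η - θ) = CL * C₀ := div_mul_cancel₀ _ hηθ.ne'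
      have : 0 ≤ C₁ * (η - θ) := by positivity
      nlinarith
    have conv₁ : ∀ n, ∀ x ∈ Metric.ball (0 : E) δ,
        ‖fderiv ℝ (picardIter L F R n) x - φ₁ x‖ ≤ K * η ^ n * ‖x‖ ^ (p - 1) := by
      intro n
      induction n with
      | zero =>
        intro x hx
        have : fderiv ℝ (picardIter L F R 0) x = 0 := by
          simp only [picardIter]; rw [fderiv_fun_const]; rfl
        rw [this, zero_sub, norm_neg, pow_zero, mul_one]
        refine (hb₁ x hx).trans ?_
        gcongr
        rw [hK]
        exact le_add_of_nonneg_right (by positivity)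
      | succ n ihn =>
        intro x hx
        have e : fderiv ℝ (picardIter L F R (n + 1)) x - φ₁ x =
            L₁ x (fderiv ℝ (picardIter L F R n) (F x) - φ₁ (F x)) +
            fl (fderiv ℝ L x) (picardIter L F R n (F x) - φ (F x)) := by
          rw [(hd n x hx).2, hφ₁ x hx, map_sub, map_sub]
          simp only [R₁]
          abel
        have e1 := norm_clm_apply_le_of_contraction hr.le hp1 hn hL₁ hx (by positivity)
          (ihn _ (hmaps x hx))
        have e2 : ‖fl (fderiv ℝ L x) (picardIter L F R n (F x) - φ (F x))‖ ≤
            CL * (C₀ * θ ^ n * ‖x‖ ^ (p - 1)) := by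
          have h1 : ‖fl (fderiv ℝ L x)‖ ≤ CL := by
            have : ‖fl (fderiv ℝ L x)‖ = ‖fderiv ℝ L x‖ :=
              (ContinuousLinearMap.flipₗᵢ ℝ E W W).norm_map _
            rw [this]; exact hLb x hx
          refine (ContinuousLinearMap.le_opNorm _ _).trans ?_
          gcongr
          refine (conv n _ (hmaps x hx)).trans ?_
          gcongr
          calc ‖F x‖ ^ p ≤ ‖x‖ ^ p := by
                gcongr
                exact (hn x hx).trans (mul_le_of_le_one_left (norm_nonneg _) hr1.le)
            _ ≤ _ := rpow_le_rpow_of_le_one (norm_nonneg _) (hx1 x hx) hp1 (by linarith)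
        rw [e]
        have hpow : θ ^ n ≤ η ^ n := by gcongr; linarith
        calc _ ≤ _ := norm_add_le_of_le e1 e2
          _ = (θ * K * η ^ n + CL * C₀ * θ ^ n) * ‖x‖ ^ (p - 1) := by rw [hθe]; ring
          _ ≤ (θ * K * η ^ n + CL * C₀ * η ^ n) * ‖x‖ ^ (p - 1) := by gcongr
          _ = (θ * K + CL * C₀) * η ^ n * ‖x‖ ^ (p - 1) := by ring
          _ ≤ K * η * η ^ n * ‖x‖ ^ (p - 1) := by gcongr
          _ = _ := by ring
    have hu : ∀ {c t : ℝ}, 0 ≤ t → t < 1 → Tendsto (fun n : ℕ => c * t ^ n) atTop (𝓝 0) := by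
      intro c t h0 h1
      simpa using (tendsto_pow_atTop_nhds_zero_of_lt_one h0 h1).const_mul c
    have unif : TendstoUniformlyOn (picardIter L F R) φ atTop (Metric.ball 0 δ) := by
      refine tendstoUniformlyOn_of_norm_sub_le (hu (c := C₀) hθ0 hθ) fun n x hx =>
        (conv n x hx).trans ?_
      exact mul_le_of_le_one_right (by positivity)
        (Real.rpow_le_one (norm_nonneg _) (hx1 x hx) hp0)
    have unif₁ : TendstoUniformlyOn (fun n => fderiv ℝ (picardIter L F R n)) φ₁ atTop
        (Metric.ball 0 δ) := by
      refine tendstoUniformlyOn_of_norm_sub_le (hu (c := K) hη0 hη1) fun n x hx =>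
        (conv₁ n x hx).trans ?_
      exact mul_le_of_le_one_right (by positivity)
        (Real.rpow_le_one (norm_nonneg _) (hx1 x hx) hp1)
    have hder : ∀ x ∈ Metric.ball (0 : E) δ, HasFDerivAt φ (φ₁ x) x := fun x hx =>
      hasFDerivAt_of_tendstoUniformlyOn Metric.isOpen_ball unif₁
        (fun n x hx => (hd n x hx).1.hasFDerivAt) (fun x hx => unif.tendsto_at hx) hx
    refine ⟨⟨C₀, hC₀, by simpa [max_eq_left hp0] using hb⟩, fun x hx => (hder x hx).differentiableAt,
      hφ₁j.congr fun x hx => (hder x hx).fderiv.symm⟩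

end FunctionalEquation

/-! ### Local `C^{k,α}` regularity between normed spaces -/

section Local

universe u

variable {E E' W W₁ W₂ W₃ : Type u} [NormedAddCommGroup E] [NormedSpace ℝ E]
  [NormedAddCommGroup E'] [NormedSpace ℝ E'] [NormedAddCommGroup W] [NormedSpace ℝ W]
variable {α δ : ℝ}

/-- A Lipschitz map fixing `0` which is `C^{j,α}` has weight `1`. -/
theorem WeightedHolder.one_of_lipschitz (hα : 0 ≤ α) (hα1 : α ≤ 1) (hδ : δ ≤ 1) {K : ℝ}
    (hK : 0 ≤ K) {j : ℕ} {f : E → W} (hf : WeightedHolder α δ j 0 f)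
    (hn : ∀ x ∈ Metric.ball (0 : E) δ, ‖f x‖ ≤ K * ‖x‖)
    (hl : ∀ x ∈ Metric.ball (0 : E) δ, ∀ y ∈ Metric.ball (0 : E) δ, ‖f x - f y‖ ≤ K * ‖x - y‖) :
    WeightedHolder α δ j 1 f := by
  cases j with
  | zero =>
    refine ⟨hf.1, 2 * K, by positivity, fun x hx => (hn x hx).trans ?_, fun x hx y hy =>
      (hl x hx y hy).trans ?_⟩
    · simp only [zero_le_one, sup_of_le_left, Real.rpow_one]
      gcongr
      linarith
    · have hm : max ‖x‖ ‖y‖ ≤ 1 :=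
        max_le ((mem_ball_zero_iff.1 hx).le.trans hδ) ((mem_ball_zero_iff.1 hy).le.trans hδ)
      have := holder_of_lipschitz (x := x) (y := y) (a := 0) hα hα1 hm (le_max_right (1 - α) 0)
        (max_le (by linarith) (by linarith)) rfl
      rw [Real.rpow_zero, one_mul] at this
      calc K * ‖x - y‖ ≤ K * (2 * max ‖x‖ ‖y‖ ^ (max (1 - α) 0) * ‖x - y‖ ^ α) := by gcongr
        _ = _ := by ring
  | succ j =>
    refine ⟨⟨K, hK, fun x hx => by simpa using hn x hx⟩, hf.2.1, ?_⟩
    exact WeightedHolder.mono_weight hα hδ hf.2.2 (Or.inr (by norm_num))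

theorem edist_le_of_norm_sub_le {a C : ℝ≥0} {v w : W} {y z : E}
    (h : ‖v - w‖ ≤ C * ‖y - z‖ ^ (a : ℝ)) : edist v w ≤ C * edist y z ^ (a : ℝ) := by
  rw [edist_nndist, edist_nndist, ← ENNReal.coe_rpow_of_nonneg _ a.coe_nonneg, ← ENNReal.coe_mul,
    ENNReal.coe_le_coe, ← NNReal.coe_le_coe]
  simpa [dist_eq_norm] using h

theorem norm_sub_le_of_edist_le {a C : ℝ≥0} {v w : W} {y z : E}
    (h : edist v w ≤ C * edist y z ^ (a : ℝ)) : ‖v - w‖ ≤ C * ‖y - z‖ ^ (a : ℝ) := by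
  rw [edist_nndist, edist_nndist, ← ENNReal.coe_rpow_of_nonneg _ a.coe_nonneg, ← ENNReal.coe_mul,
    ENNReal.coe_le_coe, ← NNReal.coe_le_coe] at h
  simpa [dist_eq_norm] using h

/-- `f` is of class `C^{j,α}` near `x`: in coordinates centred at `x` it belongs to the Hölder class
of weight `0`, in which the powers of `‖x‖` are absent. -/
def CkaAt (α : ℝ) (j : ℕ) (f : E → W) (x : E) : Prop :=
  ∃ δ : ℝ, 0 < δ ∧ δ ≤ 1 ∧ WeightedHolder α δ j 0 (fun y => f (x + y))

namespace CkaAt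

variable {j : ℕ} {f : E → W} {x : E}

theorem exists_lt (hf : CkaAt α j f x) {ε : ℝ} (hε : 0 < ε) :
    ∃ δ : ℝ, 0 < δ ∧ δ ≤ 1 ∧ δ ≤ ε ∧ WeightedHolder α δ j 0 (fun y => f (x + y)) := by
  obtain ⟨δ, h0, h1, h⟩ := hf
  exact ⟨min δ ε, lt_min h0 hε, (min_le_left _ _).trans h1, min_le_right _ _,
    h.restrict (min_le_left _ _)⟩

theorem _root_.Sternberg.exists_ball_of_eventually {P : E → Prop} (h : ∀ᶠ y in 𝓝 x, P y) :
    ∃ ε > 0, ∀ y ∈ Metric.ball (0 : E) ε, P (x + y) := by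
  obtain ⟨ε, hε, h⟩ := Metric.eventually_nhds_iff.1 h
  exact ⟨ε, hε, fun y hy => h (by simpa using hy)⟩

theorem congr {g : E → W} (hf : CkaAt α j f x) (h : f =ᶠ[𝓝 x] g) : CkaAt α j g x := by
  obtain ⟨ε, hε, he⟩ := exists_ball_of_eventually h
  obtain ⟨δ, h0, h1, h2, h3⟩ := hf.exists_lt hε
  exact ⟨δ, h0, h1, h3.congr fun y hy => he y (Metric.ball_subset_ball h2 hy)⟩

theorem continuousAt (hf : CkaAt α j f x) : ContinuousAt f x := by
  obtain ⟨δ, h0, h1, h2⟩ := hf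
  have : ContinuousAt (fun y => f (x + y)) 0 :=
    h2.continuousOn.continuousAt (Metric.ball_mem_nhds _ h0)
  have h3 : ContinuousAt (fun z => z - x) x := by fun_prop
  have := ContinuousAt.comp (f := fun z => z - x) (x := x) (by simpa using this) h3
  simpa [Function.comp_def] using this

/-- The bound of `f` itself, which is part of the weighted class, is automatic after shrinking the
ball. -/
theorem succ_iff (hα : 0 ≤ α) : CkaAt α (j + 1) f x ↔
    (∀ᶠ y in 𝓝 x, DifferentiableAt ℝ f y) ∧ CkaAt α j (fderiv ℝ f) x := by
  have hfd : fderiv ℝ (fun y => f (x + y)) = fun y => fderiv ℝ f (x + y) := by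
    ext1 y; exact fderiv_comp_add_left x
  constructor
  · rintro ⟨δ, h0, h1, -, h2, h3⟩
    constructor
    · filter_upwards [Metric.ball_mem_nhds x h0] with y hy
      have := h2 (y - x) (by simpa [dist_eq_norm] using hy)
      have h4 : DifferentiableAt ℝ (fun y => f (x + y)) (y - x) := this
      rw [differentiableAt_comp_add_left] at h4
      simpa using h4
    · refine ⟨δ, h0, h1, ?_⟩
      rw [hfd] at h3
      exact h3.mono_weight hα h1 (Or.inr le_rfl)
  · rintro ⟨h, h'⟩
    have hc : ContinuousAt f x := h.self_of_nhds.continuousAt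
    have hb : ∀ᶠ y in 𝓝 x, ‖f y‖ ≤ ‖f x‖ + 1 :=
      (hc.norm.eventually_lt_const (lt_add_one _)).mono fun _ h => h.le
    obtain ⟨ε, hε, he⟩ := exists_ball_of_eventually (h.and hb)
    obtain ⟨δ, h0, h1, h2, h3⟩ := h'.exists_lt hε
    refine ⟨δ, h0, h1, ⟨‖f x‖ + 1, by positivity, fun y hy => ?_⟩, fun y hy => ?_, ?_⟩
    · simpa using (he y (Metric.ball_subset_ball h2 hy)).2
    · exact (differentiableAt_comp_add_left x).2 (he y (Metric.ball_subset_ball h2 hy)).1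
    · rw [hfd]
      exact h3.mono_weight hα h1 (Or.inr (by norm_num))

theorem of_succ (hα : 0 ≤ α) (hα1 : α ≤ 1) (hf : CkaAt α (j + 1) f x) : CkaAt α j f x := by
  obtain ⟨δ, h0, h1, h2⟩ := hf
  exact ⟨δ, h0, h1, h2.of_succ hα hα1 h1⟩

theorem of_le (hα : 0 ≤ α) (hα1 : α ≤ 1) {i : ℕ} (hf : CkaAt α j f x) (h : i ≤ j) :
    CkaAt α i f x := by
  induction h with
  | refl => exact hf
  | step _ ih => exact ih (hf.of_succ hα hα1)

theorem contDiffAt (hα : 0 ≤ α) (hf : CkaAt α j f x) : ContDiffAt ℝ j f x := by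
  induction j generalizing W with
  | zero =>
    obtain ⟨δ, h0, h1, h2, -⟩ := hf
    simp only [CharP.cast_eq_zero]
    refine contDiffAt_zero.2 ⟨Metric.ball x δ, Metric.ball_mem_nhds x h0, fun y hy => ?_⟩
    have h3 : ContinuousOn (fun z => z - x) (Metric.ball x δ) := by fun_prop
    have h4 := (h2.comp h3 (fun z hz => by simpa [dist_eq_norm] using hz)) y hy
    simpa [Function.comp_def] using h4
  | succ j ih =>
    obtain ⟨h1, h2⟩ := (succ_iff hα).1 hf
    push_cast
    refine contDiffAt_succ_iff_hasFDerivAt.2 ⟨fderiv ℝ f, ⟨_, h1, fun y hy => ?_⟩, ih h2⟩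
    exact DifferentiableAt.hasFDerivAt hy

/-- Together with `contDiffAt` and `of_holderOnWith`: `CkaAt` means `Cʲ` with a locally Hölder
continuous `j`-th derivative. -/
theorem exists_holderOnWith {a : ℝ≥0} (hf : CkaAt a j f x) :
    ∃ U ∈ 𝓝 x, ∃ C : ℝ≥0, HolderOnWith C a (iteratedFDeriv ℝ j f) U := by
  induction j generalizing W with
  | zero =>
    obtain ⟨δ, h0, h1, -, C, hC, -, h3⟩ := hf
    refine ⟨Metric.ball x δ, Metric.ball_mem_nhds x h0, C.toNNReal, fun y hy z hz => ?_⟩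
    have := h3 (y - x) (by simpa [dist_eq_norm] using hy) (z - x)
      (by simpa [dist_eq_norm] using hz)
    rw [max_eq_right (by simp : (0 : ℝ) - a ≤ 0)] at this
    simp only [add_sub_cancel, Real.rpow_zero, mul_one, sub_sub_sub_cancel_right] at this
    rw [iteratedFDeriv_zero_eq_comp, Function.comp_apply, Function.comp_apply,
      LinearIsometryEquiv.edist_map]
    exact edist_le_of_norm_sub_le (by rwa [Real.coe_toNNReal C hC])
  | succ j ih =>
    obtain ⟨U, hU, C, h⟩ := ih ((succ_iff a.2).1 hf).2
    refine ⟨U, hU, C, fun y hy z hz => ?_⟩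
    simp only [iteratedFDeriv_succ_eq_comp_right, Function.comp_apply,
      LinearIsometryEquiv.edist_map]
    exact h y hy z hz

theorem of_holderOnWith {a : ℝ≥0} (hf : ContDiffAt ℝ j f x) {U : Set E} (hU : U ∈ 𝓝 x) {C : ℝ≥0}
    (h : HolderOnWith C a (iteratedFDeriv ℝ j f) U) : CkaAt a j f x := by
  induction j generalizing W with
  | zero =>
    obtain ⟨u, hu, hc⟩ := contDiffAt_zero.1 (by simpa using hf)
    have hb : ∀ᶠ y in 𝓝 x, ‖f y‖ ≤ ‖f x‖ + 1 :=
      ((hc.continuousAt hu).norm.eventually_lt_const (lt_add_one _)).mono fun _ h => h.le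
    obtain ⟨ε, hε, he⟩ := exists_ball_of_eventually
      ((Filter.eventually_mem_set.2 hU).and ((Filter.eventually_mem_set.2 hu).and hb))
    have hs := Metric.ball_subset_ball (x := (0 : E)) (min_le_left ε 1)
    refine ⟨min ε 1, by positivity, min_le_right _ _, ?_, ‖f x‖ + 1 + C, by positivity,
      fun y hy => ?_, fun y hy z hz => ?_⟩
    · exact hc.comp (by fun_prop) fun y hy => (he y (hs hy)).2.1
    · have := (he y (hs hy)).2.2
      simp only [max_self, Real.rpow_zero, mul_one]
      exact this.trans (by simp)
    · have := h _ (he y (hs hy)).1 _ (he z (hs hz)).1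
      rw [iteratedFDeriv_zero_eq_comp, Function.comp_apply, Function.comp_apply,
        LinearIsometryEquiv.edist_map] at this
      replace this := norm_sub_le_of_edist_le this
      rw [add_sub_add_left_eq_sub] at this
      rw [max_eq_right (by simp : (0 : ℝ) - a ≤ 0), Real.rpow_zero, mul_one]
      refine this.trans ?_
      gcongr
      linarith [norm_nonneg (f x)]
  | succ j ih =>
    push_cast at hf
    have hf1 := hf
    obtain ⟨f', ⟨u, hu, hd⟩, hf'⟩ := contDiffAt_succ_iff_hasFDerivAt.1 hf
    refine (succ_iff a.2).2 ⟨Filter.mem_of_superset hu fun y hy => (hd y hy).differentiableAt,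
      ih ?_ fun y hy z hz => ?_⟩
    · exact hf'.congr_of_eventuallyEq (Filter.mem_of_superset hu fun y hy => (hd y hy).fderiv)
    · have := h y hy z hz
      simpa only [iteratedFDeriv_succ_eq_comp_right, Function.comp_apply,
        LinearIsometryEquiv.edist_map] using this

/-- A map of class `C^{j+1}` is of class `C^{j,1}`, hence of class `C^{j,α}`. -/
theorem of_contDiffAt (hα : 0 ≤ α) (hα1 : α ≤ 1) (hf : ContDiffAt ℝ (j + 1 : ℕ) f x) :
    CkaAt α j f x := by
  induction j generalizing W with
  | zero =>
    obtain ⟨K, U, hU, hl⟩ := ContDiffAt.exists_lipschitzOnWith (by simpa using hf)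
    have hb : ∀ᶠ y in 𝓝 x, ‖f y‖ ≤ ‖f x‖ + 1 :=
      (hf.continuousAt.norm.eventually_lt_const (lt_add_one _)).mono fun _ h => h.le
    obtain ⟨ε, hε, he⟩ := exists_ball_of_eventually ((Filter.eventually_mem_set.2 hU).and hb)
    have hs := Metric.ball_subset_ball (x := (0 : E)) (min_le_left ε 1)
    refine ⟨min ε 1, by positivity, min_le_right _ _, ?_, ‖f x‖ + 1 + K * 2, by positivity,
      fun y hy => ?_, fun y hy z hz => ?_⟩
    · exact hl.continuousOn.comp (by fun_prop) fun y hy => (he y (hs hy)).1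
    · simp only [max_self, Real.rpow_zero, mul_one]
      exact ((he y (hs hy)).2).trans (le_add_of_nonneg_right (by positivity))
    · have h1 : max ‖y‖ ‖z‖ ≤ 1 := max_le
        ((mem_ball_zero_iff.1 hy).le.trans (min_le_right _ _))
        ((mem_ball_zero_iff.1 hz).le.trans (min_le_right _ _))
      have h2 := WeightedHolder.holder_of_lipschitz (x := y) (y := z) (a := 0) (b := 0) hα hα1 h1
        le_rfl (by linarith) rfl
      have h3 := hl.dist_le_mul _ (he y (hs hy)).1 _ (he z (hs hz)).1
      rw [dist_eq_norm, dist_eq_norm, add_sub_add_left_eq_sub] at h3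
      simp only [Real.rpow_zero, one_mul, mul_one] at h2
      rw [max_eq_right (by linarith : (0 : ℝ) - α ≤ 0), Real.rpow_zero, mul_one]
      calc _ ≤ (K : ℝ) * ‖y - z‖ := h3
        _ ≤ K * (2 * ‖y - z‖ ^ α) := by gcongr
        _ = K * 2 * ‖y - z‖ ^ α := by ring
        _ ≤ _ := by gcongr; linarith [norm_nonneg (f x)]
  | succ j ih =>
    have : ((j + 1 + 1 : ℕ) : WithTop ℕ∞) = (j + 1 : ℕ) + 1 := by push_cast; rfl
    rw [this] at hf
    obtain ⟨f', ⟨u, hu, hd⟩, hf'⟩ := contDiffAt_succ_iff_hasFDerivAt.1 hf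
    exact (succ_iff hα).2 ⟨Filter.mem_of_superset hu fun y hy => (hd y hy).differentiableAt,
      ih (hf'.congr_of_eventuallyEq (Filter.mem_of_superset hu fun y hy => (hd y hy).fderiv))⟩

/-- In coordinates centred at `x` and `f x`, a Lipschitz map of class `C^{j,α}` has weight `1`. -/
theorem exists_weight_one (hα : 0 ≤ α) (hα1 : α ≤ 1) (hf : CkaAt α j f x) {K : ℝ≥0} {U : Set E}
    (hU : U ∈ 𝓝 x) (hl : LipschitzOnWith K f U) {ε : ℝ} (hε : 0 < ε) :
    ∃ δ : ℝ, 0 < δ ∧ δ ≤ 1 ∧ δ ≤ ε ∧ WeightedHolder α δ j 1 (fun y => f (x + y) - f x) ∧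
      (∀ y ∈ Metric.ball (0 : E) δ, ‖f (x + y) - f x‖ ≤ K * ‖y‖) ∧
      ∀ y ∈ Metric.ball (0 : E) δ, ∀ z ∈ Metric.ball (0 : E) δ,
        ‖(f (x + y) - f x) - (f (x + z) - f x)‖ ≤ K * ‖y - z‖ := by
  obtain ⟨ε', hε', he⟩ := exists_ball_of_eventually (Filter.eventually_mem_set.2 hU)
  obtain ⟨δ, h0, h1, h2, h3⟩ := hf.exists_lt (lt_min hε hε')
  have hs := Metric.ball_subset_ball (x := (0 : E)) (h2.trans (min_le_right _ _))
  have hl1 : ∀ y ∈ Metric.ball (0 : E) δ, ‖f (x + y) - f x‖ ≤ K * ‖y‖ := fun y hy => by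
    have := hl.dist_le_mul _ (he y (hs hy)) x (mem_of_mem_nhds hU)
    simpa [dist_eq_norm] using this
  have hl2 : ∀ y ∈ Metric.ball (0 : E) δ, ∀ z ∈ Metric.ball (0 : E) δ,
      ‖(f (x + y) - f x) - (f (x + z) - f x)‖ ≤ K * ‖y - z‖ := fun y hy z hz => by
    have := hl.dist_le_mul _ (he y (hs hy)) _ (he z (hs hz))
    simpa [dist_eq_norm] using this
  exact ⟨δ, h0, h1, h2.trans (min_le_left _ _), .one_of_lipschitz hα hα1 h1 K.2
    (.sub hα hα1 h1 h3 (.const _ _ le_rfl)) hl1 hl2, hl1, hl2⟩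

theorem comp_of_lipschitz (hα : 0 ≤ α) (hα1 : α ≤ 1) {F : E → E'} {f : E' → W} {x : E}
    (hf : CkaAt α j f (F x)) (hF : CkaAt α j F x) {K : ℝ≥0} {U : Set E} (hU : U ∈ 𝓝 x)
    (hl : LipschitzOnWith K F U) : CkaAt α j (fun y => f (F y)) x := by
  obtain ⟨δ', h0', -, hf⟩ := hf
  obtain ⟨δ, h0, h1, h2, hw, hl1, hl2⟩ := hF.exists_weight_one hα hα1 hU hl
    (show 0 < δ' / (K + 1) by positivity)
  refine ⟨δ, h0, h1, ?_⟩
  have := WeightedHolder.comp hα hα1 h1 K.2 (F := fun y => F (x + y) - F x) (δ' := δ')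
    (fun y hy => ?_) hl1 hl2 hf hw
  · simpa using this
  · rw [mem_ball_zero_iff] at *
    calc _ ≤ K * ‖y‖ := hl1 y (by simpa using hy)
      _ ≤ (K + 1) * ‖y‖ := by gcongr; linarith
      _ < (K + 1) * (δ' / (K + 1)) := by gcongr; exact hy.trans_le h2
      _ = δ' := by field_simp

theorem comp (hα : 0 ≤ α) (hα1 : α ≤ 1) (hj : 1 ≤ j) {F : E → E'} {f : E' → W} {x : E}
    (hf : CkaAt α j f (F x)) (hF : CkaAt α j F x) : CkaAt α j (fun y => f (F y)) x := by
  obtain ⟨K, U, hU, hl⟩ := ContDiffAt.exists_lipschitzOnWith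
    ((hF.contDiffAt hα).of_le (by exact_mod_cast hj))
  exact comp_of_lipschitz hα hα1 hf hF hU hl

/-- For `j = 0` the inner map is not Lipschitz, so that the outer one has to be. -/
theorem contDiffAt_comp (hα : 0 ≤ α) (hα1 : α ≤ 1) {F : E → E'} {f : E' → W} {x : E}
    (hf : ContDiffAt ℝ (j + 1 : ℕ) f (F x)) (hF : CkaAt α j F x) :
    CkaAt α j (fun y => f (F y)) x := by
  cases j with
  | succ j => exact comp hα hα1 (by omega) (of_contDiffAt hα hα1 hf) hF
  | zero =>
    have hfc := hf.continuousAt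
    obtain ⟨K, U, hU, hl⟩ := ContDiffAt.exists_lipschitzOnWith (by simpa using hf)
    have hFc := hF.continuousAt
    have hb : ∀ᶠ y in 𝓝 x, ‖f (F y)‖ ≤ ‖f (F x)‖ + 1 :=
      ((hfc.comp hFc).norm.eventually_lt_const (lt_add_one _)).mono fun _ h => h.le
    obtain ⟨ε, hε, he⟩ := exists_ball_of_eventually ((hFc.eventually_mem hU).and hb)
    obtain ⟨δ, h0, h1, h2, hc, C, hC, -, h3⟩ := hF.exists_lt hε
    have hs := Metric.ball_subset_ball (x := (0 : E)) h2
    refine ⟨δ, h0, h1, hl.continuousOn.comp hc fun y hy => (he y (hs hy)).1,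
      ‖f (F x)‖ + 1 + K * C, by positivity, fun y hy => ?_, fun y hy z hz => ?_⟩
    · simp only [max_self, Real.rpow_zero, mul_one]
      exact ((he y (hs hy)).2).trans (le_add_of_nonneg_right (by positivity))
    · have h4 := hl.dist_le_mul _ (he y (hs hy)).1 _ (he z (hs hz)).1
      rw [dist_eq_norm, dist_eq_norm] at h4
      calc _ ≤ (K : ℝ) * ‖F (x + y) - F (x + z)‖ := h4
        _ ≤ K * (C * max ‖y‖ ‖z‖ ^ (max (0 - α) 0) * ‖y - z‖ ^ α) := by
          gcongr; exact h3 y hy z hz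
        _ = K * C * max ‖y‖ ‖z‖ ^ (max (0 - α) 0) * ‖y - z‖ ^ α := by ring
        _ ≤ _ := by gcongr; linarith [norm_nonneg (f (F x))]

theorem clm_comp (hα : 0 ≤ α) (hα1 : α ≤ 1) [NormedAddCommGroup W₁] [NormedSpace ℝ W₁]
    (L : W →L[ℝ] W₁) (hf : CkaAt α j f x) : CkaAt α j (fun y => L (f y)) x := by
  obtain ⟨δ, h0', h1', h2'⟩ := hf
  exact ⟨δ, h0', h1', .clm_comp hα hα1 h1' L h2'⟩

theorem add {g : E → W} (hf : CkaAt α j f x) (hg : CkaAt α j g x) :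
    CkaAt α j (fun y => f y + g y) x := by
  obtain ⟨ε, h0, h1, h2⟩ := hf
  obtain ⟨δ, h0', h1', h2', h3'⟩ := hg.exists_lt h0
  exact ⟨δ, h0', h1', (h2.restrict h2').add h3'⟩

theorem sub (hα : 0 ≤ α) (hα1 : α ≤ 1) {g : E → W} (hf : CkaAt α j f x) (hg : CkaAt α j g x) :
    CkaAt α j (fun y => f y - g y) x := by
  simpa [sub_eq_add_neg] using hf.add (hg.clm_comp hα hα1 (-ContinuousLinearMap.id ℝ W))

/-- The inverse of a `C^{j,α}` map is `C^{j,α}` as soon as it is `C¹`, by induction from the formula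
`Dg = (Df ∘ g)⁻¹`. -/
theorem of_local_inverse [CompleteSpace E] (hα : 0 ≤ α) (hα1 : α ≤ 1) {f g : E → E} {y : E}
    (hf : CkaAt α j f (g y)) (hg : ContDiffAt ℝ 1 g y)
    (hfg : ∀ᶠ z in 𝓝 y, f (g z) = z) (hgf : ∀ᶠ z in 𝓝 (g y), g (f z) = z) :
    CkaAt α j g y := by
  obtain ⟨K, U, hU, hl⟩ := hg.exists_lipschitzOnWith
  have main : ∀ i ≤ j, CkaAt α i g y := by
    intro i
    induction i with
    | zero => exact fun _ => of_contDiffAt hα hα1 (by simpa using hg)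
    | succ i ih =>
      intro hi
      have hgi := ih (by omega)
      have hdg : ∀ᶠ z in 𝓝 y, DifferentiableAt ℝ g z :=
        (hg.eventually (by simp)).mono fun z hz => hz.differentiableAt (by simp)
      have hfi := hf.of_le hα hα1 hi
      obtain ⟨hdf, hDf⟩ := (succ_iff hα).1 hfi
      have hfy : f (g y) = y := hfg.self_of_nhds
      have two : ∀ᶠ z in 𝓝 y, fderiv ℝ f (g z) * fderiv ℝ g z = 1 ∧
          fderiv ℝ g z * fderiv ℝ f (g z) = 1 := by
        filter_upwards [hdg, hg.continuousAt.eventually hdf,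
          hfg.eventually_nhds, hg.continuousAt.eventually hgf.eventually_nhds, hfg]
          with z h1 h2 h3 h4 h5
        constructor
        · have a := (h2.hasFDerivAt.comp z h1.hasFDerivAt)
          have b : HasFDerivAt (f ∘ g) (1 : E →L[ℝ] E) z :=
            (hasFDerivAt_id z).congr_of_eventuallyEq h3
          exact a.unique b
        · have a := ((h5.symm ▸ h1 : DifferentiableAt ℝ g (f (g z))).hasFDerivAt.comp (g z)
            h2.hasFDerivAt)
          rw [h5] at a
          have b : HasFDerivAt (g ∘ f) (1 : E →L[ℝ] E) (g z) :=
            (hasFDerivAt_id (g z)).congr_of_eventuallyEq h4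
          exact a.unique b
      have inv : ∀ᶠ z in 𝓝 y, Ring.inverse (fderiv ℝ f (g z)) = fderiv ℝ g z := by
        filter_upwards [two] with z hz
        exact Ring.inverse_unit ⟨_, _, hz.1, hz.2⟩
      refine (succ_iff hα).2 ⟨hdg, ?_⟩
      refine CkaAt.congr ?_ inv
      have h1 : CkaAt α i (fun z => fderiv ℝ f (g z)) y :=
        comp_of_lipschitz hα hα1 hDf hgi hU hl
      have h2 : ContDiffAt ℝ (i + 1 : ℕ) (Ring.inverse : (E →L[ℝ] E) → _) (fderiv ℝ f (g y)) := by
        obtain ⟨a, b⟩ := two.self_of_nhds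
        exact contDiffAt_ringInverse ℝ (⟨_, _, a, b⟩ : (E →L[ℝ] E)ˣ)
      exact contDiffAt_comp hα hα1 h2 h1
  exact main j le_rfl

end CkaAt

end Local

/-! ### Symmetry and leading terms of higher derivatives -/

section Jets

universe u

variable {E F G : Type u} [NormedAddCommGroup E] [NormedSpace ℝ E]
  [NormedAddCommGroup F] [NormedSpace ℝ F] [NormedAddCommGroup G] [NormedSpace ℝ G]

/-- The `n`-th derivative of a `Cⁿ` map is symmetric. Permutations are generated by swaps of
neighbours; such a swap fixes the first or the last index unless `n ≤ 2`. -/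
theorem iteratedFDeriv_comp_perm_of_contDiffAt {n : ℕ} {f : E → F} {x : E}
    (hf : ContDiffAt ℝ n f x) (σ : Equiv.Perm (Fin n)) (v : Fin n → E) :
    iteratedFDeriv ℝ n f x (fun i => v (σ i)) = iteratedFDeriv ℝ n f x v := by
  induction n generalizing F f x with
  | zero => congr 1; ext i; exact i.elim0
  | succ m ih =>
    have hσ : σ ∈ Submonoid.closure
        (range fun i : Fin m => Equiv.swap i.castSucc i.succ) := by
      rw [Equiv.Perm.mclosure_swap_castSucc_succ]; trivial
    induction hσ using Submonoid.closure_induction generalizing v with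
    | one => rfl
    | mul σ τ _ _ hσ hτ =>
      have := hτ (fun i => v (σ i))
      simp only [Equiv.Perm.mul_apply]
      rw [this, hσ]
    | mem s hs =>
      obtain ⟨i, rfl⟩ := hs
      have hf1 := hf
      push_cast at hf1
      obtain ⟨f', ⟨u, hu, hd⟩, hf'⟩ := contDiffAt_succ_iff_hasFDerivAt.1 hf1
      have hDf : ContDiffAt ℝ m (fderiv ℝ f) x :=
        hf'.congr_of_eventuallyEq (Filter.mem_of_superset hu fun y hy => (hd y hy).fderiv)
      rcases m with _ | m
      · exact i.elim0
      rcases Fin.eq_castSucc_or_eq_last i with ⟨i, rfl⟩ | rfl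
      · -- the swap fixes the last index
        rw [iteratedFDeriv_succ_apply_right (n := m + 1),
          iteratedFDeriv_succ_apply_right (n := m + 1)]
        have h1 : Equiv.swap i.castSucc.castSucc i.castSucc.succ (Fin.last (m + 1)) =
            Fin.last (m + 1) := by
          refine Equiv.swap_apply_of_ne_of_ne ?_ ?_
          · exact (Fin.castSucc_lt_last _).ne'
          · rw [Fin.succ_castSucc]; exact (Fin.castSucc_lt_last _).ne'
        have h2 : (Fin.init fun a => v (Equiv.swap i.castSucc.castSucc i.castSucc.succ a)) =
            fun a => Fin.init v (Equiv.swap i.castSucc i.succ a) := by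
          funext a
          simp only [Fin.init, Fin.succ_castSucc]
          rw [(Fin.castSucc_injective _).map_swap]
        rw [h1, h2, ih hDf]
      · rcases Nat.eq_zero_or_pos m with rfl | hm
        · -- the second derivative
          have hsymm := hf.isSymmSndFDerivAt (by simp)
          rw [iteratedFDeriv_two_apply, iteratedFDeriv_two_apply, hsymm.eq]
          rfl
        · -- the swap fixes the first index
          obtain ⟨m, rfl⟩ : ∃ m', m = m' + 1 := ⟨m - 1, by omega⟩
          rw [iteratedFDeriv_succ_apply_left (n := m + 1 + 1),
            iteratedFDeriv_succ_apply_left (n := m + 1 + 1)]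
          have h1 : Equiv.swap (Fin.last (m + 1)).castSucc (Fin.last (m + 1)).succ 0 = 0 := by
            refine Equiv.swap_apply_of_ne_of_ne ?_ ?_ <;> simp [Fin.ext_iff]
          have h2 : (Fin.tail fun a =>
              v (Equiv.swap (Fin.last (m + 1)).castSucc (Fin.last (m + 1)).succ a)) =
              fun a => Fin.tail v (Equiv.swap (Fin.last m).castSucc (Fin.last m).succ a) := by
            funext a
            simp only [Fin.tail]
            rw [(Fin.succ_injective _).map_swap]
            rfl
          rw [h1, h2]
          have hd1 : DifferentiableAt ℝ (iteratedFDeriv ℝ (m + 1 + 1) f) x :=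
            hf.differentiableAt_iteratedFDeriv (by norm_cast; omega)
          rw [← fderiv_continuousMultilinear_apply_const_apply hd1,
            ← fderiv_continuousMultilinear_apply_const_apply hd1]
          have hev : ∀ᶠ y in 𝓝 x, ContDiffAt ℝ (m + 1 + 1 : ℕ) f y :=
            (hf.of_le (by norm_cast; omega)).eventually (by simp)
          congr 1
          exact Filter.EventuallyEq.fderiv_eq (hev.mono fun y hy => ih hy _ _)

/-- A partition of `n` points into `n` blocks is the discrete one; the order of the blocks leaves no
freedom. -/
theorem OrderedFinpartition_eq_atomic {n : ℕ} (c : OrderedFinpartition n) (h : c.length = n) :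
    c = OrderedFinpartition.atomic n := by
  have hsum : ∑ m : Fin c.length, c.partSize m = n := by
    have := Fintype.card_congr c.equivSigma
    simpa using this
  have hone : ∀ m, c.partSize m = 1 := by
    have : ∑ m : Fin c.length, 1 = ∑ m : Fin c.length, c.partSize m := by simp [hsum, h]
    intro m
    exact ((Finset.sum_eq_sum_iff_of_le fun i _ => c.partSize_pos i).1 this m
      (Finset.mem_univ _)).symm
  rcases c with ⟨length, partSize, pos, emb, mono, parts, disj, cover⟩
  dsimp only at h hone parts
  subst h
  obtain rfl : partSize = fun _ => 1 := funext hone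
  have hs : StrictMono fun m => emb m 0 := parts
  have hid : ∀ m, emb m 0 = m := by
    intro m
    have hsurj : Function.Surjective fun m => emb m 0 :=
      Finite.injective_iff_surjective.1 hs.injective
    have : hs.orderIsoOfSurjective _ hsurj = OrderIso.refl _ := Subsingleton.elim _ _
    exact DFunLike.congr_fun this m
  obtain rfl : emb = fun m _ => m := by
    ext m r
    rw [Subsingleton.elim r 0, hid]
  rfl

/-- Faà di Bruno's formula up to the first order at which `f` does not vanish. -/
theorem iteratedFDeriv_comp_of_vanishing {f : F → G} {g : E → F} {x : E} {j : ℕ}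
    (hf : ContDiffAt ℝ j f (g x)) (hg : ContDiffAt ℝ j g x)
    (h0 : ∀ i < j, iteratedFDeriv ℝ i f (g x) = 0) {i : ℕ} (hi : i ≤ j) (v : Fin i → E) :
    iteratedFDeriv ℝ i (fun y => f (g y)) x v =
      iteratedFDeriv ℝ i f (g x) (fun a => fderiv ℝ g x (v a)) := by
  have hc := iteratedFDeriv_comp hf hg (i := i) (by exact_mod_cast hi)
  change iteratedFDeriv ℝ i (f ∘ g) x v = _
  rw [hc, FormalMultilinearSeries.taylorComp, sum_apply,
    Finset.sum_eq_single (OrderedFinpartition.atomic i)]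
  · rw [FormalMultilinearSeries.compAlongOrderedFinpartition_apply]
    have : ∀ a, (OrderedFinpartition.atomic i).applyOrderedFinpartition
        (fun m => ftaylorSeries ℝ g x ((OrderedFinpartition.atomic i).partSize m)) v a =
        fderiv ℝ g x (v a) := fun a => by
      exact iteratedFDeriv_one_apply _
    change iteratedFDeriv ℝ i f (g x) _ = _
    congr 1
    funext a
    exact this a
  · intro c _ hc
    have hlt : c.length < j := by
      refine lt_of_lt_of_le (lt_of_le_of_ne c.length_le fun h => hc ?_) hi
      exact OrderedFinpartition_eq_atomic c h
    rw [FormalMultilinearSeries.compAlongOrderedFinpartition_apply]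
    change iteratedFDeriv ℝ c.length f (g x) _ = 0
    rw [h0 _ hlt]; rfl
  · simp

theorem iteratedFDeriv_diagonal_of_lt {j i : ℕ} (K : E [×j]→L[ℝ] F) (hi : i < j) :
    iteratedFDeriv ℝ i (fun x : E => K fun _ => x) 0 = 0 := by
  let g : E →L[ℝ] (Fin j → E) := ContinuousLinearMap.pi fun _ => ContinuousLinearMap.id ℝ E
  change iteratedFDeriv ℝ i (K ∘ g) 0 = 0
  rw [ContinuousLinearMap.iteratedFDeriv_comp_right _ K.contDiff _ le_rfl, K.iteratedFDeriv_eq]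
  have : K.iteratedFDeriv i (g 0) = 0 := by
    have h := K.norm_iteratedFDeriv_le' i (g 0)
    rw [map_zero, norm_zero, Fintype.card_fin, zero_pow (by omega), mul_zero] at h
    rw [map_zero]
    exact norm_le_zero_iff.1 h
  rw [this]; rfl

theorem contDiff_diagonal {j : ℕ} (K : E [×j]→L[ℝ] F) {n : WithTop ℕ∞} :
    ContDiff ℝ n (fun x : E => K fun _ => x) := by
  let g : E →L[ℝ] (Fin j → E) := ContinuousLinearMap.pi fun _ => ContinuousLinearMap.id ℝ E
  exact K.contDiff.comp g.contDiff

end Jets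

/-! ### The homological operator and nonresonance -/

section Homological

open Polynomial

/-- An eigenvalue of a product of commuting endomorphisms is the product of two eigenvalues. -/
theorem exists_mul_eq_of_hasEigenvalue_mul {V : Type*} [AddCommGroup V] [Module ℂ V]
    [Module.Finite ℂ V] {a b : Module.End ℂ V} (hab : Commute a b) {z : ℂ}
    (hz : (a * b).HasEigenvalue z) :
    ∃ α β : ℂ, a.HasEigenvalue α ∧ b.HasEigenvalue β ∧ z = α * β := by
  have hmaps : ∀ {c d : Module.End ℂ V} {w : ℂ}, Commute c d → ∀ y ∈ d.eigenspace w,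
      c y ∈ d.eigenspace w := by
    intro c d w hcd y hy
    rw [Module.End.mem_eigenspace_iff] at *
    have : d (c y) = c (d y) := (LinearMap.congr_fun hcd.eq y).symm
    rw [this, hy, map_smul]
  have h1 : ∀ y ∈ (a * b).eigenspace z, a y ∈ (a * b).eigenspace z :=
    hmaps ((Commute.refl a).mul_right hab)
  have : Nontrivial ((a * b).eigenspace z) := Submodule.nontrivial_iff_ne_bot.2 hz
  obtain ⟨α, hα⟩ := Module.End.exists_eigenvalue (LinearMap.restrict a h1)
  obtain ⟨⟨y, hy⟩, hya, hy0⟩ := hα.exists_hasEigenvector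
  rw [Module.End.mem_eigenspace_iff] at hya
  have hya' : a y = α • y := congrArg Subtype.val hya
  have hyn : y ≠ 0 := fun h => hy0 (by ext; exact h)
  let S : Submodule ℂ V := (a * b).eigenspace z ⊓ a.eigenspace α
  have h2 : ∀ y ∈ S, b y ∈ S := fun y hy =>
    ⟨hmaps (hab.symm.mul_right (Commute.refl b)) y hy.1, hmaps hab.symm y hy.2⟩
  have hS : Nontrivial S := by
    refine Submodule.nontrivial_iff_ne_bot.2 fun h => hyn ?_
    have : y ∈ S := ⟨hy, Module.End.mem_eigenspace_iff.2 hya'⟩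
    rwa [h, Submodule.mem_bot] at this
  obtain ⟨β, hβ⟩ := Module.End.exists_eigenvalue (LinearMap.restrict b h2)
  obtain ⟨⟨w, hw⟩, hwb, hw0⟩ := hβ.exists_hasEigenvector
  rw [Module.End.mem_eigenspace_iff] at hwb
  have hwb' : b w = β • w := congrArg Subtype.val hwb
  have hwn : w ≠ 0 := fun h => hw0 (by ext; exact h)
  have hwa : a w = α • w := Module.End.mem_eigenspace_iff.1 hw.2
  refine ⟨α, β, Module.End.hasEigenvalue_of_hasEigenvector
    ⟨Module.End.mem_eigenspace_iff.2 hwa, hwn⟩, Module.End.hasEigenvalue_of_hasEigenvector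
    ⟨Module.End.mem_eigenspace_iff.2 hwb', hwn⟩, ?_⟩
  have h3 : a (b w) = z • w := Module.End.mem_eigenspace_iff.1 hw.1
  rw [hwb', map_smul, hwa, smul_smul] at h3
  exact smul_left_injective ℂ hwn (by simpa [mul_comm] using h3.symm)

variable {V M : Type*} [AddCommGroup V] [Module ℝ V] [AddCommGroup M] [Module ℝ M]

/-- `z` is an eigenvalue of the complexification of `T`. -/
def IsComplexEigenvalue [Module.Finite ℝ V] (T : Module.End ℝ V) (z : ℂ) : Prop :=
  Module.End.HasEigenvalue (LinearMap.baseChange ℂ T : Module.End ℂ (ℂ ⊗[ℝ] V)) z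

theorem isComplexEigenvalue_iff [Module.Finite ℝ V] (T : Module.End ℝ V) (z : ℂ) :
    IsComplexEigenvalue T z ↔ aeval z T.charpoly = 0 := by
  rw [IsComplexEigenvalue, Module.End.hasEigenvalue_iff_isRoot_charpoly,
    LinearMap.charpoly_baseChange, IsRoot.def, eval_map_algebraMap]

/-- A complex eigenvalue is a root of every real polynomial which annihilates the operator. -/
theorem IsComplexEigenvalue.aeval_eq_zero [Module.Finite ℝ V] {T : Module.End ℝ V} {z : ℂ}
    (hz : IsComplexEigenvalue T z) {q : ℝ[X]} (hq : aeval T q = 0) : aeval z q = 0 := by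
  obtain ⟨y, hy⟩ := hz.exists_hasEigenvector
  have h1 := Module.End.aeval_apply_of_hasEigenvector (p := q.map (algebraMap ℝ ℂ)) hy
  have h2 : aeval (LinearMap.baseChange ℂ T : Module.End ℂ (ℂ ⊗[ℝ] V)) q = 0 := by
    have := Polynomial.aeval_algHom_apply (Module.End.baseChangeHom ℝ ℂ V) T q
    rw [hq, map_zero] at this
    exact this
  rw [aeval_map_algebraMap, h2, eval_map_algebraMap] at h1
  exact (smul_eq_zero.1 h1.symm).resolve_right hy.2

theorem IsComplexEigenvalue.of_inverse [Module.Finite ℝ V] {A B : Module.End ℝ V}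
    (hAB : A * B = 1) {z : ℂ} (hz : IsComplexEigenvalue B z) :
    z ≠ 0 ∧ IsComplexEigenvalue A z⁻¹ := by
  obtain ⟨y, hy, hy0⟩ := hz.exists_hasEigenvector
  rw [Module.End.mem_eigenspace_iff] at hy
  have h : (LinearMap.baseChange ℂ A) ((LinearMap.baseChange ℂ B) y) = y := by
    have : (LinearMap.baseChange ℂ A) * (LinearMap.baseChange ℂ B) =
        (1 : Module.End ℂ (ℂ ⊗[ℝ] V)) := by
      rw [← LinearMap.baseChange_mul, hAB, LinearMap.baseChange_one]
    exact LinearMap.congr_fun this y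
  rw [hy, map_smul] at h
  have hz0 : z ≠ 0 := fun h0 => hy0 (by rw [← h, h0, zero_smul])
  refine ⟨hz0, Module.End.hasEigenvalue_of_hasEigenvector
    ⟨Module.End.mem_eigenspace_iff.2 (?_ : (LinearMap.baseChange ℂ A) y = z⁻¹ • y), hy0⟩⟩
  nth_rewrite 2 [← h]
  rw [smul_smul, inv_mul_cancel₀ hz0, one_smul]

/-- Composition on the left with an endomorphism. -/
def postComp (V : Type*) [AddCommGroup V] [Module ℝ V] (T : Module.End ℝ M) :
    Module.End ℝ (V →ₗ[ℝ] M) where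
  toFun f := T ∘ₗ f
  map_add' _ _ := LinearMap.comp_add _ _ _
  map_smul' _ _ := LinearMap.comp_smul _ _ _

/-- Composition on the right with an endomorphism. -/
def preComp (M : Type*) [AddCommGroup M] [Module ℝ M] (A : Module.End ℝ V) :
    Module.End ℝ (V →ₗ[ℝ] M) where
  toFun f := f ∘ₗ A
  map_add' _ _ := LinearMap.add_comp _ _ _
  map_smul' _ _ := LinearMap.smul_comp _ _ _

theorem aeval_postComp (T : Module.End ℝ M) (q : ℝ[X]) :
    aeval (postComp V T) q = postComp V (aeval T q) := by
  induction q using Polynomial.induction_on' with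
  | add p q hp hq => rw [map_add, map_add, hp, hq]; ext f v; simp [postComp]
  | monomial n c =>
    have : ∀ n : ℕ, postComp V T ^ n = postComp V (T ^ n) := by
      intro n
      induction n with
      | zero => ext f v; simp [postComp]
      | succ n ih => rw [pow_succ', pow_succ', ih]; ext f v; simp [postComp]
    rw [aeval_monomial, aeval_monomial, this]
    ext f v
    simp [postComp]

theorem aeval_preComp (A : Module.End ℝ V) (q : ℝ[X]) :
    aeval (preComp M A) q = preComp M (aeval A q) := by
  induction q using Polynomial.induction_on' with
  | add p q hp hq => rw [map_add, map_add, hp, hq]; ext f v; simp [preComp]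
  | monomial n c =>
    have : ∀ n : ℕ, preComp M A ^ n = preComp M (A ^ n) := by
      intro n
      induction n with
      | zero => ext f v; simp [preComp]
      | succ n ih => rw [pow_succ', pow_succ, ih]; ext f v; simp [preComp]
    rw [aeval_monomial, aeval_monomial, this]
    ext f v
    simp [preComp]

/-- Every complex eigenvalue of `f ↦ T ∘ f ∘ A` is a product of eigenvalues of `T` and `A`. -/
theorem IsComplexEigenvalue.postComp_mul_preComp [Module.Finite ℝ V] [Module.Finite ℝ M]
    {T : Module.End ℝ M} {A : Module.End ℝ V} {z : ℂ}
    (hz : IsComplexEigenvalue (postComp V T * preComp M A) z) :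
    ∃ α β : ℂ, IsComplexEigenvalue T α ∧ IsComplexEigenvalue A β ∧ z = α * β := by
  have hc : Commute (postComp V T) (preComp M A) := by
    ext f v; simp [postComp, preComp]
  rw [IsComplexEigenvalue, LinearMap.baseChange_mul] at hz
  have hc' : Commute (LinearMap.baseChange ℂ (postComp V T))
      (LinearMap.baseChange ℂ (preComp M A)) := by
    rw [commute_iff_eq, ← LinearMap.baseChange_mul, ← LinearMap.baseChange_mul, hc.eq]
  obtain ⟨α, β, hα, hβ, h⟩ := exists_mul_eq_of_hasEigenvalue_mul hc' hz
  refine ⟨α, β, (isComplexEigenvalue_iff _ _).2 ?_, (isComplexEigenvalue_iff _ _).2 ?_, h⟩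
  · refine IsComplexEigenvalue.aeval_eq_zero (T := postComp V T) hα ?_
    rw [aeval_postComp, LinearMap.aeval_self_charpoly]; ext; simp [postComp]
  · refine IsComplexEigenvalue.aeval_eq_zero (T := preComp M A) hβ ?_
    rw [aeval_preComp, LinearMap.aeval_self_charpoly]; ext; simp [preComp]

/-- The operator `K ↦ B ∘ K ∘ (A × ⋯ × A)` on multilinear maps. -/
def conjMultilinear (B A : Module.End ℝ V) (j : ℕ) :
    Module.End ℝ (MultilinearMap ℝ (fun _ : Fin j => V) V) where
  toFun K := B.compMultilinearMap (K.compLinearMap fun _ => A)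
  map_add' _ _ := by ext; simp
  map_smul' _ _ := by ext; simp

/-- Every complex eigenvalue of `K ↦ B ∘ K ∘ (A × ⋯ × A)` is the product of an eigenvalue of `B` and
`j` eigenvalues of `A`: by currying, the operator for `j + 1` is `f ↦ T ∘ f ∘ A` on linear maps from
`V` to multilinear maps in `j` variables, `T` being the operator for `j`. -/
theorem IsComplexEigenvalue.conjMultilinear [Module.Finite ℝ V] {B A : Module.End ℝ V} {j : ℕ}
    {z : ℂ} (hz : IsComplexEigenvalue (conjMultilinear B A j) z) :
    ∃ β : ℂ, IsComplexEigenvalue B β ∧ ∃ l : Fin j → ℂ, (∀ i, IsComplexEigenvalue A (l i)) ∧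
      z = β * ∏ i, l i := by
  induction j generalizing z with
  | zero =>
    let e : MultilinearMap ℝ (fun _ : Fin 0 => V) V ≃ₗ[ℝ] V :=
      (MultilinearMap.constLinearEquivOfIsEmpty ℝ ℝ (fun _ : Fin 0 => V) V).symm
    have : e.conj (Sternberg.conjMultilinear B A 0) = B := by
      ext v
      rfl
    rw [isComplexEigenvalue_iff, ← LinearEquiv.charpoly_conj e, this,
      ← isComplexEigenvalue_iff] at hz
    exact ⟨z, hz, fun i => i.elim0, fun i => i.elim0, by simp⟩
  | succ j ih =>
    let e := multilinearCurryLeftEquiv ℝ (fun _ : Fin (j + 1) => V) V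
    have : e.conj (Sternberg.conjMultilinear B A (j + 1)) =
        postComp V (Sternberg.conjMultilinear B A j) * preComp _ A := by
      ext f v w
      change B _ = B _
      congr 1
    rw [isComplexEigenvalue_iff, ← LinearEquiv.charpoly_conj e, this,
      ← isComplexEigenvalue_iff] at hz
    obtain ⟨α, γ, hα, hγ, rfl⟩ := IsComplexEigenvalue.postComp_mul_preComp hz
    obtain ⟨β, hβ, l, hl, rfl⟩ := ih hα
    refine ⟨β, hβ, Fin.cons γ l, fun i => ?_, ?_⟩
    · refine Fin.cases ?_ (fun i => ?_) i
      · simpa using hγ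
      · simpa using hl i
    · rw [Fin.prod_cons]; ring

/-- Nonresonance for products of `j` eigenvalues, with repetitions, instead of products of powers
`λ₁ ^ m₁ ⋯ λₙ ^ mₙ` over the list of all eigenvalues. -/
theorem IsNonresonant.ne_prod {V W : Type*} [AddCommGroup V] [Module ℂ V] [Module.Finite ℂ V]
    [AddCommGroup W] [Module ℂ W] [Module.Finite ℂ W] {X : Module.End ℂ V} {Y : Module.End ℂ W}
    {k : ℕ∞} (h : IsNonresonant X Y k) {j : ℕ} (h2 : 2 ≤ j) (hj : (j : ℕ∞) ≤ k) {μ : ℂ}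
    (hμ : X.HasEigenvalue μ) {l : Fin j → ℂ} (hl : ∀ i, Y.HasEigenvalue (l i)) :
    μ ≠ ∏ i, l i := by
  classical
  have mem' : ∀ i, l i ∈ eigenvalues Y := by
    intro i
    rw [eigenvalues, Polynomial.mem_roots (LinearMap.charpoly_monic Y).ne_zero]
    exact (Module.End.hasEigenvalue_iff_isRoot_charpoly _ _).1 (hl i)
  let t : Fin j → (eigenvalues Y).ToType := fun i =>
    Multiset.mkToType _ (l i) ⟨0, Multiset.count_pos.2 (mem' i)⟩
  let m : (eigenvalues Y).ToType → ℕ := fun s => (Finset.univ.filter fun i => t i = s).card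
  have hm : ∑ s, m s = j := by
    have := Finset.card_eq_sum_card_fiberwise (f := t) (s := Finset.univ) (t := Finset.univ)
      (fun _ _ => Finset.mem_univ _)
    simpa [m] using this.symm
  have hp : ∏ s, (s.1 : ℂ) ^ m s = ∏ i, l i := by
    rw [← Finset.prod_fiberwise' Finset.univ t (fun s => (s.1 : ℂ))]
    refine Finset.prod_congr rfl fun s _ => ?_
    rw [Finset.prod_const]
  rw [← hp]
  refine h μ ?_ m (by omega) (by rw [hm]; exact hj)
  rw [eigenvalues, Polynomial.mem_roots (LinearMap.charpoly_monic X).ne_zero]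
  exact (Module.End.hasEigenvalue_iff_isRoot_charpoly _ _).1 hμ

/-- Under nonresonance `K ↦ A⁻¹ ∘ K ∘ (A × ⋯ × A)` has no fixed vector in degrees `2 ≤ j ≤ k`. -/
theorem multilinear_eq_zero_of_nonresonant [Module.Finite ℝ V] {A B : Module.End ℝ V}
    (hAB : A * B = 1) {k : ℕ∞}
    (hnr : IsNonresonant (LinearMap.baseChange ℂ A : Module.End ℂ (ℂ ⊗[ℝ] V))
      (LinearMap.baseChange ℂ A : Module.End ℂ (ℂ ⊗[ℝ] V)) k)
    {j : ℕ} (h2 : 2 ≤ j) (hj : (j : ℕ∞) ≤ k) {K : MultilinearMap ℝ (fun _ : Fin j => V) V}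
    (hK : ∀ v, B (K fun i => A (v i)) = K v) : K = 0 := by
  by_contra hK0
  have hKe : conjMultilinear B A j K = K := by ext v; exact hK v
  have h1 : (conjMultilinear B A j).HasEigenvalue 1 :=
    Module.End.hasEigenvalue_of_hasEigenvector
      ⟨Module.End.mem_eigenspace_iff.2 (by rw [hKe, one_smul]), hK0⟩
  have h1c : IsComplexEigenvalue (conjMultilinear B A j) 1 := by
    rw [Module.End.hasEigenvalue_iff_isRoot_charpoly, IsRoot.def] at h1
    rw [isComplexEigenvalue_iff]
    have := Polynomial.aeval_algebraMap_apply ℂ (1 : ℝ) (conjMultilinear B A j).charpoly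
    rw [map_one, coe_aeval_eq_eval, h1, map_zero] at this
    exact this
  -- `1 = β l₁ ⋯ lⱼ` with `β⁻¹` an eigenvalue of `A` is a resonance
  obtain ⟨β, hβ, l, hl, h⟩ := h1c.conjMultilinear
  obtain ⟨hβ0, hβi⟩ := hβ.of_inverse hAB
  refine hnr.ne_prod h2 hj hβi hl ?_
  rw [inv_eq_of_mul_eq_one_right h.symm]

end Homological

/-! ### Formal linearization -/

section Formal

universe u

variable {E : Type u} [NormedAddCommGroup E] [NormedSpace ℝ E] [FiniteDimensional ℝ E]

/-- `A` is `k`-nonresonant as a real endomorphism. -/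
def IsNonresonantEnd (A : E →L[ℝ] E) (k : ℕ∞) : Prop :=
  IsNonresonant (LinearMap.baseChange ℂ (A : E →ₗ[ℝ] E) : Module.End ℂ (ℂ ⊗[ℝ] E))
    (LinearMap.baseChange ℂ (A : E →ₗ[ℝ] E) : Module.End ℂ (ℂ ⊗[ℝ] E)) k

variable {A B : E →L[ℝ] E} {k : ℕ∞} {j : ℕ}

theorem continuousMultilinear_eq_zero_of_nonresonant (hAB : A * B = 1)
    (hnr : IsNonresonantEnd A k) (h2 : 2 ≤ j) (hj : (j : ℕ∞) ≤ k) {K : E [×j]→L[ℝ] E}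
    (hK : ∀ v, B (K fun i => A (v i)) = K v) : K = 0 := by
  have h : (A : E →ₗ[ℝ] E) * (B : E →ₗ[ℝ] E) = 1 := by
    ext v; exact DFunLike.congr_fun hAB v
  have := multilinear_eq_zero_of_nonresonant h hnr h2 hj (K := K.toMultilinearMap) hK
  exact ContinuousMultilinearMap.toMultilinearMap_injective this

/-- Under nonresonance the homological equation is solvable in degrees `2 ≤ j ≤ k`. -/
theorem exists_homological_solution (hAB : A * B = 1)
    (hnr : IsNonresonantEnd A k) (h2 : 2 ≤ j) (hj : (j : ℕ∞) ≤ k) (H : E [×j]→L[ℝ] E) :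
    ∃ K : E [×j]→L[ℝ] E, ∀ v, B (K fun i => A (v i)) - K v = H v := by
  have : FiniteDimensional ℝ (E [×j]→L[ℝ] E) :=
    Module.Finite.of_injective (ContinuousMultilinearMap.toMultilinearMapLinear (R' := ℝ)
      (A := ℝ) (M₁ := fun _ : Fin j => E) (M₂ := E))
      ContinuousMultilinearMap.toMultilinearMap_injective
  let T : (E [×j]→L[ℝ] E) →ₗ[ℝ] (E [×j]→L[ℝ] E) :=
    { toFun := fun K => B.compContinuousMultilinearMap (K.compContinuousLinearMap fun _ => A) - K
      map_add' := by intros; ext; simp; abel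
      map_smul' := by intros; ext; simp [smul_sub] }
  have hinj : Function.Injective T := by
    rw [injective_iff_map_eq_zero]
    intro K hK
    refine continuousMultilinear_eq_zero_of_nonresonant hAB hnr h2 hj fun v => ?_
    exact sub_eq_zero.1 (DFunLike.congr_fun hK v)
  obtain ⟨K, hK⟩ := LinearMap.injective_iff_surjective.1 hinj H
  exact ⟨K, fun v => DFunLike.congr_fun hK v⟩

/-- There is a smooth (in fact polynomial) map `P`, tangent to the identity, which linearizes `F` up
to order `n`. Order by order: if the error `A⁻¹ ∘ P ∘ F - P` vanishes to order `j - 1`, with `j`-th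
derivative `H` at `0`, adding `(1 / j!) K (x, …, x)` to `P` changes the `j`-th derivative by the
symmetrization of `A⁻¹ ∘ K ∘ (A × ⋯ × A) - K`, so that `K` is to be chosen with
`A⁻¹ ∘ K ∘ (A × ⋯ × A) - K = - H`. -/
theorem exists_formal_linearization {F : E → E} (hAB : A * B = 1) (hBA : B * A = 1)
    (hnr : IsNonresonantEnd A k) {m : ℕ} (hm : (m : ℕ∞) ≤ k) (hm1 : 1 ≤ m)
    (hF : ContDiffAt ℝ m F 0) (hF0 : F 0 = 0) (hFA : fderiv ℝ F 0 = A) {n : ℕ} (hn1 : 1 ≤ n)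
    (hn : n ≤ m) :
    ∃ P : E → E, ContDiff ℝ ∞ P ∧ P 0 = 0 ∧ fderiv ℝ P 0 = 1 ∧
      ∀ i ≤ n, iteratedFDeriv ℝ i (fun x => B (P (F x)) - P x) 0 = 0 := by
  have hdF : DifferentiableAt ℝ F 0 := hF.differentiableAt (by norm_cast; omega)
  induction n, hn1 using Nat.le_induction with
  | base =>
    refine ⟨fun x => x, contDiff_id, rfl, fderiv_fun_id, fun i hi => ?_⟩
    interval_cases i
    · ext v; simp [hF0]
    · ext v
      rw [iteratedFDeriv_one_apply]
      have : HasFDerivAt (fun x => B (F x) - x) (B.comp (fderiv ℝ F 0) - 1) 0 :=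
        (B.hasFDerivAt.comp 0 hdF.hasFDerivAt).sub (hasFDerivAt_id 0)
      rw [this.fderiv, hFA]
      have : B.comp A = 1 := hBA
      rw [this]; simp
  | succ j hj1 ih =>
    obtain ⟨P, hP, hP0, hP1, hvan⟩ := ih (by omega)
    have h2 : 2 ≤ j + 1 := by omega
    have hjk : ((j + 1 : ℕ) : ℕ∞) ≤ k := le_trans (by exact_mod_cast hn) hm
    have hPm : ∀ {i : ℕ} {x : E}, ContDiffAt ℝ i P x := fun {i x} =>
      (hP.of_le (by exact_mod_cast le_top)).contDiffAt
    have hFj : ContDiffAt ℝ (j + 1 : ℕ) F 0 := hF.of_le (by exact_mod_cast hn)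
    have hBf : ∀ {f : E → E} {i : ℕ}, i ≤ j + 1 → ContDiffAt ℝ i f 0 →
        ContDiffAt ℝ i (fun x => B (f x)) 0 := fun _ h => B.contDiff.contDiffAt.comp 0 h
    have hR : ContDiffAt ℝ (j + 1 : ℕ) (fun x => B (P (F x)) - P x) 0 :=
      (hBf le_rfl (ContDiffAt.comp 0 hPm hFj)).sub hPm
    set H := iteratedFDeriv ℝ (j + 1) (fun x => B (P (F x)) - P x) 0 with hH
    obtain ⟨K, hK⟩ := exists_homological_solution hAB hnr h2 hjk (-H)
    set c : ℝ := ((Nat.factorial (j + 1) : ℕ) : ℝ)⁻¹ with hc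
    set D : E [×(j + 1)]→L[ℝ] E := c • K with hD
    have hQ : ∀ {i : ℕ} {x : E}, ContDiffAt ℝ i (fun x : E => D fun _ => x) x := fun {i x} =>
      (contDiff_diagonal D).contDiffAt
    have hQ0 : ∀ i < j + 1, iteratedFDeriv ℝ i (fun x : E => D fun _ => x) (F 0) = 0 := by
      rw [hF0]; exact fun i hi => iteratedFDeriv_diagonal_of_lt D hi
    -- the change of the error, and its derivatives at `0`
    have hS : ∀ i ≤ j + 1, ∀ v, iteratedFDeriv ℝ i
        (fun x => B (D fun _ => F x) - D fun _ => x) 0 v =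
        B (iteratedFDeriv ℝ i (fun x : E => D fun _ => x) 0 fun a => A (v a)) -
          iteratedFDeriv ℝ i (fun x : E => D fun _ => x) 0 v := by
      intro i hi v
      have hFi : ContDiffAt ℝ i F 0 := hFj.of_le (by exact_mod_cast hi)
      have hQF : ContDiffAt ℝ i (fun x => D fun _ => F x) 0 :=
        ContDiffAt.comp (g := fun x : E => D fun _ => x) 0 hQ hFi
      rw [fun_iteratedFDeriv_sub_apply (hBf hi hQF) hQ, sub_apply]
      congr 1
      have h1 := B.iteratedFDeriv_comp_left hQF (i := i) le_rfl
      change iteratedFDeriv ℝ i (B ∘ fun x => D fun _ => F x) 0 v = _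
      rw [h1]
      change B (iteratedFDeriv ℝ i (fun x => D fun _ => F x) 0 v) = _
      rw [iteratedFDeriv_comp_of_vanishing (f := fun x : E => D fun _ => x) hQ hFj hQ0 hi v,
        hFA, hF0]
    refine ⟨fun x => P x + D fun _ => x, hP.add (contDiff_diagonal D), ?_, ?_, fun i hi => ?_⟩
    · change P 0 + (D fun _ => 0) = 0
      rw [hP0, zero_add]
      exact D.map_coord_zero (0 : Fin (j + 1)) rfl
    · have h1 : fderiv ℝ (fun x : E => D fun _ => x) 0 = 0 := by
        ext v
        have := iteratedFDeriv_diagonal_of_lt D (show 1 < j + 1 by omega)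
        have := DFunLike.congr_fun this (fun _ => v)
        rwa [iteratedFDeriv_one_apply] at this
      rw [fderiv_fun_add ((hPm (i := 1)).differentiableAt (by simp))
        ((hQ (i := 1)).differentiableAt (by simp)), h1, hP1, add_zero]
    · have hsplit : (fun x => B (P (F x) + D fun _ => F x) - (P x + D fun _ => x)) =
          fun x => (B (P (F x)) - P x) + (B (D fun _ => F x) - D fun _ => x) := by
        ext x; rw [map_add]; abel
      have hFi : ContDiffAt ℝ i F 0 := hFj.of_le (by exact_mod_cast hi)
      have hQF : ContDiffAt ℝ i (fun x => D fun _ => F x) 0 :=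
        ContDiffAt.comp (g := fun x : E => D fun _ => x) 0 hQ hFi
      rw [hsplit, fun_iteratedFDeriv_add_apply (hR.of_le (by exact_mod_cast hi))
        ((hBf hi hQF).sub hQ)]
      ext v
      rw [add_apply, hS i hi v]
      rcases hi.lt_or_eq with hlt | rfl
      · rw [hvan i (by omega), iteratedFDeriv_diagonal_of_lt D hlt]; simp
      · rw [← hH, D.iteratedFDeriv_comp_diagonal, D.iteratedFDeriv_comp_diagonal, map_sum,
          ← Finset.sum_sub_distrib]
        have hterm : ∀ σ : Equiv.Perm (Fin (j + 1)),
            B (D fun i => A (v (σ i))) - (D fun i => v (σ i)) = - (c • H v) := by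
          intro σ
          have h1 := hK (fun i => v (σ i))
          simp only [hD, smul_apply, map_smul]
          rw [← smul_sub, h1]
          change c • (- H fun i => v (σ i)) = _
          rw [hH, iteratedFDeriv_comp_perm_of_contDiffAt hR σ v, smul_neg]
        rw [Finset.sum_congr rfl fun σ _ => hterm σ, Finset.sum_const, Finset.card_univ,
          Fintype.card_perm, Fintype.card_fin, smul_neg, ← Nat.cast_smul_eq_nsmul ℝ, smul_smul, hc,
          mul_inv_cancel₀ (by positivity)]
        simp

/-- Two solutions of the linearization equation with the same value and derivative at the fixed
point have the same `m`-jet there. -/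
theorem iteratedFDeriv_eq_zero_of_semiconj {F χ : E → E} (hAB : A * B = 1) (hBA : B * A = 1)
    (hnr : IsNonresonantEnd A k) {m : ℕ} (hm : (m : ℕ∞) ≤ k)
    (hF : ContDiffAt ℝ m F 0) (hF0 : F 0 = 0) (hFA : fderiv ℝ F 0 = A)
    (hχ : ContDiffAt ℝ m χ 0) (hχ0 : χ 0 = 0) (hχ1 : fderiv ℝ χ 0 = 0)
    (hconj : ∀ᶠ x in 𝓝 0, χ (F x) = A (χ x)) :
    ∀ i ≤ m, iteratedFDeriv ℝ i χ 0 = 0 := by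
  intro i
  induction i using Nat.strong_induction_on with
  | _ i ih =>
    intro hi
    match i, ih, hi with
    | 0, ih, hi => ext v; simpa using hχ0
    | 1, ih, hi => ext v; rw [iteratedFDeriv_one_apply, hχ1]; rfl
    | i + 2, ih, hi =>
      have hχi : ContDiffAt ℝ (i + 2 : ℕ) χ 0 := hχ.of_le (by exact_mod_cast hi)
      have hFi : ContDiffAt ℝ (i + 2 : ℕ) F 0 := hF.of_le (by exact_mod_cast hi)
      refine continuousMultilinear_eq_zero_of_nonresonant hAB hnr (by omega)
        (le_trans (by exact_mod_cast hi) hm) fun v => ?_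
      have h1 := iteratedFDeriv_comp_of_vanishing (f := χ) (g := F) (x := 0) (j := i + 2)
        (by rwa [hF0]) hFi (by rw [hF0]; exact fun a ha => ih a ha (by omega)) le_rfl v
      rw [hFA, hF0, (Filter.EventuallyEq.iteratedFDeriv ℝ hconj (i + 2)).eq_of_nhds] at h1
      have h2 := A.iteratedFDeriv_comp_left hχi (i := i + 2) le_rfl
      have h3 : iteratedFDeriv ℝ (i + 2) (fun x => A (χ x)) 0 v =
          A (iteratedFDeriv ℝ (i + 2) χ 0 v) := DFunLike.congr_fun h2 v
      rw [← h1, h3]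
      exact DFunLike.congr_fun hBA _

end Formal

/-! ### Spectral estimates -/

section Spectral

universe u

variable {E : Type u} [NormedAddCommGroup E] [NormedSpace ℝ E] [FiniteDimensional ℝ E]

attribute [local instance] Matrix.linftyOpNormedRing Matrix.linftyOpNormedAlgebra

/-- Gelfand's formula for a real operator: its powers are eventually bounded by those of any number
which exceeds the modulus of all complex eigenvalues. -/
theorem eventually_norm_pow_lt {T : E →L[ℝ] E} {ρ : ℝ} (hρ : 0 < ρ)
    (h : ∀ z, IsComplexEigenvalue (T : E →ₗ[ℝ] E) z → ‖z‖ < ρ) :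
    ∀ᶠ n : ℕ in atTop, ‖T ^ n‖ < ρ ^ n := by
  classical
  rcases subsingleton_or_nontrivial E with hE | hE
  · refine Eventually.of_forall fun n => ?_
    rw [Subsingleton.elim (T ^ n) 0, norm_zero]
    positivity
  let b := Module.finBasis ℝ E
  let Θ : (E →L[ℝ] E) →ₗ[ℝ] Matrix (Fin (Module.finrank ℝ E)) (Fin (Module.finrank ℝ E)) ℂ :=
    { toFun := fun X => (LinearMap.toMatrix b b (X : E →ₗ[ℝ] E)).map (algebraMap ℝ ℂ)
      map_add' := by intro X Y; ext i j; simp [LinearMap.toMatrix_apply]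
      map_smul' := by intro c X; ext i j; simp [LinearMap.toMatrix_apply] }
  have hmul : ∀ X Y, Θ (X * Y) = Θ X * Θ Y := by
    intro X Y
    change ((LinearMap.toMatrix b b) ((X : E →ₗ[ℝ] E) * (Y : E →ₗ[ℝ] E))).map _ = _
    rw [LinearMap.toMatrix_mul, Matrix.map_mul]
    rfl
  have hone : Θ 1 = 1 := by
    change ((LinearMap.toMatrix b b) (1 : E →ₗ[ℝ] E)).map _ = _
    rw [LinearMap.toMatrix_one, Matrix.map_one _ (map_zero _) (map_one _)]
  have hpow : ∀ n, Θ (T ^ n) = Θ T ^ n := by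
    intro n
    induction n with
    | zero => rw [pow_zero, pow_zero, hone]
    | succ n ih => rw [pow_succ, pow_succ, hmul, ih]
  have hker : LinearMap.ker Θ = ⊥ := by
    rw [LinearMap.ker_eq_bot']
    intro X hX
    have h1 : LinearMap.toMatrix b b (X : E →ₗ[ℝ] E) = 0 := by
      ext i j
      have := congrFun (congrFun hX i) j
      simpa [Θ] using this
    have h2 : (X : E →ₗ[ℝ] E) = 0 := by simpa using h1
    ext v
    exact LinearMap.congr_fun h2 v
  obtain ⟨K, hK0, hK⟩ := Θ.exists_antilipschitzWith hker
  have hbound : ∀ n, ‖T ^ n‖ ≤ K * ‖Θ T ^ n‖ := by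
    intro n
    have := hK.le_mul_dist (T ^ n) 0
    rwa [map_zero, dist_zero_right, dist_zero_right, hpow] at this
  have hspec : ∀ z ∈ spectrum ℂ (Θ T), ‖z‖₊ < ρ.toNNReal := by
    intro z hz
    rw [Real.lt_toNNReal_iff_coe_lt]
    refine h z ?_
    rw [Matrix.mem_spectrum_iff_isRoot_charpoly] at hz
    rw [isComplexEigenvalue_iff]
    have : (Θ T).charpoly = (T : E →ₗ[ℝ] E).charpoly.map (algebraMap ℝ ℂ) := by
      rw [← LinearMap.charpoly_toMatrix (T : E →ₗ[ℝ] E) b, ← Matrix.charpoly_map]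
      rfl
    rw [this, Polynomial.IsRoot.def, Polynomial.eval_map_algebraMap] at hz
    exact hz
  have : Nonempty (Fin (Module.finrank ℝ E)) := Fin.pos_iff_nonempty.1 Module.finrank_pos
  have hsr := spectrum.spectralRadius_lt_of_forall_lt (Θ T) hspec
  obtain ⟨r, hr1, hr2⟩ := ENNReal.lt_iff_exists_nnreal_btwn.1 hsr
  have hlim := spectrum.pow_nnnorm_pow_one_div_tendsto_nhds_spectralRadius (Θ T)
  have hr0 : 0 < r := by
    exact ENNReal.coe_pos.1 (zero_le.trans_lt hr1)
  have hrρ : (r : ℝ) < ρ := by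
    have : r < ρ.toNNReal := by exact_mod_cast hr2
    rwa [Real.lt_toNNReal_iff_coe_lt] at this
  have hev : ∀ᶠ n : ℕ in atTop, ‖Θ T ^ n‖ < r ^ n := by
    filter_upwards [hlim.eventually_lt_const hr1, eventually_gt_atTop 0] with n hn hn0
    have h1 : (‖Θ T ^ n‖₊ : ℝ≥0∞) < (r : ℝ≥0∞) ^ (n : ℝ) := by
      have hn0' : (0 : ℝ) < n := by exact_mod_cast hn0
      have := ENNReal.rpow_lt_rpow hn hn0'
      rwa [← ENNReal.rpow_mul, one_div, inv_mul_cancel₀ hn0'.ne', ENNReal.rpow_one] at this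
    rw [ENNReal.rpow_natCast] at h1
    have h2 : ‖Θ T ^ n‖₊ < r ^ n := by exact_mod_cast h1
    exact_mod_cast h2
  have hq : Tendsto (fun n : ℕ => (K : ℝ) * (r / ρ) ^ n) atTop (𝓝 0) := by
    have := (tendsto_pow_atTop_nhds_zero_of_lt_one (r := r / ρ) (by positivity)
      ((div_lt_one hρ).2 hrρ)).const_mul (K : ℝ)
    simpa using this
  filter_upwards [hev, hq.eventually_lt_const one_pos] with n h1 h2
  calc ‖T ^ n‖ ≤ K * ‖Θ T ^ n‖ := hbound n
    _ ≤ K * r ^ n := by gcongr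
    _ = K * (r / ρ) ^ n * ρ ^ n := by rw [div_pow]; field_simp
    _ < 1 * ρ ^ n := by gcongr
    _ = ρ ^ n := one_mul _

theorem finite_isComplexEigenvalue (T : E →ₗ[ℝ] E) : {z | IsComplexEigenvalue T z}.Finite :=
  Module.End.finite_hasEigenvalue _

theorem exists_isComplexEigenvalue [Nontrivial E] (T : E →ₗ[ℝ] E) :
    ∃ z, IsComplexEigenvalue T z := by
  have : Nontrivial (ℂ ⊗[ℝ] E) := inferInstance
  exact Module.End.exists_eigenvalue _

/-- Some iterate of `A` contracts so strongly that `‖A⁻ᴺ‖ ‖Aᴺ‖ ^ p < 1`, provided that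
`|z| ^ p < |μ|` for all eigenvalues `z`, `μ`. -/
theorem exists_pow_contraction {A B : E →L[ℝ] E} (hAB : A * B = 1) {p : ℝ} (hp : 0 ≤ p)
    (h1 : ∀ z, IsComplexEigenvalue (A : E →ₗ[ℝ] E) z → ‖z‖ < 1)
    (h2 : ∀ z μ, IsComplexEigenvalue (A : E →ₗ[ℝ] E) z →
      IsComplexEigenvalue (A : E →ₗ[ℝ] E) μ → ‖z‖ ^ p < ‖μ‖) :
    ∃ N : ℕ, 1 ≤ N ∧ ∃ r : ℝ, 0 < r ∧ r < 1 ∧ ‖A ^ N‖ < r ∧ ‖B ^ N‖ * r ^ p < 1 := by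
  rcases subsingleton_or_nontrivial E with hE | hE
  · refine ⟨1, le_rfl, 1 / 2, by norm_num, by norm_num, ?_, ?_⟩
    · rw [Subsingleton.elim (A ^ 1) 0, norm_zero]; norm_num
    · rw [Subsingleton.elim (B ^ 1) 0, norm_zero, zero_mul]; norm_num
  have hAB' : (A : E →ₗ[ℝ] E) * (B : E →ₗ[ℝ] E) = 1 := by
    ext v; exact DFunLike.congr_fun hAB v
  have hfin := finite_isComplexEigenvalue (A : E →ₗ[ℝ] E)
  have hne : {z | IsComplexEigenvalue (A : E →ₗ[ℝ] E) z}.Nonempty :=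
    exists_isComplexEigenvalue _
  -- only the largest modulus `‖z‖` and the smallest one `‖μ‖` matter
  obtain ⟨z, hz, hzmax⟩ := Set.exists_max_image _ (fun z => ‖z‖) hfin hne
  obtain ⟨μ, hμ, hμmin⟩ := Set.exists_min_image _ (fun z => ‖z‖) hfin hne
  have hzμ := h2 z μ hz hμ
  have hcont : ContinuousAt (fun a : ℝ => a ^ p) ‖z‖ :=
    Real.continuousAt_rpow_const _ _ (Or.inr hp)
  have hev : ∀ᶠ a in 𝓝[>] ‖z‖, a ^ p < ‖μ‖ ∧ a < 1 :=
    Filter.Eventually.filter_mono nhdsWithin_le_nhds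
      ((hcont.eventually_lt_const hzμ).and (eventually_lt_nhds (h1 z hz)))
  obtain ⟨a, ⟨hap, ha1⟩, hza⟩ := (hev.and self_mem_nhdsWithin).exists
  have hza : ‖z‖ < a := hza
  have ha0 : 0 < a := (norm_nonneg z).trans_lt hza
  have hap0 : 0 < a ^ p := Real.rpow_pos_of_pos ha0 p
  obtain ⟨b, hb1, hb2⟩ := exists_between (inv_strictAnti₀ hap0 hap)
  have hμ0 : 0 < ‖μ‖ := hap0.trans hap
  have hb0 : 0 < b := (inv_pos.2 hμ0).trans hb1
  have hA := eventually_norm_pow_lt ha0 fun w hw => (hzmax w hw).trans_lt hza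
  have hB := eventually_norm_pow_lt (T := B) hb0 fun w hw => by
    obtain ⟨hw0, hw'⟩ := hw.of_inverse hAB'
    have := hμmin _ hw'
    rw [norm_inv] at this
    refine lt_of_le_of_lt ?_ hb1
    exact (le_inv_comm₀ hμ0 (norm_pos_iff.2 hw0)).1 this
  obtain ⟨N, ⟨hN1, hN2⟩, hN⟩ := ((hA.and hB).and (eventually_ge_atTop 1)).exists
  refine ⟨N, hN, a ^ N, by positivity, pow_lt_one₀ ha0.le ha1 (by omega), hN1, ?_⟩
  have hba : b * a ^ p < 1 := by
    calc b * a ^ p < (a ^ p)⁻¹ * a ^ p := by gcongr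
      _ = 1 := inv_mul_cancel₀ hap0.ne'
  have hcomm : (a ^ N) ^ p = (a ^ p) ^ N := by
    rw [← Real.rpow_natCast, ← Real.rpow_natCast, ← Real.rpow_mul ha0.le, ← Real.rpow_mul ha0.le,
      mul_comm]
  calc ‖B ^ N‖ * (a ^ N) ^ p ≤ b ^ N * (a ^ p) ^ N := by rw [hcomm]; gcongr
    _ = (b * a ^ p) ^ N := (mul_pow _ _ _).symm
    _ < 1 := pow_lt_one₀ (by positivity) hba (by omega)

/-- A bound for the powers of an operator along every vector bounds the eigenvalues. -/
theorem norm_le_of_pow_apply_le {A : E →L[ℝ] E} {t : ℝ} (ht : 0 < t)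
    (h : ∀ x : E, ∃ C : ℝ, ∀ n : ℕ, ‖(A ^ n) x‖ ≤ C * t ^ n) {z : ℂ}
    (hz : IsComplexEigenvalue (A : E →ₗ[ℝ] E) z) : ‖z‖ ≤ t := by
  obtain ⟨y, hy, hy0⟩ := hz.exists_hasEigenvector
  rw [Module.End.mem_eigenspace_iff] at hy
  obtain ⟨f, hf⟩ : ∃ f : Module.Dual ℂ (ℂ ⊗[ℝ] E), f y ≠ 0 := by
    by_contra! hcon
    exact hy0 ((Module.forall_dual_apply_eq_zero_iff ℂ y).1 hcon)
  let T : Module.End ℂ (ℂ ⊗[ℝ] E) := LinearMap.baseChange ℂ (A : E →ₗ[ℝ] E)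
  have hT : ∀ n : ℕ, (T ^ n) y = z ^ n • y := by
    intro n
    induction n with
    | zero => simp
    | succ n ih =>
      rw [pow_succ', Module.End.mul_apply, ih, map_smul]
      change z ^ n • (LinearMap.baseChange ℂ (A : E →ₗ[ℝ] E)) y = _
      rw [hy, smul_smul, pow_succ]
  have hTt : ∀ (n : ℕ) (c : ℂ) (x : E), (T ^ n) (c ⊗ₜ[ℝ] x) = c ⊗ₜ[ℝ] (A ^ n) x := by
    intro n
    induction n with
    | zero => intro c x; simp
    | succ n ih =>
      intro c x
      rw [pow_succ', Module.End.mul_apply, ih, pow_succ']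
      rfl
  have hb : ∀ y : ℂ ⊗[ℝ] E, ∃ C : ℝ, ∀ n : ℕ, ‖f ((T ^ n) y)‖ ≤ C * t ^ n := by
    intro y
    induction y using TensorProduct.induction_on with
    | zero => exact ⟨0, fun n => by simp⟩
    | tmul c x =>
      let g : E →ₗ[ℝ] ℂ := (f.restrictScalars ℝ) ∘ₗ (TensorProduct.mk ℝ ℂ E c)
      let g' : E →L[ℝ] ℂ := LinearMap.toContinuousLinearMap g
      obtain ⟨C, hC⟩ := h x
      refine ⟨‖g'‖ * C, fun n => ?_⟩
      rw [hTt]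
      change ‖g' ((A ^ n) x)‖ ≤ _
      rw [mul_assoc]
      exact (g'.le_opNorm _).trans (by gcongr; exact hC n)
    | add y w hy hw =>
      obtain ⟨C, hC⟩ := hy
      obtain ⟨C', hC'⟩ := hw
      refine ⟨C + C', fun n => ?_⟩
      rw [map_add, map_add, add_mul]
      exact norm_add_le_of_le (hC n) (hC' n)
  obtain ⟨C, hC⟩ := hb y
  by_contra! hlt
  have h1 : ∀ n : ℕ, (‖z‖ / t) ^ n ≤ C / ‖f y‖ := by
    intro n
    have := hC n
    rw [hT, map_smul, norm_smul, norm_pow] at this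
    rw [div_pow, div_le_div_iff₀ (by positivity) (norm_pos_iff.2 hf)]
    exact this
  obtain ⟨n, hn⟩ := pow_unbounded_of_one_lt (C / ‖f y‖) ((one_lt_div ht).2 hlt)
  exact absurd (h1 n) hn.not_ge

/-- There is a positive definite bilinear form on a finite-dimensional space. -/
theorem exists_posDef_form : ∃ β : E →ₗ[ℝ] E →ₗ[ℝ] ℝ, ∃ c > 0, ∀ x, c * ‖x‖ ^ 2 ≤ β x x := by
  let e : E ≃L[ℝ] EuclideanSpace ℝ (Fin (Module.finrank ℝ E)) := toEuclidean
  refine ⟨LinearMap.mk₂ ℝ (fun x y => inner ℝ (e x) (e y)) ?_ ?_ ?_ ?_,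
    1 / (‖(e.symm : EuclideanSpace ℝ (Fin (Module.finrank ℝ E)) →L[ℝ] E)‖ ^ 2 + 1),
    by positivity, fun x => ?_⟩
  · intro x y z; rw [map_add, inner_add_left]
  · intro c x y; rw [map_smul, real_inner_smul_left]; rfl
  · intro x y z; rw [map_add, inner_add_right]
  · intro c x y; rw [map_smul, real_inner_smul_right]; rfl
  · rw [LinearMap.mk₂_apply, real_inner_self_eq_norm_sq, one_div, inv_mul_le_iff₀ (by positivity)]
    have h : ‖x‖ ≤ ‖(e.symm : EuclideanSpace ℝ (Fin (Module.finrank ℝ E)) →L[ℝ] E)‖ * ‖e x‖ := by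
      simpa using (e.symm : EuclideanSpace ℝ (Fin (Module.finrank ℝ E)) →L[ℝ] E).le_opNorm (e x)
    calc ‖x‖ ^ 2
        ≤ (‖(e.symm : EuclideanSpace ℝ (Fin (Module.finrank ℝ E)) →L[ℝ] E)‖ * ‖e x‖) ^ 2 := by
          gcongr
      _ ≤ _ := by rw [mul_pow]; nlinarith [sq_nonneg ‖e x‖]

/-- Any interval contains a number `s` which is not an eigenvalue, so that `S - s` is onto. -/
theorem exists_apply_sub_smul_eq {V : Type*} [AddCommGroup V] [Module ℝ V] [Module.Finite ℝ V]
    (S : Module.End ℝ V) (w : V) {a b : ℝ} (hab : a < b) :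
    ∃ s ∈ Ioo a b, ∃ v : V, S v - s • v = w := by
  have hfin : {s : ℝ | S.HasEigenvalue s}.Finite := Module.End.finite_hasEigenvalue S
  obtain ⟨s, hs, hs'⟩ := (Ioo_infinite hab).exists_notMem_finite hfin
  refine ⟨s, hs, ?_⟩
  have hinj : Function.Injective (S - algebraMap ℝ (Module.End ℝ V) s) := by
    rw [injective_iff_map_eq_zero]
    intro v hv
    by_contra hv0
    refine hs' (Module.End.hasEigenvalue_of_hasEigenvector
      ⟨Module.End.mem_eigenspace_iff.2 ?_, hv0⟩)
    simpa [sub_eq_zero, Module.algebraMap_end_apply] using hv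
  exact LinearMap.injective_iff_surjective.1 hinj w

/-- The equation `β (A x) (A y) = s β x y + β₀ x y` for a bilinear form `β` can be solved for some
`s` in any given interval, since it is solvable unless `s` is an eigenvalue of
`β ↦ β (A ·) (A ·)`. -/
theorem exists_form_comp_eq {V : Type*} [AddCommGroup V] [Module ℝ V] [Module.Finite ℝ V]
    (A : V →ₗ[ℝ] V) (β₀ : V →ₗ[ℝ] V →ₗ[ℝ] ℝ) {a b : ℝ} (hab : a < b) :
    ∃ s ∈ Ioo a b, ∃ β : V →ₗ[ℝ] V →ₗ[ℝ] ℝ, ∀ x y, β (A x) (A y) = s * β x y + β₀ x y := by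
  have : Module.Finite ℝ (V →ₗ[ℝ] V →ₗ[ℝ] ℝ) := inferInstance
  obtain ⟨S, hS⟩ : ∃ S : Module.End ℝ (V →ₗ[ℝ] V →ₗ[ℝ] ℝ), ∀ β x y, S β x y = β (A x) (A y) :=
    ⟨{ toFun := fun β => β.compl₁₂ A A
       map_add' := by intros; ext; simp
       map_smul' := by intros; ext; simp }, fun β x y => rfl⟩
  obtain ⟨s, hs, β, hβ⟩ := exists_apply_sub_smul_eq (V := V →ₗ[ℝ] V →ₗ[ℝ] ℝ) S β₀ hab
  refine ⟨s, hs, β, fun x y => ?_⟩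
  have h2 := LinearMap.congr_fun (LinearMap.congr_fun hβ x) y
  simp only [LinearMap.sub_apply, LinearMap.smul_apply, hS, smul_eq_mul] at h2
  linarith

/-- A bilinear form on a finite-dimensional space is bounded. -/
theorem exists_form_le (β : E →ₗ[ℝ] E →ₗ[ℝ] ℝ) : ∃ K, 0 ≤ K ∧ ∀ x y, |β x y| ≤ K * ‖x‖ * ‖y‖ := by
  let β' : E →L[ℝ] E →L[ℝ] ℝ :=
    LinearMap.toContinuousLinearMap ((LinearMap.toContinuousLinearMap :
      (E →ₗ[ℝ] ℝ) ≃ₗ[ℝ] (E →L[ℝ] ℝ)).toLinearMap ∘ₗ β)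
  exact ⟨‖β'‖, norm_nonneg β', fun x y => β'.le_opNorm₂ x y⟩

/-- A fixed point which is Lyapunov stable and attracting has no eigenvalue of modulus greater
than `1`. Otherwise, for some `1 < s < |z|²`, there is a quadratic form `q` such that
`q (A x) - s q x` is positive definite. It takes a positive value, since `q ≤ 0` would give
`|Aⁿ x|² = O(sⁿ)`; but where it is positive it increases along the orbits close to the fixed point,
on which it tends to `0`. -/
theorem norm_le_one_of_stable {A : E →L[ℝ] E} {F : E → E} (hF : HasFDerivAt F A 0) (hF0 : F 0 = 0)
    (hdyn : ∀ ε > 0, ∀ᶠ x in 𝓝 (0 : E), ∃ u : ℕ → E, u 0 = x ∧ (∀ n, u (n + 1) = F (u n)) ∧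
      (∀ n, ‖u n‖ < ε) ∧ Tendsto u atTop (𝓝 0)) {z : ℂ}
    (hz : IsComplexEigenvalue (A : E →ₗ[ℝ] E) z) : ‖z‖ ≤ 1 := by
  by_contra! hz1
  obtain ⟨β₀, c, hc, hβ₀⟩ := exists_posDef_form (E := E)
  obtain ⟨s, ⟨hs1, hs2⟩, β, hβ⟩ := exists_form_comp_eq (A : E →ₗ[ℝ] E) β₀
    (show (1 : ℝ) < ‖z‖ ^ 2 by nlinarith)
  have hq : ∀ x, s * β x x + c * ‖x‖ ^ 2 ≤ β (A x) (A x) := by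
    intro x
    have h1 : β (A x) (A x) = s * β x x + β₀ x x := hβ x x
    linarith [hβ₀ x]
  by_cases hpos : ∃ v, 0 < β v v
  · obtain ⟨v, hv⟩ := hpos
    obtain ⟨K, hK0, hK⟩ := exists_form_le β
    -- the remainder of `F` is so small that it does not spoil the growth of `q`
    obtain ⟨η, hη, hη1, hηc⟩ : ∃ η : ℝ, 0 < η ∧ η ≤ 1 ∧ K * (2 * ‖A‖ + 1) * η ≤ c := by
      refine ⟨min 1 (c / (K * (2 * ‖A‖ + 1) + 1)), by positivity, min_le_left _ _, ?_⟩
      calc K * (2 * ‖A‖ + 1) * min 1 (c / (K * (2 * ‖A‖ + 1) + 1))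
          ≤ (K * (2 * ‖A‖ + 1) + 1) * (c / (K * (2 * ‖A‖ + 1) + 1)) := by
            gcongr
            · linarith
            · exact min_le_right _ _
        _ = c := by field_simp
    have hFA : ∀ᶠ x in 𝓝 (0 : E), ‖F x - A x‖ ≤ η * ‖x‖ := by
      have := hF.isLittleO.def hη
      simpa [hF0] using this
    obtain ⟨ε, hε, hεF⟩ := Metric.eventually_nhds_iff_ball.1 hFA
    have hgrow : ∀ x, ‖x‖ < ε → 0 ≤ β x x → β x x ≤ β (F x) (F x) := by
      intro x hx hx0
      have h1 := hεF x (by simpa using hx)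
      set w := F x - A x with hw
      have h2 : F x = A x + w := by rw [hw]; abel
      have h3 : β (F x) (F x) = β (A x) (A x) + β (A x) w + β w (A x) + β w w := by
        rw [h2]; simp only [map_add, LinearMap.add_apply]; ring
      have h4 : ‖A x‖ ≤ ‖A‖ * ‖x‖ := A.le_opNorm x
      have h5 : |β (A x) w| ≤ K * (‖A‖ * ‖x‖) * (η * ‖x‖) := (hK _ _).trans (by gcongr)
      have h6 : |β w (A x)| ≤ K * (η * ‖x‖) * (‖A‖ * ‖x‖) := (hK _ _).trans (by gcongr)
      have h7 : |β w w| ≤ K * (η * ‖x‖) * (1 * ‖x‖) :=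
        (hK _ _).trans (by gcongr; nlinarith [norm_nonneg x])
      have h8 : K * (2 * ‖A‖ + 1) * η * ‖x‖ ^ 2 ≤ c * ‖x‖ ^ 2 := by gcongr
      have h9 := hq x
      have h10 := abs_le.1 h5
      have h11 := abs_le.1 h6
      have h12 := abs_le.1 h7
      nlinarith
    have hray : Tendsto (fun t : ℝ => t • v) (𝓝[>] 0) (𝓝 0) := by
      have h : Tendsto (fun t : ℝ => t • v) (𝓝 0) (𝓝 ((0 : ℝ) • v)) :=
        (continuous_id.smul continuous_const).tendsto 0
      rw [zero_smul] at h
      exact h.mono_left nhdsWithin_le_nhds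
    obtain ⟨t, ⟨u, hu0, hu, huε, hulim⟩, ht⟩ :=
      ((hray.eventually (hdyn ε hε)).and self_mem_nhdsWithin).exists
    have ht : 0 < t := ht
    have h0 : 0 < β (u 0) (u 0) := by
      rw [hu0, map_smul, map_smul, LinearMap.smul_apply, smul_eq_mul, smul_eq_mul]
      positivity
    have hmono : ∀ n, β (u 0) (u 0) ≤ β (u n) (u n) := by
      intro n
      induction n with
      | zero => exact le_rfl
      | succ n ih =>
        rw [hu]
        exact ih.trans (hgrow _ (huε n) (h0.le.trans ih))
    have hlim : Tendsto (fun n => K * ‖u n‖ * ‖u n‖) atTop (𝓝 0) := by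
      have := ((hulim.norm.const_mul K).mul hulim.norm)
      simpa using this
    have := ge_of_tendsto' hlim fun n => (hmono n).trans ((le_abs_self _).trans (hK _ _))
    linarith
  -- the case `q ≤ 0`: then `c ‖x‖² ≤ - s q x`, and `- q` grows at most by the factor `s`
  · push Not at hpos
    have hs0 : 0 < s := by linarith
    have hpow : ∀ x (n : ℕ), - β ((A ^ n) x) ((A ^ n) x) ≤ s ^ n * (- β x x) := by
      intro x n
      induction n with
      | zero => simp
      | succ n ih =>
        have h1 : (A ^ (n + 1)) x = A ((A ^ n) x) := by rw [pow_succ']; rfl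
        rw [h1, pow_succ]
        have := hq ((A ^ n) x)
        have h2 : 0 ≤ c * ‖(A ^ n) x‖ ^ 2 := by positivity
        nlinarith
    have hzle : ‖z‖ ≤ √s := by
      refine norm_le_of_pow_apply_le (A := A) (Real.sqrt_pos.2 hs0) (fun x => ?_) hz
      refine ⟨√(s * (- β x x) / c), fun n => ?_⟩
      have h1 : ‖(A ^ n) x‖ ^ 2 ≤ s * (- β x x) / c * s ^ n := by
        have h2 := hq ((A ^ n) x)
        have h3 := hpos (A ((A ^ n) x))
        have h4 := mul_le_mul_of_nonneg_left (hpow x n) hs0.le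
        rw [div_mul_eq_mul_div, le_div_iff₀ hc]
        linarith
      have h0 : 0 ≤ s * (- β x x) / c :=
        div_nonneg (mul_nonneg hs0.le (by linarith [hpos x])) hc.le
      refine abs_le_of_sq_le_sq' ?_ (by positivity) |>.2
      rw [mul_pow, Real.sq_sqrt h0, ← pow_mul, mul_comm n 2, pow_mul, Real.sq_sqrt hs0.le]
      exact h1
    have : ‖z‖ ^ 2 ≤ s := by
      calc ‖z‖ ^ 2 ≤ √s ^ 2 := by gcongr
        _ = s := Real.sq_sqrt hs0.le
    linarith

end Spectral

/-! ### Maps between manifolds in coordinates -/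

section Charts

universe u

variable {E E' E'' W : Type u} [NormedAddCommGroup E] [NormedSpace ℝ E] [NormedAddCommGroup E']
  [NormedSpace ℝ E'] [NormedAddCommGroup E''] [NormedSpace ℝ E''] [NormedAddCommGroup W]
  [NormedSpace ℝ W]
variable {H M H' N : Type*} [TopologicalSpace H] [TopologicalSpace M] [ChartedSpace H M]
  [TopologicalSpace H'] [TopologicalSpace N] [ChartedSpace H' N]
variable {I : ModelWithCorners ℝ E H} {I' : ModelWithCorners ℝ E' H'} [I.Boundaryless]
  [I'.Boundaryless]

theorem isOpen_extend_image (e : OpenPartialHomeomorph M H) {s : Set M} (hs : IsOpen s)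
    (hse : s ⊆ e.source) : IsOpen (e.extend I '' s) := by
  have h : e.extend I '' s = I.toHomeomorph '' (e '' s) := by
    rw [Set.image_image]; rfl
  rw [h]
  exact I.toHomeomorph.isOpenMap _ (e.isOpen_image_of_subset_source hs hse)

theorem _root_.HolderOnWith.of_eqOn {X Y : Type*} [PseudoEMetricSpace X] [PseudoEMetricSpace Y]
    {C r : ℝ≥0} {f g : X → Y} {s : Set X} (hf : HolderOnWith C r f s) (h : EqOn g f s) :
    HolderOnWith C r g s := fun x hx y hy => by
  rw [h hx, h hy]
  exact hf x hx y hy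

/-- A map of class `C^{j,α}_loc` has this regularity in all smooth coordinates, and even after
composition with arbitrary smooth maps. -/
theorem IsCkaLoc.ckaAt [IsManifold I ∞ M] [IsManifold I' ∞ N] {j : ℕ} (hj : 1 ≤ j) {α : ℝ≥0}
    (hα : α ≤ 1) {f : M → N} (hf : IsCkaLoc I I' (j : ℕ∞) α f) {a : E'' → M} {b : N → W} {y : E''}
    (ha : ContMDiffAt 𝓘(ℝ, E'') I ∞ a y) (hb : ContMDiffAt I' 𝓘(ℝ, W) ∞ b (f (a y))) :
    CkaAt α j (fun z => b (f (a z))) y := by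
  obtain ⟨e, he, e', he', hx, hfx, C, hC⟩ := hf.2 j rfl (a y)
  set g : E → E' := e'.extend I' ∘ f ∘ (e.extend I).symm with hg
  have hα1 : (α : ℝ) ≤ 1 := hα
  have hopen : IsOpen (e.source ∩ f ⁻¹' e'.source) :=
    e.open_source.inter (e'.open_source.preimage hf.1.continuous)
  have hD := isOpen_extend_image (I := I) e hopen inter_subset_left
  have hxD : e.extend I (a y) ∈ e.extend I '' (e.source ∩ f ⁻¹' e'.source) :=
    mem_image_of_mem _ ⟨hx, hfx⟩
  have hle : ((j : ℕ∞) : ℕ∞ω) ≤ (∞ : ℕ∞ω) := by exact_mod_cast le_top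
  have hgd : ContDiffAt ℝ j g (e.extend I (a y)) := by
    have h := ((contMDiffWithinAt_iff_of_mem_maximalAtlas (s := univ)
      (IsManifold.maximalAtlas_subset_of_le hle he)
      (IsManifold.maximalAtlas_subset_of_le hle he') hx hfx).1
      (hf.1 (a y)).contMDiffWithinAt).2
    rw [preimage_univ, univ_inter, I.range_eq_univ, contDiffWithinAt_univ] at h
    exact h
  have hgc : CkaAt α j g (e.extend I (a y)) :=
    CkaAt.of_holderOnWith hgd (hD.mem_nhds hxD)
      (hC.of_eqOn (iteratedFDerivWithin_of_isOpen j hD).symm)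
  have hin : ContDiffAt ℝ ∞ (fun z => e.extend I (a z)) y := by
    rw [← contMDiffAt_iff_contDiffAt]
    exact ContMDiffAt.comp y (e.contMDiffAt_extend he hx) ha
  have hgx : g (e.extend I (a y)) = e'.extend I' (f (a y)) := by
    simp only [hg, Function.comp_apply, e.extend_left_inv hx]
  have hout : ContDiffAt ℝ ∞ (fun z => b ((e'.extend I').symm z)) (g (e.extend I (a y))) := by
    rw [← contMDiffAt_iff_contDiffAt, hgx]
    refine ContMDiffAt.comp (I' := I') _ (by rwa [e'.extend_left_inv hfx]) ?_
    refine (contMDiffOn_extend_symm he').contMDiffAt ?_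
    exact (I'.toHomeomorph.isOpenMap _ e'.open_target).mem_nhds
      (mem_image_of_mem _ (e'.map_source hfx))
  have hle1 : ((j + 1 : ℕ) : ℕ∞ω) ≤ (∞ : ℕ∞ω) := by exact_mod_cast le_top
  have h1 : CkaAt α j (fun z => e.extend I (a z)) y :=
    CkaAt.of_contDiffAt α.2 hα1 (hin.of_le hle1)
  have h2 : CkaAt α j (fun z => g (e.extend I (a z))) y := CkaAt.comp α.2 hα1 hj hgc h1
  have h3 : CkaAt α j (fun z => b ((e'.extend I').symm (g (e.extend I (a z))))) y :=
    CkaAt.contDiffAt_comp α.2 hα1 (f := fun z => b ((e'.extend I').symm z)) (hout.of_le hle1) h2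
  refine h3.congr ?_
  have h4 : ∀ᶠ z in 𝓝 y, a z ∈ e.source ∩ f ⁻¹' e'.source :=
    ha.continuousAt (hopen.mem_nhds ⟨hx, hfx⟩)
  filter_upwards [h4] with z hz
  simp only [hg, Function.comp_apply, e.extend_left_inv hz.1, e'.extend_left_inv hz.2]

/-- Regularity at the base points of the preferred charts is enough for being `C^{j,α}_loc`. -/
theorem IsCkaLoc.of_ckaAt [IsManifold I ∞ M] [IsManifold I' ∞ N] {j : ℕ} {α : ℝ≥0} {f : M → N}
    (hfc : Continuous f)
    (hf : ∀ x, CkaAt α j (fun z => extChartAt I' (f x) (f ((extChartAt I x).symm z)))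
      (extChartAt I x x)) : IsCkaLoc I I' (j : ℕ∞) α f := by
  refine ⟨fun x => ?_, fun i hi x => ?_⟩
  · rw [contMDiffAt_iff]
    refine ⟨hfc.continuousAt, ?_⟩
    exact ((hf x).contDiffAt α.2).contDiffWithinAt
  obtain rfl : i = j := by exact_mod_cast hi
  obtain ⟨U, hU, C, hC⟩ := (hf x).exists_holderOnWith
  have hO : extChartAt I x ⁻¹' U ∈ 𝓝 x := continuousAt_extChartAt x hU
  obtain ⟨O, hOU, hOo, hxO⟩ := mem_nhds_iff.1 hO
  refine ⟨(chartAt H x).restr O, restr_mem_maximalAtlas _ (IsManifold.chart_mem_maximalAtlas x) hOo,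
    chartAt H' (f x), IsManifold.chart_mem_maximalAtlas _, ?_, mem_chart_source _ _, C, ?_⟩
  · rw [OpenPartialHomeomorph.restr_source, hOo.interior_eq]
    exact ⟨mem_chart_source _ _, hxO⟩
  have hopen : IsOpen (((chartAt H x).restr O).source ∩ f ⁻¹' (chartAt H' (f x)).source) :=
    ((chartAt H x).restr O).open_source.inter
      ((chartAt H' (f x)).open_source.preimage hfc)
  have hD := isOpen_extend_image (I := I) ((chartAt H x).restr O) hopen inter_subset_left
  have hDU : ((chartAt H x).restr O).extend I ''
      (((chartAt H x).restr O).source ∩ f ⁻¹' (chartAt H' (f x)).source) ⊆ U := by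
    rintro _ ⟨y, ⟨hy, -⟩, rfl⟩
    rw [OpenPartialHomeomorph.restr_source, hOo.interior_eq] at hy
    exact hOU hy.2
  exact (hC.mono hDU).of_eqOn (iteratedFDerivWithin_of_isOpen _ hD)

end Charts

/-! ### Linearization of a germ -/

section Local

universe u

variable {E W W' : Type u} [NormedAddCommGroup E] [NormedSpace ℝ E] [NormedAddCommGroup W]
  [NormedSpace ℝ W] [NormedAddCommGroup W'] [NormedSpace ℝ W']
variable {α : ℝ} {j : ℕ} {f g : E → W}

/-- The germ of `f` at `0` is of class `C^{j,α}` and vanishes there to the order `j + α`. For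
a germ of class `C^{j,α}` the latter holds if the `j`-jet vanishes, see `FlatAt.of_ckaAt`. -/
def FlatAt (α : ℝ) (j : ℕ) (f : E → W) : Prop :=
  ∃ δ : ℝ, 0 < δ ∧ δ ≤ 1 ∧ WeightedHolder α δ j (j + α) f

namespace FlatAt

theorem of_ckaAt (hα : 0 ≤ α) (hf : CkaAt α j f 0) (h0 : ∀ i ≤ j, iteratedFDeriv ℝ i f 0 = 0) :
    FlatAt α j f := by
  obtain ⟨δ, hδ, hδ1, h⟩ := hf
  simp only [zero_add] at h
  exact ⟨δ, hδ, hδ1, h.of_iteratedFDeriv_eq_zero hα hδ1 hδ h0⟩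

theorem ckaAt (hα : 0 ≤ α) (hf : FlatAt α j f) : CkaAt α j f 0 := by
  obtain ⟨δ, hδ, hδ1, h⟩ := hf
  refine ⟨δ, hδ, hδ1, ?_⟩
  simpa only [zero_add] using h.mono_weight hα hδ1 (Or.inr le_rfl)

theorem congr (hf : FlatAt α j f) (h : f =ᶠ[𝓝 0] g) : FlatAt α j g := by
  obtain ⟨δ, hδ, hδ1, hw⟩ := hf
  obtain ⟨ε, hε, he⟩ := exists_ball_of_eventually h
  refine ⟨min δ ε, lt_min hδ hε, (min_le_left _ _).trans hδ1,
    (hw.restrict (min_le_left _ _)).congr fun x hx => ?_⟩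
  simpa using he x (Metric.ball_subset_ball (min_le_right _ _) hx)

theorem add (hf : FlatAt α j f) (hg : FlatAt α j g) : FlatAt α j (fun x => f x + g x) := by
  obtain ⟨δ, hδ, hδ1, hw⟩ := hf
  obtain ⟨ε, hε, -, he⟩ := hg
  exact ⟨min δ ε, lt_min hδ hε, (min_le_left _ _).trans hδ1,
    (hw.restrict (min_le_left _ _)).add (he.restrict (min_le_right _ _))⟩

theorem clm_comp (hα : 0 ≤ α) (hα1 : α ≤ 1) (L : W →L[ℝ] W') (hf : FlatAt α j f) :
    FlatAt α j (fun x => L (f x)) := by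
  obtain ⟨δ, hδ, hδ1, hw⟩ := hf
  exact ⟨δ, hδ, hδ1, hw.clm_comp hα hα1 hδ1 L⟩

theorem sub (hα : 0 ≤ α) (hα1 : α ≤ 1) (hf : FlatAt α j f) (hg : FlatAt α j g) :
    FlatAt α j (fun x => f x - g x) := by
  have := hf.add (hg.clm_comp hα hα1 (-ContinuousLinearMap.id ℝ W))
  simpa [sub_eq_add_neg] using this

theorem comp (hα : 0 ≤ α) (hα1 : α ≤ 1) (hj : 1 ≤ j) {G : E → E} (hf : FlatAt α j f)
    (hG : CkaAt α j G 0) (hG0 : G 0 = 0) : FlatAt α j (fun x => f (G x)) := by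
  obtain ⟨ε, hε, hε1, hw⟩ := hf
  obtain ⟨K, U, hU, hl⟩ := ContDiffAt.exists_lipschitzOnWith
    ((hG.contDiffAt hα).of_le (by exact_mod_cast hj))
  obtain ⟨δ, hδ, hδ1, hδε, hG1, hn, hlip⟩ := hG.exists_weight_one hα hα1 hU hl
    (ε := ε / (K + 1)) (by positivity)
  simp only [zero_add, hG0, sub_zero] at hG1 hn hlip
  refine ⟨δ, hδ, hδ1, WeightedHolder.comp hα hα1 hδ1 K.2 (fun x hx => ?_) hn hlip hw hG1⟩
  have hx' : ‖x‖ < δ := by simpa using hx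
  rw [mem_ball_zero_iff]
  calc ‖G x‖ ≤ K * ‖x‖ := hn x hx
    _ ≤ (K + 1) * ‖x‖ := by gcongr; linarith
    _ < (K + 1) * (ε / (K + 1)) := by gcongr; exact hx'.trans_le hδε
    _ = ε := by field_simp

theorem exists_bound (hα : 0 ≤ α) (hf : FlatAt α j f) :
    ∃ C : ℝ, 0 ≤ C ∧ ∀ᶠ x in 𝓝 0, ‖f x‖ ≤ C * ‖x‖ ^ (j + α) := by
  obtain ⟨δ, hδ, -, hw⟩ := hf
  obtain ⟨C, hC, h⟩ := hw.bound
  rw [max_eq_left (by positivity)] at h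
  exact ⟨C, hC, Filter.mem_of_superset (Metric.ball_mem_nhds 0 hδ) h⟩

theorem apply_zero (hj : 1 ≤ j) (hα : 0 ≤ α) (hf : FlatAt α j f) : f 0 = 0 := by
  obtain ⟨C, -, h⟩ := hf.exists_bound hα
  have hp : (j : ℝ) + α ≠ 0 := by positivity
  simpa [Real.zero_rpow hp] using h.self_of_nhds

theorem fderiv_zero (hj : 1 ≤ j) (hp : 1 < j + α) (hf : FlatAt α j f) : fderiv ℝ f 0 = 0 := by
  obtain ⟨δ, hδ, -, hw⟩ := hf
  obtain ⟨j, rfl⟩ := Nat.exists_eq_succ_of_ne_zero (by omega : j ≠ 0)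
  obtain ⟨C, -, h⟩ := hw.2.2.bound
  have := h 0 (by simpa using hδ)
  rw [norm_zero, Real.zero_rpow (lt_max_of_lt_left (by linarith)).ne', mul_zero] at this
  exact norm_le_zero_iff.1 this

end FlatAt

theorem CkaAt.eventually {a : ℝ≥0} {x : E} (hf : CkaAt a j f x) : ∀ᶠ y in 𝓝 x, CkaAt a j f y := by
  obtain ⟨U, hU, C, hC⟩ := hf.exists_holderOnWith
  filter_upwards [(hf.contDiffAt a.2).eventually (by simp), eventually_mem_nhds_iff.2 hU]
    with y hy hyU
  exact CkaAt.of_holderOnWith hy hyU hC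

/-- If `‖y n‖` decreases at the rate `r` and `w n = O(‖y n‖ ^ p)`, then `w n = D (w (n + 1))` with
`‖D‖ r ^ p < 1` forces `w 0 = 0`. -/
theorem eq_zero_of_contraction {y : ℕ → E} {w : ℕ → W} {D : W →L[ℝ] W} {r p C : ℝ} (hr : 0 ≤ r)
    (hp : 0 ≤ p) (hC : 0 ≤ C) (hD : ‖D‖ * r ^ p < 1) (hy : ∀ n, ‖y (n + 1)‖ ≤ r * ‖y n‖)
    (hw : ∀ n, w n = D (w (n + 1))) (hb : ∀ n, ‖w n‖ ≤ C * ‖y n‖ ^ p) : w 0 = 0 := by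
  have hy' : ∀ n, ‖y n‖ ≤ r ^ n * ‖y 0‖ := by
    intro n
    induction n with
    | zero => simp
    | succ n ih =>
      calc _ ≤ r * ‖y n‖ := hy n
        _ ≤ r * (r ^ n * ‖y 0‖) := by gcongr
        _ = _ := by ring
  have hw' : ∀ n, ‖w 0‖ ≤ ‖D‖ ^ n * ‖w n‖ := by
    intro n
    induction n with
    | zero => simp
    | succ n ih =>
      calc _ ≤ ‖D‖ ^ n * ‖w n‖ := ih
        _ ≤ ‖D‖ ^ n * (‖D‖ * ‖w (n + 1)‖) := by
          gcongr
          conv_lhs => rw [hw n]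
          exact D.le_opNorm _
        _ = _ := by ring
  have hfin : ∀ n, ‖w 0‖ ≤ C * ‖y 0‖ ^ p * (‖D‖ * r ^ p) ^ n := by
    intro n
    calc ‖w 0‖ ≤ ‖D‖ ^ n * ‖w n‖ := hw' n
      _ ≤ ‖D‖ ^ n * (C * ‖y n‖ ^ p) := by gcongr; exact hb n
      _ ≤ ‖D‖ ^ n * (C * (r ^ n * ‖y 0‖) ^ p) := by
        gcongr
        exact hy' n
      _ = _ := by
        have hrn : (r ^ n) ^ p = (r ^ p) ^ n := by
          rw [← Real.rpow_natCast r n, ← Real.rpow_mul hr, mul_comm (n : ℝ) p, Real.rpow_mul hr,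
            Real.rpow_natCast]
        rw [Real.mul_rpow (by positivity) (by positivity), hrn, mul_pow]
        ring
  have hlim : Tendsto (fun n : ℕ => C * ‖y 0‖ ^ p * (‖D‖ * r ^ p) ^ n) atTop (𝓝 0) := by
    have := (tendsto_pow_atTop_nhds_zero_of_lt_one (by positivity) hD).const_mul (C * ‖y 0‖ ^ p)
    simpa using this
  exact norm_le_zero_iff.1 (ge_of_tendsto' hlim hfin)

variable {A B : E →L[ℝ] E}

/-- The rate of expansion `‖A⁻ᴺ‖` is at least `r⁻¹`, so that `‖A⁻ᴺ‖ r ^ p < 1` is impossible for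
`p ≤ 1`. -/
theorem one_lt_of_contraction [Nontrivial E] (hAB : A * B = 1) {N : ℕ} {r p : ℝ} (hr : 0 < r)
    (hr1 : r < 1) (hA : ‖A ^ N‖ < r) (hB : ‖B ^ N‖ * r ^ p < 1) : 1 < p := by
  by_contra! hp
  have h1 : A ^ N * B ^ N = 1 := pow_mul_pow_eq_one N hAB
  have h2 : 1 ≤ ‖A ^ N‖ * ‖B ^ N‖ := by
    rw [← ContinuousLinearMap.norm_id (𝕜 := ℝ) (E := E)]
    refine le_trans (le_of_eq ?_) (norm_mul_le (A ^ N) (B ^ N))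
    rw [h1]; rfl
  have h3 : r ≤ r ^ p := by
    simpa using Real.rpow_le_rpow_of_exponent_ge hr hr1.le hp
  have h4 : ‖A ^ N‖ * ‖B ^ N‖ ≤ ‖B ^ N‖ * r ^ p := by
    rw [mul_comm]
    gcongr
    exact hA.le.trans h3
  linarith

theorem CkaAt.iterate (hα : 0 ≤ α) (hα1 : α ≤ 1) (hj : 1 ≤ j) {F : E → E} (hF : CkaAt α j F 0)
    (hF0 : F 0 = 0) (n : ℕ) : CkaAt α j F^[n] 0 := by
  induction n with
  | zero => exact CkaAt.of_contDiffAt hα hα1 contDiffAt_id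
  | succ n ih =>
    have : F^[n + 1] = fun x => F (F^[n] x) := funext fun x => Function.iterate_succ_apply' F n x
    rw [this]
    exact CkaAt.comp hα hα1 hj (by rwa [Function.iterate_fixed hF0]) ih

/-- The local linearization. Let `B = A⁻¹` and let `P` be a formal linearization of `F` to the
order `j`. For `n = N` the remainder `A⁻ⁿ ∘ P ∘ Fⁿ - P` is flat, and `ψ = P + φ` conjugates `Fᴺ` to
`Aᴺ` if `φ` solves `φ = A⁻ᴺ ∘ φ ∘ Fᴺ + (A⁻ᴺ ∘ P ∘ Fᴺ - P)`. As `N` is chosen such that this equation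
is contracting, its solution is flat. -/
theorem exists_local_linearization [FiniteDimensional ℝ E] {k : ℕ∞} {F : E → E} (hα : 0 ≤ α)
    (hα1 : α ≤ 1) (hj : 1 ≤ j) (hAB : A * B = 1) (hBA : B * A = 1) (hnr : IsNonresonantEnd A k)
    (hjk : (j : ℕ∞) ≤ k) (hF : CkaAt α j F 0) (hF0 : F 0 = 0) (hFA : HasFDerivAt F A 0)
    {N : ℕ} {r : ℝ} (hr : 0 < r) (hr1 : r < 1) (hA : ‖A ^ N‖ < r)
    (hB : ‖B ^ N‖ * r ^ (j + α) < 1) :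
    ∃ ψ : E → E, CkaAt α j ψ 0 ∧ ψ 0 = 0 ∧ HasFDerivAt ψ (1 : E →L[ℝ] E) 0 ∧
      (∀ᶠ x in 𝓝 0, ψ (F^[N] x) = (A ^ N) (ψ x)) ∧ FlatAt α j (fun x => B (ψ (F x)) - ψ x) := by
  obtain ⟨P, hP, hP0, hP1, hPj⟩ := exists_formal_linearization hAB hBA hnr hjk hj
    (hF.contDiffAt hα) hF0 hFA.fderiv hj le_rfl
  have hPc : ∀ x, CkaAt α j P x := fun x =>
    CkaAt.of_contDiffAt hα hα1 (hP.contDiffAt.of_le (mod_cast le_top))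
  have hR1 : FlatAt α j (fun x => B (P (F x)) - P x) :=
    FlatAt.of_ckaAt hα (CkaAt.sub hα hα1
      (CkaAt.clm_comp hα hα1 B (CkaAt.comp hα hα1 hj (hPc _) hF)) (hPc _)) hPj
  have hFn := hF.iterate hα hα1 hj hF0
  have hFn0 : ∀ n, F^[n] 0 = 0 := fun n => Function.iterate_fixed hF0 n
  have hR : ∀ n, FlatAt α j (fun x => (B ^ n) (P (F^[n] x)) - P x) := by
    intro n
    induction n with
    | zero =>
      refine FlatAt.of_ckaAt hα ?_ ?_
      · simpa using CkaAt.of_contDiffAt hα hα1 contDiffAt_const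
      · intro i _
        simp
    | succ n ih =>
      refine ((FlatAt.clm_comp hα hα1 (B ^ n) (hR1.comp hα hα1 hj (hFn n) (hFn0 n))).add ih).congr
        (Eventually.of_forall fun x => ?_)
      simp only [Function.iterate_succ_apply', pow_succ, map_sub, mul_apply_eq_comp]
      abel
  have hp0 : (0 : ℝ) ≤ j + α := by positivity
  -- `F^[N]` contracts a small ball at the rate `r`
  obtain ⟨U, hU, hl⟩ : ∃ U ∈ 𝓝 (0 : E), LipschitzOnWith r.toNNReal F^[N] U := by
    have h1 : HasStrictFDerivAt F^[N] (A ^ N) 0 := by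
      have h := ((hFn N).contDiffAt hα).hasStrictFDerivAt (by norm_cast; omega)
      rwa [(HasFDerivAt.iterate hFA hF0 N).fderiv] at h
    refine h1.exists_lipschitzOnWith_of_nnnorm_lt r.toNNReal ?_
    rwa [Real.lt_toNNReal_iff_coe_lt]
  obtain ⟨ε, hε, hε1, hRw⟩ := hR N
  obtain ⟨δ, hδ, hδ1, hδε, hG1, hn, hlip⟩ := (hFn N).exists_weight_one hα hα1 hU hl hε
  simp only [zero_add, hFn0, sub_zero, Real.coe_toNNReal _ hr.le] at hG1 hn hlip
  have hmaps : ∀ x ∈ Metric.ball (0 : E) δ, F^[N] x ∈ Metric.ball (0 : E) δ := by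
    intro x hx
    have h := hn x hx
    rw [mem_ball_zero_iff] at hx ⊢
    nlinarith [norm_nonneg x]
  have hRw := hRw.restrict hδε
  obtain ⟨C, hC, hCb⟩ := hRw.bound
  rw [max_eq_left hp0] at hCb
  obtain ⟨φ, hφ, hφb⟩ := exists_solution (L := fun _ => B ^ N) hr.le hp0 hC (norm_nonneg (B ^ N))
    hB hmaps hn (fun _ _ => le_rfl) hCb
  have hφf : FlatAt α j φ := ⟨δ, hδ, hδ1, weightedHolder_of_solution hα hα1 hδ1 hr hr1
    (norm_nonneg (B ^ N)) le_rfl hB hmaps hn hlip hG1 (fun _ _ => le_rfl)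
    (WeightedHolder.const (B ^ N) j le_rfl) hRw hφ hφb⟩
  have hφ0 := hφf.apply_zero hj hα
  have hφc := hφf.ckaAt hα
  have hj0 : ((j : ℕ) : ℕ∞ω) ≠ 0 := by norm_cast; omega
  have hφ1 : fderiv ℝ φ 0 = 0 := by
    rcases subsingleton_or_nontrivial E with hE | hE
    · exact Subsingleton.elim _ _
    · exact hφf.fderiv_zero hj (one_lt_of_contraction hAB hr hr1 hA hB)
  refine ⟨fun x => P x + φ x, (hPc 0).add hφc, by simp [hP0, hφ0], ?_, ?_, ?_⟩
  · have h1 := (hP.differentiable (by simp) 0).hasFDerivAt.add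
      ((hφc.contDiffAt hα).differentiableAt hj0).hasFDerivAt
    rw [hP1, hφ1, add_zero] at h1
    exact h1
  · filter_upwards [Metric.ball_mem_nhds (0 : E) hδ] with x hx
    have hABN : ∀ v, (A ^ N) ((B ^ N) v) = v := fun v =>
      DFunLike.congr_fun (pow_mul_pow_eq_one N hAB) v
    rw [hφ x hx, map_add, map_add, map_sub, hABN, hABN]
    abel
  · refine (hR1.add ((FlatAt.clm_comp hα hα1 B (hφf.comp hα hα1 hj hF hF0)).sub hα hα1 hφf)).congr
      (Eventually.of_forall fun x => ?_)
    simp only [map_add]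
    abel

end Local

/-! ### Centred coordinates at a fixed point -/

section Coordinates

universe u

variable {E : Type u} [NormedAddCommGroup E] [NormedSpace ℝ E]
  {Q : Type*} [TopologicalSpace Q] [ChartedSpace E Q]

/-- The preferred chart at `x₀`, translated so that `x₀` has coordinates `0`. -/
noncomputable def toCoord (x₀ x : Q) : E := extChartAt 𝓘(ℝ, E) x₀ x - extChartAt 𝓘(ℝ, E) x₀ x₀

/-- The inverse of `toCoord x₀`. -/
noncomputable def ofCoord (x₀ : Q) (z : E) : Q :=
  (extChartAt 𝓘(ℝ, E) x₀).symm (z + extChartAt 𝓘(ℝ, E) x₀ x₀)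

/-- The coordinate expression near `x₀` of a map which fixes `x₀`. -/
noncomputable def coordMap (x₀ : Q) (f : Q → Q) (z : E) : E := toCoord x₀ (f (ofCoord x₀ z))

variable {x₀ : Q}

@[simp]
theorem toCoord_self : toCoord (E := E) x₀ x₀ = 0 := sub_self _

@[simp]
theorem ofCoord_zero : ofCoord x₀ (0 : E) = x₀ := by
  rw [ofCoord, zero_add, extChartAt_to_inv]

theorem continuousAt_toCoord : ContinuousAt (toCoord (E := E) x₀) x₀ :=
  (continuousAt_extChartAt x₀).sub continuousAt_const

theorem tendsto_add_coord :
    Tendsto (fun z : E => z + extChartAt 𝓘(ℝ, E) x₀ x₀) (𝓝 0) (𝓝 (extChartAt 𝓘(ℝ, E) x₀ x₀)) := by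
  have : ContinuousAt (fun z : E => z + extChartAt 𝓘(ℝ, E) x₀ x₀) 0 := by fun_prop
  simpa [ContinuousAt] using this

theorem continuousAt_ofCoord : Tendsto (ofCoord (E := E) x₀) (𝓝 0) (𝓝 x₀) := by
  have h := (continuousAt_extChartAt_symm (I := 𝓘(ℝ, E)) x₀).tendsto.comp tendsto_add_coord
  rwa [extChartAt_to_inv] at h

theorem eventually_ofCoord_toCoord : ∀ᶠ x in 𝓝 x₀, ofCoord (E := E) x₀ (toCoord x₀ x) = x := by
  filter_upwards [extChartAt_source_mem_nhds (I := 𝓘(ℝ, E)) x₀] with x hx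
  rw [ofCoord, toCoord, sub_add_cancel, (extChartAt 𝓘(ℝ, E) x₀).left_inv hx]

theorem eventually_toCoord_ofCoord : ∀ᶠ z in 𝓝 (0 : E), toCoord x₀ (ofCoord x₀ z) = z := by
  filter_upwards [tendsto_add_coord (extChartAt_target_mem_nhds (I := 𝓘(ℝ, E)) x₀)] with z hz
  rw [ofCoord, toCoord, (extChartAt 𝓘(ℝ, E) x₀).right_inv hz, add_sub_cancel_right]

section Smooth

variable [IsManifold 𝓘(ℝ, E) ∞ Q]

theorem contMDiffAt_extChartAt_symm (x : Q) : ContMDiffAt 𝓘(ℝ, E) 𝓘(ℝ, E) ∞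
    (extChartAt 𝓘(ℝ, E) x).symm (extChartAt 𝓘(ℝ, E) x x) :=
  (contMDiffOn_extChartAt_symm x).contMDiffAt (extChartAt_target_mem_nhds x)

theorem eventually_contMDiffAt_toCoord :
    ∀ᶠ x in 𝓝 x₀, ContMDiffAt 𝓘(ℝ, E) 𝓘(ℝ, E) ∞ (toCoord (E := E) x₀) x := by
  filter_upwards [chart_source_mem_nhds E x₀] with x hx
  exact (contMDiffAt_extChartAt' hx).sub contMDiffAt_const

theorem eventually_contMDiffAt_ofCoord :
    ∀ᶠ z in 𝓝 0, ContMDiffAt 𝓘(ℝ, E) 𝓘(ℝ, E) ∞ (ofCoord (E := E) x₀) z := by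
  have h : ∀ᶠ y in 𝓝 (extChartAt 𝓘(ℝ, E) x₀ x₀), (extChartAt 𝓘(ℝ, E) x₀).target ∈ 𝓝 y :=
    eventually_mem_nhds_iff.2 (extChartAt_target_mem_nhds x₀)
  filter_upwards [tendsto_add_coord h] with z hz
  refine ContMDiffAt.comp z ((contMDiffOn_extChartAt_symm x₀).contMDiffAt hz) ?_
  exact contMDiffAt_id.add contMDiffAt_const

theorem CkaAt.coordMap {j : ℕ} (hj : 1 ≤ j) {α : ℝ≥0} (hα : α ≤ 1) {f : Q → Q}
    (hf : IsCkaLoc 𝓘(ℝ, E) 𝓘(ℝ, E) (j : ℕ∞) α f) (hf0 : f x₀ = x₀) :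
    CkaAt α j (coordMap (E := E) x₀ f) 0 :=
  hf.ckaAt hj hα (a := ofCoord x₀) eventually_contMDiffAt_ofCoord.self_of_nhds
    (by rw [ofCoord_zero, hf0]; exact eventually_contMDiffAt_toCoord.self_of_nhds)

end Smooth

theorem coordMap_zero {f : Q → Q} (hf0 : f x₀ = x₀) : coordMap (E := E) x₀ f 0 = 0 := by
  simp [coordMap, hf0]

theorem eventually_coordMap_comp {f g : Q → Q} (hf : ContinuousAt f x₀) (hf0 : f x₀ = x₀) :
    ∀ᶠ z in 𝓝 (0 : E), coordMap x₀ g (coordMap x₀ f z) = coordMap x₀ (fun x => g (f x)) z := by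
  have h : Tendsto f (𝓝 x₀) (𝓝 x₀) := by simpa [ContinuousAt, hf0] using hf
  filter_upwards [(h.comp continuousAt_ofCoord).eventually (eventually_ofCoord_toCoord (E := E))]
    with z hz
  simp only [coordMap]
  rw [show ofCoord x₀ (toCoord (E := E) x₀ (f (ofCoord x₀ z))) = f (ofCoord x₀ z) from hz]

theorem hasFDerivAt_coordMap {f : Q → Q} (hf : MDifferentiableAt 𝓘(ℝ, E) 𝓘(ℝ, E) f x₀)
    (hf0 : f x₀ = x₀) :
    HasFDerivAt (coordMap x₀ f) (derivAtFixedPoint (E := E) f x₀) 0 := by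
  have h : HasFDerivWithinAt (extChartAt 𝓘(ℝ, E) (f x₀) ∘ f ∘ (extChartAt 𝓘(ℝ, E) x₀).symm)
    (derivAtFixedPoint (E := E) f x₀) (range 𝓘(ℝ, E)) (extChartAt 𝓘(ℝ, E) x₀ x₀) :=
    hf.hasMFDerivAt.2
  rw [hf0, ModelWithCorners.range_eq_univ, hasFDerivWithinAt_univ] at h
  have h2 : HasFDerivAt (fun z : E => z + extChartAt 𝓘(ℝ, E) x₀ x₀)
    (ContinuousLinearMap.id ℝ E) 0 := (hasFDerivAt_id 0).add_const _
  rw [← zero_add (extChartAt 𝓘(ℝ, E) x₀ x₀)] at h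
  exact (HasFDerivAt.comp (0 : E) h h2).sub_const _

/-- The derivative of `ψ : Q → E` at `x₀` as an endomorphism of `E = T_{x₀} Q`. -/
noncomputable def derivToModel (ψ : Q → E) (x₀ : Q) : E →L[ℝ] E :=
  (mfderiv 𝓘(ℝ, E) 𝓘(ℝ, E) ψ x₀ : TangentSpace 𝓘(ℝ, E) x₀ →L[ℝ] TangentSpace 𝓘(ℝ, E) (ψ x₀))

theorem hasFDerivAt_comp_ofCoord {ψ : Q → E} (hf : MDifferentiableAt 𝓘(ℝ, E) 𝓘(ℝ, E) ψ x₀) :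
    HasFDerivAt (fun z : E => ψ (ofCoord x₀ z)) (derivToModel ψ x₀) 0 := by
  have h : HasFDerivWithinAt (ψ ∘ (extChartAt 𝓘(ℝ, E) x₀).symm)
    (derivToModel ψ x₀) (range 𝓘(ℝ, E)) (extChartAt 𝓘(ℝ, E) x₀ x₀) :=
    hf.hasMFDerivAt.2
  rw [ModelWithCorners.range_eq_univ, hasFDerivWithinAt_univ] at h
  have h2 : HasFDerivAt (fun z : E => z + extChartAt 𝓘(ℝ, E) x₀ x₀)
    (ContinuousLinearMap.id ℝ E) 0 := (hasFDerivAt_id 0).add_const _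
  rw [← zero_add (extChartAt 𝓘(ℝ, E) x₀ x₀)] at h
  exact HasFDerivAt.comp (0 : E) h h2

theorem derivAtFixedPoint_comp {f g : Q → Q} (hf : MDifferentiableAt 𝓘(ℝ, E) 𝓘(ℝ, E) f x₀)
    (hf0 : f x₀ = x₀) (hg : MDifferentiableAt 𝓘(ℝ, E) 𝓘(ℝ, E) g x₀) (hg0 : g x₀ = x₀) :
    derivAtFixedPoint (E := E) (fun x => g (f x)) x₀ =
      derivAtFixedPoint (E := E) g x₀ * derivAtFixedPoint (E := E) f x₀ := by
  have hgf : MDifferentiableAt 𝓘(ℝ, E) 𝓘(ℝ, E) (fun x => g (f x)) x₀ :=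
    MDifferentiableAt.comp (I' := 𝓘(ℝ, E)) x₀ (by rwa [hf0]) hf
  have h1 := hasFDerivAt_coordMap hgf (by simp only [hf0, hg0])
  have h2 : HasFDerivAt (fun z => coordMap (E := E) x₀ g (coordMap x₀ f z))
      (derivAtFixedPoint (E := E) g x₀ * derivAtFixedPoint (E := E) f x₀) 0 := by
    refine HasFDerivAt.comp (0 : E) (g := coordMap x₀ g) ?_ (hasFDerivAt_coordMap hf hf0)
    rw [coordMap_zero hf0]
    exact hasFDerivAt_coordMap hg hg0
  exact h1.unique (h2.congr_of_eventuallyEq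
    ((eventually_coordMap_comp hf.continuousAt hf0).mono fun z hz => hz.symm))

theorem derivAtFixedPoint_id : derivAtFixedPoint (E := E) (fun x : Q => x) x₀ = 1 :=
  mfderiv_id (I := 𝓘(ℝ, E)) (x := x₀)

end Coordinates

/-! ### Dynamics near a globally attracting fixed point -/

section Attracting

universe u

variable {T : Type*} [AddCommGroup T] [One T] [Preorder T] [TopologicalSpace T]
  {E : Type u} [NormedAddCommGroup E] [NormedSpace ℝ E]
  {Q : Type*} [TopologicalSpace Q] [ChartedSpace E Q] {x₀ : Q}

theorem IsGloballyAttractingFixedPoint.eventually_forall_orbit {Φ : Flow T Q}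
    (h : IsGloballyAttractingFixedPoint Φ x₀) {P : Q → Prop} (hP : ∀ᶠ y in 𝓝 x₀, P y) :
    ∀ᶠ y in 𝓝 x₀, ∀ t : T, 0 ≤ t → P (Φ t y) := by
  obtain ⟨V, hV, h⟩ := h.stable _ hP
  exact mem_of_superset hV h

theorem IsCkaLoc.mdifferentiableAt {Q' : Type*} [TopologicalSpace Q'] [ChartedSpace E Q']
    {f : Q → Q'} {k : ℕ∞} (hk : 1 ≤ k) {α : ℝ≥0}
    (hf : IsCkaLoc 𝓘(ℝ, E) 𝓘(ℝ, E) k α f) (x : Q) : MDifferentiableAt 𝓘(ℝ, E) 𝓘(ℝ, E) f x :=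
  (hf.1 x).mdifferentiableAt (by
    have : ((1 : ℕ∞) : ℕ∞ω) ≤ k := by exact_mod_cast hk
    intro h
    rw [h] at this
    simp at this)

/-- The derivatives at the fixed point form a representation of the group of times. -/
theorem derivAtFixedPoint_add {Φ : Flow T Q} (h0 : ∀ t, Φ t x₀ = x₀)
    (hd : ∀ t, MDifferentiableAt 𝓘(ℝ, E) 𝓘(ℝ, E) (Φ t) x₀) (s t : T) :
    derivAtFixedPoint (E := E) (Φ (s + t)) x₀ =
      derivAtFixedPoint (E := E) (Φ s) x₀ * derivAtFixedPoint (E := E) (Φ t) x₀ := by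
  rw [← derivAtFixedPoint_comp (hd t) (h0 t) (hd s) (h0 s)]
  congr 1
  ext x
  exact Φ.map_add s t x

theorem derivAtFixedPoint_zero {Φ : Flow T Q} :
    derivAtFixedPoint (E := E) (Φ 0) x₀ = 1 := by
  rw [← derivAtFixedPoint_id (x₀ := x₀)]
  congr 1
  ext x
  exact Φ.map_zero_apply x

end Attracting

section Cascade

universe u

variable {E : Type u} [NormedAddCommGroup E] [NormedSpace ℝ E]
  {Q : Type*} [TopologicalSpace Q] [ChartedSpace E Q] {x₀ : Q} {Φ : Flow ℤ Q}

theorem derivAtFixedPoint_natCast (h0 : ∀ t, Φ t x₀ = x₀)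
    (hd : ∀ t, MDifferentiableAt 𝓘(ℝ, E) 𝓘(ℝ, E) (Φ t) x₀) (t : ℤ) (n : ℕ) :
    derivAtFixedPoint (E := E) (Φ (n * t)) x₀ = derivAtFixedPoint (E := E) (Φ t) x₀ ^ n := by
  induction n with
  | zero => simpa using derivAtFixedPoint_zero (Φ := Φ)
  | succ n ih => rw [pow_succ, ← ih, ← derivAtFixedPoint_add h0 hd]; push_cast; ring_nf

theorem IsGloballyAttractingFixedPoint.tendsto_nat (h : IsGloballyAttractingFixedPoint Φ x₀)
    {N : ℕ} (hN : 1 ≤ N) (x : Q) : Tendsto (fun n : ℕ => Φ (n * N : ℤ) x) atTop (𝓝 x₀) := by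
  refine (h.attracting x).comp ?_
  have : Tendsto (fun n : ℕ => n * N) atTop atTop :=
    tendsto_id.atTop_mul_const' (by omega)
  have h2 : Tendsto (fun n : ℕ => ((n * N : ℕ) : ℤ)) atTop atTop :=
    tendsto_natCast_atTop_atTop.comp this
  exact_mod_cast h2

/-- A property which holds near the attracting fixed point and is inherited by preimages holds
everywhere. -/
theorem IsGloballyAttractingFixedPoint.forall_of_eventually
    (h : IsGloballyAttractingFixedPoint Φ x₀) {N : ℕ} (hN : 1 ≤ N) {P : Q → Prop}
    (hP : ∀ᶠ y in 𝓝 x₀, P y) (hback : ∀ y, P (Φ N y) → P y) (x : Q) : P x := by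
  have hback' : ∀ n : ℕ, P (Φ (n * N : ℤ) x) → P x := by
    intro n
    induction n with
    | zero => intro h; simpa using h
    | succ n ih =>
      intro h
      refine ih (hback _ ?_)
      rw [← Φ.map_add]
      convert h using 2
      push_cast
      ring
  obtain ⟨n, hn⟩ := ((h.tendsto_nat hN x).eventually hP).exists
  exact hback' n hn

theorem eventually_iterate_coordMap (h0 : ∀ t, Φ t x₀ = x₀) (n : ℕ) :
    ∀ᶠ z in 𝓝 (0 : E), (coordMap x₀ (Φ 1))^[n] z = coordMap x₀ (Φ n) z := by
  induction n with
  | zero =>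
    filter_upwards [eventually_toCoord_ofCoord (x₀ := x₀)] with z hz
    simp [coordMap, hz]
  | succ n ih =>
    have hc : ContinuousAt (Φ n) x₀ := (Φ.continuous_toFun n).continuousAt
    filter_upwards [ih, eventually_coordMap_comp (g := Φ 1) hc (h0 n)] with z hz hz2
    rw [Function.iterate_succ_apply', hz, hz2]
    congr 1
    ext x
    rw [← Φ.map_add]
    push_cast
    rw [add_comm]

/-- The eigenvalues of the derivative at a globally attracting fixed point lie in the closed unit
disc. -/
theorem norm_le_one_of_attracting [FiniteDimensional ℝ E]
    (h : IsGloballyAttractingFixedPoint Φ x₀)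
    (hd : MDifferentiableAt 𝓘(ℝ, E) 𝓘(ℝ, E) (Φ 1) x₀) {z : ℂ}
    (hz : IsComplexEigenvalue (derivAtFixedPoint (E := E) (Φ 1) x₀ : E →ₗ[ℝ] E) z) : ‖z‖ ≤ 1 := by
  refine norm_le_one_of_stable (hasFDerivAt_coordMap hd (h.fixed 1)) (coordMap_zero (h.fixed 1))
    (fun ε hε => ?_) hz
  have hU : ∀ᶠ y in 𝓝 x₀, ofCoord (E := E) x₀ (toCoord x₀ y) = y ∧ ‖toCoord (E := E) x₀ y‖ < ε := by
    refine eventually_ofCoord_toCoord.and ?_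
    have := (continuousAt_toCoord (E := E) (x₀ := x₀)).norm
    exact this.eventually_lt_const (by simpa using hε)
  filter_upwards [continuousAt_ofCoord.eventually (h.eventually_forall_orbit hU),
    eventually_toCoord_ofCoord (x₀ := x₀)] with w hw hw2
  refine ⟨fun n => toCoord x₀ (Φ n (ofCoord x₀ w)), by simpa using hw2, fun n => ?_,
    fun n => (hw n (by positivity)).2, ?_⟩
  · rw [coordMap, (hw n (by positivity)).1, ← Φ.map_add]
    push_cast
    rw [add_comm]
  · have h1 := h.tendsto_nat le_rfl (ofCoord x₀ w)
    have h2 := (continuousAt_toCoord (E := E) (x₀ := x₀)).tendsto.comp h1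
    simpa [Function.comp_def] using h2

theorem mem_spectrum_complexDeriv [FiniteDimensional ℝ E] {f : Q → Q} {z : ℂ} :
    z ∈ spectrum ℂ (complexDeriv (E := E) f x₀) ↔
      IsComplexEigenvalue (derivAtFixedPoint (E := E) f x₀ : E →ₗ[ℝ] E) z :=
  Module.End.hasEigenvalue_iff_mem_spectrum.symm

/-- The bound on the spectral spread, rewritten without logarithms. -/
theorem rpow_lt_of_spread_lt [FiniteDimensional ℝ E] {f : Q → Q} {p : ℝ}
    (hp : spread (complexDeriv (E := E) f x₀) (complexDeriv (E := E) f x₀) < p) {z μ : ℂ}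
    (hz : IsComplexEigenvalue (derivAtFixedPoint (E := E) f x₀ : E →ₗ[ℝ] E) z)
    (hz0 : z ≠ 0) (hz1 : ‖z‖ < 1)
    (hμ : IsComplexEigenvalue (derivAtFixedPoint (E := E) f x₀ : E →ₗ[ℝ] E) μ) (hμ0 : μ ≠ 0) :
    ‖z‖ ^ p < ‖μ‖ := by
  have hfin : (spectrum ℂ (complexDeriv (E := E) f x₀)).Finite := by
    refine (finite_isComplexEigenvalue (derivAtFixedPoint (E := E) f x₀ : E →ₗ[ℝ] E)).subset ?_
    intro z hz
    exact mem_spectrum_complexDeriv.1 hz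
  have hle : Real.log ‖μ‖ / Real.log ‖z‖ ≤
      spread (complexDeriv (E := E) f x₀) (complexDeriv (E := E) f x₀) := by
    refine le_csSup ?_ ⟨μ, mem_spectrum_complexDeriv.2 hμ, z, mem_spectrum_complexDeriv.2 hz, rfl⟩
    refine ((hfin.image2 (fun μ z => Real.log ‖μ‖ / Real.log ‖z‖) hfin).subset ?_).bddAbove
    rintro _ ⟨μ, hμ, z, hz, rfl⟩
    exact mem_image2_of_mem hμ hz
  have hlog : Real.log ‖z‖ < 0 := Real.log_neg (norm_pos_iff.2 hz0) hz1
  have h := hle.trans_lt hp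
  rw [div_lt_iff_of_neg hlog] at h
  rw [← Real.log_lt_log_iff (Real.rpow_pos_of_pos (norm_pos_iff.2 hz0) p) (norm_pos_iff.2 hμ0),
    Real.log_rpow (norm_pos_iff.2 hz0)]
  exact h

theorem coe_natCast_add (j : ℕ) (α : ℝ≥0) :
    ((((j : ℕ∞) : ℝ≥0∞) + (α : ℝ≥0∞) : ℝ≥0∞) : EReal) = ((j + α : ℝ) : EReal) := by
  have h : ((j : ℕ∞) : ℝ≥0∞) + (α : ℝ≥0∞) = ((j + α : ℝ≥0) : ℝ≥0∞) := by simp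
  rw [h, EReal.coe_nnreal_eq_coe_real]
  simp

/-- What the spectral hypotheses of the linearization theorem amount to for `A = D_{x₀} Φ¹`. -/
theorem SternbergCondition.exists_rates [FiniteDimensional ℝ E] {j : ℕ} {α : ℝ≥0}
    (hS : SternbergCondition (E := E) Φ x₀ (j : ℕ∞) α)
    (hd : ∀ t, MDifferentiableAt 𝓘(ℝ, E) 𝓘(ℝ, E) (Φ t) x₀) :
    ∃ N : ℕ, 1 ≤ N ∧ ∃ r : ℝ, 0 < r ∧ r < 1 ∧ ‖derivAtFixedPoint (E := E) (Φ 1) x₀ ^ N‖ < r ∧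
      ‖derivAtFixedPoint (E := E) (Φ (-1)) x₀ ^ N‖ * r ^ (j + α : ℝ) < 1 := by
  have hadd := derivAtFixedPoint_add hS.attracting.fixed hd
  have hAB : derivAtFixedPoint (E := E) (Φ 1) x₀ * derivAtFixedPoint (E := E) (Φ (-1)) x₀ = 1 := by
    rw [← hadd, add_neg_cancel, derivAtFixedPoint_zero]
  have hBA : (derivAtFixedPoint (E := E) (Φ (-1)) x₀ : E →ₗ[ℝ] E) *
      (derivAtFixedPoint (E := E) (Φ 1) x₀ : E →ₗ[ℝ] E) = 1 := by
    have h : derivAtFixedPoint (E := E) (Φ (-1)) x₀ * derivAtFixedPoint (E := E) (Φ 1) x₀ = 1 := by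
      rw [← hadd, neg_add_cancel, derivAtFixedPoint_zero]
    ext v; exact DFunLike.congr_fun h v
  have hp : spread (complexDeriv (E := E) (Φ 1) x₀) (complexDeriv (E := E) (Φ 1) x₀) <
      (j + α : ℝ) := by
    have h := hS.spread_lt
    rw [coe_natCast_add] at h
    exact_mod_cast h
  have h1 : ∀ z, IsComplexEigenvalue (derivAtFixedPoint (E := E) (Φ 1) x₀ : E →ₗ[ℝ] E) z →
      ‖z‖ < 1 := fun z hz => lt_of_le_of_ne (norm_le_one_of_attracting hS.attracting (hd 1) hz)
        (hS.hyperbolic z (mem_spectrum_complexDeriv.2 hz))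
  exact exists_pow_contraction hAB (by positivity) h1 fun z μ hz hμ =>
    rpow_lt_of_spread_lt hp hz (hz.of_inverse hBA).1 (h1 z hz) hμ (hμ.of_inverse hBA).1

end Cascade

/-! ### The global conjugacy -/

section Conjugacy

universe u

variable {E : Type u} [NormedAddCommGroup E] [NormedSpace ℝ E]
  {Q : Type*} [TopologicalSpace Q] [ChartedSpace E Q] {x₀ : Q} {Φ : Flow ℤ Q} {j : ℕ}

theorem tendsto_toCoord : Tendsto (toCoord (E := E) x₀) (𝓝 x₀) (𝓝 0) := by
  simpa [ContinuousAt] using continuousAt_toCoord (E := E) (x₀ := x₀)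

/-- The uniqueness principle: a flat map `χ` with `χ = D ∘ χ ∘ Φᴺ` vanishes if `D` does not
compensate for the contraction of `Φᴺ`. -/
theorem eq_zero_of_flat {α : ℝ} (hα : 0 ≤ α) (h : IsGloballyAttractingFixedPoint Φ x₀)
    (hd : ∀ t, MDifferentiableAt 𝓘(ℝ, E) 𝓘(ℝ, E) (Φ t) x₀) {N : ℕ} (hN : 1 ≤ N) {r : ℝ}
    (hr : 0 < r) (hA : ‖derivAtFixedPoint (E := E) (Φ 1) x₀ ^ N‖ < r) {D : E →L[ℝ] E}
    (hD : ‖D‖ * r ^ (j + α) < 1) {χ : Q → E} (hχ : ∀ x, χ x = D (χ (Φ N x)))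
    (hflat : FlatAt α j (fun z : E => χ (ofCoord x₀ z))) (x : Q) : χ x = 0 := by
  refine h.forall_of_eventually hN (P := fun y => χ y = 0) ?_
    (fun y hy => by rw [hχ, hy, map_zero]) x
  have hp : (0 : ℝ) ≤ j + α := by positivity
  obtain ⟨C, hC, hCb⟩ := hflat.exists_bound hα
  have hG : ∀ᶠ z in 𝓝 (0 : E), ‖coordMap x₀ (Φ N) z‖ ≤ r * ‖z‖ := by
    have h1 := hasFDerivAt_coordMap (hd N) (h.fixed N)
    have h2 := derivAtFixedPoint_natCast h.fixed hd 1 N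
    rw [mul_one] at h2
    rw [h2] at h1
    filter_upwards [h1.isLittleO.def (sub_pos.2 hA)] with z hz
    rw [coordMap_zero (h.fixed N), sub_zero, sub_zero] at hz
    have h3 := (derivAtFixedPoint (E := E) (Φ 1) x₀ ^ N).le_opNorm z
    have h4 := norm_le_norm_add_norm_sub' (coordMap x₀ (Φ N) z)
      ((derivAtFixedPoint (E := E) (Φ 1) x₀ ^ N) z)
    linarith
  have hev : ∀ᶠ y in 𝓝 x₀, ‖toCoord (E := E) x₀ (Φ N y)‖ ≤ r * ‖toCoord (E := E) x₀ y‖ ∧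
      ‖χ y‖ ≤ C * ‖toCoord (E := E) x₀ y‖ ^ (j + α) := by
    filter_upwards [tendsto_toCoord.eventually hG, tendsto_toCoord.eventually hCb,
      eventually_ofCoord_toCoord (E := E) (x₀ := x₀)] with y h1 h2 h3
    rw [coordMap, h3] at h1
    rw [h3] at h2
    exact ⟨h1, h2⟩
  filter_upwards [h.eventually_forall_orbit hev] with y hy
  have hstep : ∀ n : ℕ, Φ ((n + 1 : ℕ) * N : ℤ) y = Φ N (Φ (n * N : ℤ) y) := by
    intro n
    rw [← Φ.map_add]
    congr 1
    push_cast
    ring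
  have := eq_zero_of_contraction (y := fun n : ℕ => toCoord (E := E) x₀ (Φ (n * N : ℤ) y))
    (w := fun n : ℕ => χ (Φ (n * N : ℤ) y)) hr.le hp hC hD (fun n => ?_) (fun n => ?_) (fun n => ?_)
  · simpa using this
  · rw [hstep]
    exact (hy _ (by positivity)).1
  · rw [hstep]
    exact hχ _
  · exact (hy _ (by positivity)).2

/-- A local conjugacy of `Φᴺ` with an invertible linear map `A` extends to the whole of `Q`. -/
theorem exists_extension (h : IsGloballyAttractingFixedPoint Φ x₀) {N : ℕ} (hN : 1 ≤ N)
    {A B : E →L[ℝ] E} (hAB : A * B = 1) (hBA : B * A = 1) {ψ₀ : Q → E}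
    (hψ₀ : ∀ᶠ y in 𝓝 x₀, ψ₀ (Φ N y) = A (ψ₀ y)) :
    ∃ ψ : Q → E, (∀ x, ψ (Φ N x) = A (ψ x)) ∧ ψ =ᶠ[𝓝 x₀] ψ₀ := by
  have hBA' : ∀ v, B (A v) = v := fun v => DFunLike.congr_fun hBA v
  have hstep : ∀ (n : ℕ) (x : Q), Φ ((n + 1 : ℕ) * N : ℤ) x = Φ N (Φ (n * N : ℤ) x) := by
    intro n x
    rw [← Φ.map_add]
    congr 1
    push_cast
    ring
  have hstep' : ∀ (n : ℕ) (x : Q), Φ (n * N : ℤ) (Φ N x) = Φ ((n + 1 : ℕ) * N : ℤ) x := by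
    intro n x
    rw [← Φ.map_add]
    congr 1
    push_cast
    ring
  have hV := h.eventually_forall_orbit hψ₀
  -- the sequence `B ^ n ∘ ψ₀ ∘ Φ^(nN)` becomes stationary at every point
  have hconst : ∀ x (n : ℕ), (∀ t : ℤ, 0 ≤ t → ψ₀ (Φ N (Φ t (Φ (n * N : ℤ) x))) =
      A (ψ₀ (Φ t (Φ (n * N : ℤ) x)))) → ∀ m, n ≤ m →
      (B ^ m) (ψ₀ (Φ (m * N : ℤ) x)) = (B ^ n) (ψ₀ (Φ (n * N : ℤ) x)) := by
    intro x n hx m hm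
    induction m, hm using Nat.le_induction with
    | base => rfl
    | succ m hm ih =>
      have h1 := hx ((m - n : ℤ) * N) (by
        have : (n : ℤ) ≤ m := by exact_mod_cast hm
        have : (0 : ℤ) ≤ m - n := by omega
        positivity)
      rw [← Φ.map_add ((m - n : ℤ) * N), show ((m - n : ℤ) * N + n * N : ℤ) = m * N by ring] at h1
      rw [← ih, hstep, h1, pow_succ, mul_apply_eq_comp, hBA']
  have hex : ∀ x, ∃ v, ∀ᶠ m : ℕ in atTop, (B ^ m) (ψ₀ (Φ (m * N : ℤ) x)) = v := by
    intro x
    obtain ⟨n, hn⟩ := ((h.tendsto_nat hN x).eventually hV).exists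
    exact ⟨_, (eventually_ge_atTop n).mono (hconst x n hn)⟩
  choose ψ hψ using hex
  refine ⟨ψ, fun x => ?_, ?_⟩
  · obtain ⟨m, h1, h2⟩ := ((hψ (Φ N x)).and ((tendsto_add_atTop_nat 1).eventually (hψ x))).exists
    rw [← h1, ← h2, hstep', pow_succ', mul_apply_eq_comp]
    exact (DFunLike.congr_fun hAB _).symm
  · filter_upwards [hV] with x hx
    obtain ⟨m, h1⟩ := (hψ x).exists
    rw [← h1, hconst x 0 (by simpa using hx) m (Nat.zero_le m)]
    simp

variable [FiniteDimensional ℝ E] [IsManifold 𝓘(ℝ, E) ∞ Q] {α : ℝ≥0}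

/-- A solution of the functional equation for `Φ¹` is one for all times. -/
theorem semiconj_int (h0 : ∀ t, Φ t x₀ = x₀)
    (hd : ∀ t, MDifferentiableAt 𝓘(ℝ, E) 𝓘(ℝ, E) (Φ t) x₀) {ψ : Q → E}
    (hψ : ∀ x, ψ (Φ 1 x) = derivAtFixedPoint (E := E) (Φ 1) x₀ (ψ x)) (n : ℤ) (x : Q) :
    ψ (Φ n x) = derivAtFixedPoint (E := E) (Φ n) x₀ (ψ x) := by
  have hnat : ∀ (n : ℕ) (x : Q), ψ (Φ n x) = derivAtFixedPoint (E := E) (Φ n) x₀ (ψ x) := by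
    intro n
    induction n with
    | zero =>
      intro x
      rw [Nat.cast_zero, derivAtFixedPoint_zero, Φ.map_zero_apply]
      rfl
    | succ n ih =>
      intro x
      rw [Nat.cast_succ, Φ.map_add, ih, hψ, derivAtFixedPoint_add h0 hd]
      rfl
  obtain ⟨n, rfl | rfl⟩ := n.eq_nat_or_neg
  · exact hnat n x
  · have h1 := hnat n (Φ (-n) x)
    rw [← Φ.map_add, add_neg_cancel, Φ.map_zero_apply] at h1
    rw [h1, ← mul_apply_eq_comp, ← derivAtFixedPoint_add h0 hd, neg_add_cancel,
      derivAtFixedPoint_zero]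
    rfl

/-- Existence of the linearization, as a conjugacy which is regular at the fixed point. The local
linearization only conjugates some iterate `Φᴺ` to its derivative; the defect for `Φ¹` is a flat map,
and so is zero by the uniqueness principle. -/
theorem exists_conjugacy (hj : 1 ≤ j) (hα : α ≤ 1) (hΦ : IsCkaCascade E Φ j α)
    (hS : SternbergCondition (E := E) Φ x₀ (j : ℕ∞) α) :
    ∃ ψ : Q → E, (∀ (n : ℤ) x, ψ (Φ n x) = derivAtFixedPoint (E := E) (Φ n) x₀ (ψ x)) ∧
      CkaAt α j (fun z : E => ψ (ofCoord x₀ z)) 0 ∧ ψ x₀ = 0 ∧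
      HasFDerivAt (fun z : E => ψ (ofCoord x₀ z)) (1 : E →L[ℝ] E) 0 := by
  have h := hS.attracting
  have h0 := h.fixed
  have hα1 : (α : ℝ) ≤ 1 := hα
  have hd : ∀ t, MDifferentiableAt 𝓘(ℝ, E) 𝓘(ℝ, E) (Φ t) x₀ := fun t =>
    IsCkaLoc.mdifferentiableAt (by exact_mod_cast hj) (hΦ t) x₀
  have hadd := derivAtFixedPoint_add h0 hd
  obtain ⟨N, hN, r, hr, hr1, hA, hB⟩ := hS.exists_rates hd
  set A := derivAtFixedPoint (E := E) (Φ 1) x₀ with hAd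
  set B := derivAtFixedPoint (E := E) (Φ (-1)) x₀ with hBd
  have hAB : A * B = 1 := by rw [hAd, hBd, ← hadd, add_neg_cancel, derivAtFixedPoint_zero]
  have hBA : B * A = 1 := by rw [hAd, hBd, ← hadd, neg_add_cancel, derivAtFixedPoint_zero]
  have hBA' : ∀ v, B (A v) = v := fun v => DFunLike.congr_fun hBA v
  have hAB' : ∀ v, A (B v) = v := fun v => DFunLike.congr_fun hAB v
  have hABN := pow_mul_pow_eq_one N hAB
  have hBAN := pow_mul_pow_eq_one N hBA
  obtain ⟨ψ₁, hψ₁, hψ₁0, hψ₁1, hψ₁c, hψ₁f⟩ := exists_local_linearization α.2 hα1 hj hAB hBA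
    hS.nonresonant le_rfl (CkaAt.coordMap hj hα (hΦ 1) (h0 1)) (coordMap_zero (h0 1))
    (hasFDerivAt_coordMap (hd 1) (h0 1)) hr hr1 hA hB
  have hloc : ∀ᶠ y in 𝓝 x₀, ψ₁ (toCoord x₀ (Φ N y)) = (A ^ N) (ψ₁ (toCoord x₀ y)) := by
    filter_upwards [tendsto_toCoord.eventually hψ₁c,
      tendsto_toCoord.eventually (eventually_iterate_coordMap (E := E) h0 N),
      eventually_ofCoord_toCoord (E := E) (x₀ := x₀)] with y h1 h2 h3
    rw [h2, coordMap, h3] at h1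
    exact h1
  obtain ⟨ψ, hψN, hψ⟩ := exists_extension (ψ₀ := fun y => ψ₁ (toCoord x₀ y)) h hN hABN hBAN hloc
  have hψof : (fun z : E => ψ (ofCoord x₀ z)) =ᶠ[𝓝 0] ψ₁ := by
    filter_upwards [continuousAt_ofCoord.eventually hψ,
      eventually_toCoord_ofCoord (E := E) (x₀ := x₀)] with z h1 h2
    rw [h1, h2]
  refine ⟨ψ, semiconj_int h0 hd fun x => ?_, hψ₁.congr hψof.symm, ?_,
    hψ₁1.congr_of_eventuallyEq hψof⟩
  · have hzero := eq_zero_of_flat α.2 h hd hN hr hA hB (χ := fun x => B (ψ (Φ 1 x)) - ψ x)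
      (fun x => ?_) ?_ x
    · rw [← hAB' (ψ (Φ 1 x)), sub_eq_zero.1 hzero]
    · have hBNA : ∀ v, (B ^ N) ((A ^ N) v) = v := fun v => DFunLike.congr_fun hBAN v
      have hcomm : ∀ v, B ((A ^ N) v) = (A ^ N) (B v) := by
        have h1 : Commute B A := by rw [Commute, SemiconjBy, hAB, hBA]
        exact fun v => DFunLike.congr_fun (h1.pow_right N) v
      have h1 : ψ (Φ 1 (Φ N x)) = (A ^ N) (ψ (Φ 1 x)) := by
        rw [← hψN, ← Φ.map_add, ← Φ.map_add, add_comm]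
      rw [h1, hψN, hcomm, ← map_sub, hBNA]
    · refine hψ₁f.congr ?_
      have hc1 : Tendsto (fun z : E => Φ 1 (ofCoord x₀ z)) (𝓝 0) (𝓝 x₀) := by
        have h1 : Tendsto (Φ 1) (𝓝 x₀) (𝓝 (Φ 1 x₀)) := (Φ.continuous_toFun 1).continuousAt
        rw [h0] at h1
        exact h1.comp continuousAt_ofCoord
      filter_upwards [hψof, hc1.eventually hψ] with z h1 h2
      rw [h1, h2]
      rfl
  · have := hψof.self_of_nhds
    simpa [hψ₁0] using this

end Conjugacy

/-! ### Regularity, inverse and uniqueness of the conjugacy -/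

section FiniteRegularity

universe u

variable {E : Type u} [NormedAddCommGroup E] [NormedSpace ℝ E]
  {Q : Type*} [TopologicalSpace Q] [ChartedSpace E Q] {x₀ : Q} {Φ : Flow ℤ Q} {j : ℕ} {α : ℝ≥0}

theorem derivAtFixedPoint_neg_apply (h0 : ∀ t, Φ t x₀ = x₀)
    (hd : ∀ t, MDifferentiableAt 𝓘(ℝ, E) 𝓘(ℝ, E) (Φ t) x₀) (n : ℤ) (v : E) :
    derivAtFixedPoint (E := E) (Φ (-n)) x₀ (derivAtFixedPoint (E := E) (Φ n) x₀ v) = v := by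
  rw [← mul_apply_eq_comp, ← derivAtFixedPoint_add h0 hd, neg_add_cancel, derivAtFixedPoint_zero]
  rfl

/-- A conjugacy inherits its regularity at `x₀` everywhere, since all orbits approach `x₀`. -/
theorem ckaAt_of_conjugacy [IsManifold 𝓘(ℝ, E) ∞ Q] (hj : 1 ≤ j) (hα : α ≤ 1)
    (hΦ : IsCkaCascade E Φ j α) (h : IsGloballyAttractingFixedPoint Φ x₀) {ψ : Q → E}
    (hψ : ∀ (n : ℤ) x, ψ (Φ n x) = derivAtFixedPoint (E := E) (Φ n) x₀ (ψ x))
    (hloc : CkaAt α j (fun z : E => ψ (ofCoord x₀ z)) 0) {a : E → Q} {y : E}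
    (ha : ContMDiffAt 𝓘(ℝ, E) 𝓘(ℝ, E) ∞ a y) : CkaAt α j (fun z => ψ (a z)) y := by
  have hα1 : (α : ℝ) ≤ 1 := hα
  have hd : ∀ t, MDifferentiableAt 𝓘(ℝ, E) 𝓘(ℝ, E) (Φ t) x₀ := fun t =>
    IsCkaLoc.mdifferentiableAt (by exact_mod_cast hj) (hΦ t) x₀
  have hgood : ∀ᶠ x in 𝓝 x₀, (∀ᶠ x' in 𝓝 x, ofCoord (E := E) x₀ (toCoord x₀ x') = x') ∧
      CkaAt α j (fun z : E => ψ (ofCoord x₀ z)) (toCoord x₀ x) ∧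
      ContMDiffAt 𝓘(ℝ, E) 𝓘(ℝ, E) ∞ (toCoord (E := E) x₀) x :=
    eventually_ofCoord_toCoord.eventually_nhds.and
      ((tendsto_toCoord.eventually hloc.eventually).and eventually_contMDiffAt_toCoord)
  obtain ⟨n, hn1, hn2, hn3⟩ := ((h.attracting (a y)).eventually hgood).exists
  have hc : Tendsto (fun z => Φ n (a z)) (𝓝 y) (𝓝 (Φ n (a y))) :=
    ((Φ.continuous_toFun n).continuousAt.comp ha.continuousAt)
  have h1 : CkaAt α j (fun z => toCoord (E := E) x₀ (Φ n (a z))) y := (hΦ n).ckaAt hj hα ha hn3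
  have h2 : CkaAt α j (fun z => ψ (ofCoord x₀ (toCoord (E := E) x₀ (Φ n (a z))))) y :=
    CkaAt.comp α.2 hα1 hj (F := fun z => toCoord (E := E) x₀ (Φ n (a z))) hn2 h1
  refine (h2.clm_comp α.2 hα1 (derivAtFixedPoint (E := E) (Φ (-n)) x₀)).congr ?_
  filter_upwards [hc.eventually hn1] with z hz
  rw [hz, hψ, derivAtFixedPoint_neg_apply h.fixed hd]

theorem isCkaLoc_of_ckaAt_comp [IsManifold 𝓘(ℝ, E) ∞ Q] {ψ : Q → E}
    (h : ∀ x : Q, CkaAt α j (fun z => ψ ((extChartAt 𝓘(ℝ, E) x).symm z)) (extChartAt 𝓘(ℝ, E) x x)) :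
    IsCkaLoc 𝓘(ℝ, E) 𝓘(ℝ, E) (j : ℕ∞) α ψ := by
  refine IsCkaLoc.of_ckaAt (continuous_iff_continuousAt.2 fun x => ?_) fun x => by
    simpa only [extChartAt_model_space_eq_id, PartialEquiv.refl_coe, id] using h x
  have h1 := ContinuousAt.comp (f := extChartAt 𝓘(ℝ, E) x) (h x).continuousAt
    (continuousAt_extChartAt x)
  refine h1.congr ?_
  filter_upwards [extChartAt_source_mem_nhds (I := 𝓘(ℝ, E)) x] with y hy
  simp only [Function.comp_apply, (extChartAt 𝓘(ℝ, E) x).left_inv hy]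

/-- The inverse function theorem for `C^{j,α}` germs with derivative `1`. -/
theorem exists_local_inverse [CompleteSpace E] (hj : 1 ≤ j) (hα : α ≤ 1) {f : E → E}
    (hf : CkaAt α j f 0) (hf0 : f 0 = 0) (hf1 : HasFDerivAt f (1 : E →L[ℝ] E) 0) :
    ∃ g : E → E, CkaAt α j g 0 ∧ g 0 = 0 ∧ (∀ᶠ z in 𝓝 0, g (f z) = z) ∧
      ∀ᶠ w in 𝓝 0, f (g w) = w := by
  have hα1 : (α : ℝ) ≤ 1 := hα
  have hc : ContDiffAt ℝ 1 f 0 := (hf.contDiffAt α.2).of_le (by exact_mod_cast hj)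
  have hf1' : HasFDerivAt f ((ContinuousLinearEquiv.refl ℝ E : E ≃L[ℝ] E) : E →L[ℝ] E) 0 := hf1
  have hs := hc.hasStrictFDerivAt' hf1' one_ne_zero
  have hg0 : hs.localInverse f _ 0 0 = 0 := by
    have := hs.localInverse_apply_image
    rwa [hf0] at this
  have hgc : ContDiffAt ℝ 1 (hs.localInverse f _ 0) 0 := by
    have := hc.to_localInverse hf1' one_ne_zero
    rwa [hf0] at this
  have h1 := hs.eventually_left_inverse
  have h2 := hs.eventually_right_inverse
  rw [hf0] at h2
  exact ⟨hs.localInverse f _ 0, CkaAt.of_local_inverse α.2 hα1 (by rwa [hg0]) hgc h2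
    (by rwa [hg0]), hg0, h1, h2⟩

variable [FiniteDimensional ℝ E] [IsManifold 𝓘(ℝ, E) ∞ Q] {ψ : Q → E}

/-- Near `x₀` the conjugacy has a regular inverse, and the dynamics carries it to all of `E`. -/
theorem isCkaDiffeo_of_conjugacy (hj : 1 ≤ j) (hα : α ≤ 1)
    (hΦ : IsCkaCascade E Φ j α) (h : IsGloballyAttractingFixedPoint Φ x₀)
    (hψ : ∀ (n : ℤ) x, ψ (Φ n x) = derivAtFixedPoint (E := E) (Φ n) x₀ (ψ x))
    (hloc : CkaAt α j (fun z : E => ψ (ofCoord x₀ z)) 0) (hψ0 : ψ x₀ = 0)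
    (hψ1 : HasFDerivAt (fun z : E => ψ (ofCoord x₀ z)) (1 : E →L[ℝ] E) 0) :
    IsCkaDiffeo 𝓘(ℝ, E) 𝓘(ℝ, E) (j : ℕ∞) α ψ ∧
      ∀ v, Tendsto (fun n : ℤ => derivAtFixedPoint (E := E) (Φ n) x₀ v) atTop (𝓝 0) := by
  have hα1 : (α : ℝ) ≤ 1 := hα
  have hd : ∀ t, MDifferentiableAt 𝓘(ℝ, E) 𝓘(ℝ, E) (Φ t) x₀ := fun t =>
    IsCkaLoc.mdifferentiableAt (by exact_mod_cast hj) (hΦ t) x₀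
  have hreg : IsCkaLoc 𝓘(ℝ, E) 𝓘(ℝ, E) (j : ℕ∞) α ψ := isCkaLoc_of_ckaAt_comp fun x =>
    ckaAt_of_conjugacy hj hα hΦ h hψ hloc (contMDiffAt_extChartAt_symm x)
  have hψc : Continuous ψ := hreg.1.continuous
  obtain ⟨g₀, hg₀, hg₀0, hg₀l, hg₀r⟩ := exists_local_inverse hj hα hloc (by simpa using hψ0) hψ1
  have hlim : ∀ v, Tendsto (fun n : ℤ => derivAtFixedPoint (E := E) (Φ n) x₀ v) atTop (𝓝 0) := by
    intro v
    -- a small multiple of `v` is in the range of `ψ`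
    have hray : Tendsto (fun t : ℝ => t • v) (𝓝[>] 0) (𝓝 0) := by
      have h : Tendsto (fun t : ℝ => t • v) (𝓝 0) (𝓝 ((0 : ℝ) • v)) :=
        (continuous_id.smul continuous_const).tendsto 0
      rw [zero_smul] at h
      exact h.mono_left nhdsWithin_le_nhds
    obtain ⟨t, ht, ht0⟩ := ((hray.eventually hg₀r).and self_mem_nhdsWithin).exists
    have ht0 : 0 < t := ht0
    have h1 := (hψc.tendsto x₀).comp (h.attracting (ofCoord x₀ (g₀ (t • v))))
    rw [hψ0] at h1
    have h2 := h1.const_smul t⁻¹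
    rw [smul_zero] at h2
    refine h2.congr fun n => ?_
    rw [Function.comp_apply, hψ, ht, map_smul, smul_smul, inv_mul_cancel₀ ht0.ne', one_smul]
  have hinj : Function.Injective ψ := by
    have hP : ∀ᶠ x in 𝓝 x₀, ofCoord x₀ (g₀ (ψ x)) = x := by
      filter_upwards [tendsto_toCoord.eventually hg₀l,
        eventually_ofCoord_toCoord (E := E) (x₀ := x₀)] with x h1 h2
      rw [h2] at h1
      rw [h1, h2]
    intro x y hxy
    obtain ⟨n, hx, hy⟩ := (((h.attracting x).eventually hP).and
      ((h.attracting y).eventually hP)).exists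
    have hn : Φ n x = Φ n y := by rw [← hx, ← hy, hψ, hψ, hxy]
    have := congrArg (Φ (-n)) hn
    rwa [← Φ.map_add, ← Φ.map_add, neg_add_cancel, Φ.map_zero_apply, Φ.map_zero_apply] at this
  have hgood : ∀ᶠ u in 𝓝 (0 : E), (∀ᶠ w in 𝓝 u, ψ (ofCoord x₀ (g₀ w)) = w) ∧ CkaAt α j g₀ u ∧
      ContMDiffAt 𝓘(ℝ, E) 𝓘(ℝ, E) ∞ (ofCoord (E := E) x₀) (g₀ u) := by
    have hc : Tendsto g₀ (𝓝 0) (𝓝 0) := by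
      simpa [ContinuousAt, hg₀0] using hg₀.continuousAt
    exact hg₀r.eventually_nhds.and
      (hg₀.eventually.and (hc.eventually eventually_contMDiffAt_ofCoord))
  have hinv : ∀ (n : ℤ) (w : E),
      ψ (ofCoord x₀ (g₀ (derivAtFixedPoint (E := E) (Φ n) x₀ w))) =
        derivAtFixedPoint (E := E) (Φ n) x₀ w →
      ψ (Φ (-n) (ofCoord x₀ (g₀ (derivAtFixedPoint (E := E) (Φ n) x₀ w)))) = w := by
    intro n w hw
    rw [hψ, hw, derivAtFixedPoint_neg_apply h.fixed hd]
  have hsurj : Function.Surjective ψ := by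
    intro v
    obtain ⟨n, hn, -⟩ := ((hlim v).eventually hgood).exists
    exact ⟨_, hinv n v hn.self_of_nhds⟩
  let e := Equiv.ofBijective ψ ⟨hinj, hsurj⟩
  have hformula : ∀ v, ∃ n : ℤ, CkaAt α j g₀ (derivAtFixedPoint (E := E) (Φ n) x₀ v) ∧
      ContMDiffAt 𝓘(ℝ, E) 𝓘(ℝ, E) ∞ (ofCoord (E := E) x₀)
        (g₀ (derivAtFixedPoint (E := E) (Φ n) x₀ v)) ∧
      ∀ᶠ w in 𝓝 v, Φ (-n) (ofCoord x₀ (g₀ (derivAtFixedPoint (E := E) (Φ n) x₀ w))) = e.symm w := by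
    intro v
    obtain ⟨n, hn1, hn2, hn3⟩ := ((hlim v).eventually hgood).exists
    refine ⟨n, hn2, hn3, ?_⟩
    filter_upwards [(derivAtFixedPoint (E := E) (Φ n) x₀).continuous.continuousAt.eventually hn1]
      with w hw
    rw [Equiv.eq_symm_apply]
    exact hinv n w hw
  refine ⟨⟨hreg, e.symm, e.left_inv, e.right_inv, ?_⟩, hlim⟩
  refine IsCkaLoc.of_ckaAt (continuous_iff_continuousAt.2 fun v => ?_) fun v => ?_
  · obtain ⟨n, hn2, hn3, hn⟩ := hformula v
    refine ContinuousAt.congr ?_ hn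
    have h1 : ContinuousAt (fun w => g₀ (derivAtFixedPoint (E := E) (Φ n) x₀ w)) v :=
      ContinuousAt.comp (g := g₀) hn2.continuousAt
        (derivAtFixedPoint (E := E) (Φ n) x₀).continuous.continuousAt
    exact (Φ.continuous_toFun (-n)).continuousAt.comp
      (ContinuousAt.comp (g := ofCoord (E := E) x₀) hn3.continuousAt h1)
  · obtain ⟨n, hn2, hn3, hn⟩ := hformula v
    have hL : CkaAt α j (derivAtFixedPoint (E := E) (Φ n) x₀) v :=
      CkaAt.of_contDiffAt α.2 hα1 (derivAtFixedPoint (E := E) (Φ n) x₀).contDiff.contDiffAt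
    have h1 : CkaAt α j (fun w => g₀ (derivAtFixedPoint (E := E) (Φ n) x₀ w)) v :=
      CkaAt.comp α.2 hα1 hj hn2 hL
    have h2 : CkaAt α j (fun z => extChartAt 𝓘(ℝ, E) (e.symm v) (Φ (-n) (ofCoord x₀ z)))
        (g₀ (derivAtFixedPoint (E := E) (Φ n) x₀ v)) := by
      refine (hΦ (-n)).ckaAt hj hα (b := extChartAt 𝓘(ℝ, E) (e.symm v)) hn3 ?_
      rw [hn.self_of_nhds]
      exact contMDiffAt_extChartAt
    have h3 := CkaAt.comp α.2 hα1 hj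
      (F := fun w => g₀ (derivAtFixedPoint (E := E) (Φ n) x₀ w)) h2 h1
    refine h3.congr ?_
    filter_upwards [hn] with w hw
    simp only [hw, extChartAt_model_space_eq_id, PartialEquiv.refl_symm, PartialEquiv.refl_coe,
      id]

/-- Two linearizations have the same `j`-jet at `x₀`, by nonresonance. So their difference is flat,
and the uniqueness principle applies. -/
theorem eq_of_isLinearization (hj : 1 ≤ j) (hα : α ≤ 1) (hΦ : IsCkaCascade E Φ j α)
    (hS : SternbergCondition (E := E) Φ x₀ (j : ℕ∞) α)
    (hlim : ∀ v, Tendsto (fun n : ℤ => derivAtFixedPoint (E := E) (Φ n) x₀ v) atTop (𝓝 0))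
    {ψ' : Q → E} (hψ : IsCkaLoc 𝓘(ℝ, E) 𝓘(ℝ, E) (j : ℕ∞) α ψ) (hψl : IsLinearization Φ x₀ ψ)
    (hψ' : IsCkaLoc 𝓘(ℝ, E) 𝓘(ℝ, E) (j : ℕ∞) α ψ') (hψl' : IsLinearization Φ x₀ ψ') : ψ' = ψ := by
  have h := hS.attracting
  have h0 := h.fixed
  have hα1 : (α : ℝ) ≤ 1 := hα
  have hj1 : (1 : ℕ∞) ≤ j := by exact_mod_cast hj
  have hd : ∀ t, MDifferentiableAt 𝓘(ℝ, E) 𝓘(ℝ, E) (Φ t) x₀ := fun t =>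
    IsCkaLoc.mdifferentiableAt hj1 (hΦ t) x₀
  have hadd := derivAtFixedPoint_add h0 hd
  obtain ⟨N, hN, r, hr, hr1, hA, hB⟩ := hS.exists_rates hd
  -- a linearization maps `x₀` to a fixed point of the contraction `A`, that is to `0`
  have hzero : ∀ {θ : Q → E}, IsLinearization Φ x₀ θ → θ x₀ = 0 := by
    intro θ hθ
    refine tendsto_nhds_unique ?_ (hlim (θ x₀))
    refine tendsto_const_nhds.congr fun n => ?_
    rw [← hθ.1, h0]
  set A := derivAtFixedPoint (E := E) (Φ 1) x₀ with hAd
  set B := derivAtFixedPoint (E := E) (Φ (-1)) x₀ with hBd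
  have hAB : A * B = 1 := by rw [hAd, hBd, ← hadd, add_neg_cancel, derivAtFixedPoint_zero]
  have hBA : B * A = 1 := by rw [hAd, hBd, ← hadd, neg_add_cancel, derivAtFixedPoint_zero]
  have hof : ContMDiffAt 𝓘(ℝ, E) 𝓘(ℝ, E) ∞ (ofCoord (E := E) x₀) 0 :=
    eventually_contMDiffAt_ofCoord.self_of_nhds
  have hcka : ∀ {θ : Q → E}, IsCkaLoc 𝓘(ℝ, E) 𝓘(ℝ, E) (j : ℕ∞) α θ →
      CkaAt α j (fun z : E => θ (ofCoord x₀ z)) 0 := fun hθ =>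
    hθ.ckaAt hj hα (b := fun v => v) hof contMDiffAt_id
  have hχ : CkaAt α j (fun z : E => ψ' (ofCoord x₀ z) - ψ (ofCoord x₀ z)) 0 :=
    (hcka hψ').sub α.2 hα1 (hcka hψ)
  have hder : ∀ {θ : Q → E}, IsCkaLoc 𝓘(ℝ, E) 𝓘(ℝ, E) (j : ℕ∞) α θ → IsLinearization Φ x₀ θ →
      HasFDerivAt (fun z : E => θ (ofCoord x₀ z)) (1 : E →L[ℝ] E) 0 := by
    intro θ hθ hθl
    have h1 := hasFDerivAt_comp_ofCoord (IsCkaLoc.mdifferentiableAt hj1 hθ x₀)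
    rwa [show derivToModel θ x₀ = 1 from hθl.2] at h1
  have hjets := iteratedFDeriv_eq_zero_of_semiconj hAB hBA hS.nonresonant le_rfl
    ((CkaAt.coordMap hj hα (hΦ 1) (h0 1)).contDiffAt α.2) (coordMap_zero (h0 1))
    (hasFDerivAt_coordMap (hd 1) (h0 1)).fderiv (hχ.contDiffAt α.2)
    (by simp [hzero hψl, hzero hψl'])
    (by simpa using ((hder hψ' hψl').fun_sub (hder hψ hψl)).fderiv) (by
      have hc1 : Tendsto (fun z : E => Φ 1 (ofCoord x₀ z)) (𝓝 0) (𝓝 x₀) := by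
        have h1 : Tendsto (Φ 1) (𝓝 x₀) (𝓝 (Φ 1 x₀)) := (Φ.continuous_toFun 1).continuousAt
        rw [h0] at h1
        exact h1.comp continuousAt_ofCoord
      filter_upwards [hc1.eventually (eventually_ofCoord_toCoord (E := E))] with z hz
      rw [coordMap, hz, hψl.1, hψl'.1, map_sub])
  ext x
  refine sub_eq_zero.1 (eq_zero_of_flat α.2 h hd hN hr hA hB (χ := fun x => ψ' x - ψ x)
    (fun y => ?_) (FlatAt.of_ckaAt α.2 hχ hjets) x)
  have hAN : derivAtFixedPoint (E := E) (Φ N) x₀ = A ^ N := by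
    have := derivAtFixedPoint_natCast h0 hd 1 N
    rwa [mul_one] at this
  rw [hψl.1, hψl'.1, ← map_sub, hAN]
  exact (DFunLike.congr_fun (pow_mul_pow_eq_one N hBA) _).symm

/-- The global Sternberg linearization of an invertible map, in finite regularity. -/
theorem hasUniqueLinearization_of_finite (hj : 1 ≤ j) (hα : α ≤ 1) (hΦ : IsCkaCascade E Φ j α)
    (hS : SternbergCondition (E := E) Φ x₀ (j : ℕ∞) α) :
    HasUniqueLinearization (E := E) Φ x₀ (j : ℕ∞) α := by
  have hj1 : (1 : ℕ∞) ≤ j := by exact_mod_cast hj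
  obtain ⟨ψ, hψ, hloc, hψ0, hψ1⟩ := exists_conjugacy hj hα hΦ hS
  obtain ⟨hdiff, hlim⟩ := isCkaDiffeo_of_conjugacy hj hα hΦ hS.attracting hψ hloc hψ0 hψ1
  have hlin : IsLinearization Φ x₀ ψ := by
    refine ⟨hψ, ?_⟩
    have h1 := hasFDerivAt_comp_ofCoord (IsCkaLoc.mdifferentiableAt hj1 hdiff.1 x₀)
    exact h1.unique hψ1
  exact ⟨ψ, ⟨hdiff, hlin⟩, fun ψ' h1 h2 =>
    eq_of_isLinearization hj hα hΦ hS hlim hdiff.1 hlin h1 h2⟩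

end FiniteRegularity

/-! ### Infinite differentiability and continuous time -/

section Composition

universe u

variable {E E' : Type u} [NormedAddCommGroup E] [NormedSpace ℝ E] [NormedAddCommGroup E']
  [NormedSpace ℝ E']
variable {H M H' N : Type*} [TopologicalSpace H] [TopologicalSpace M] [ChartedSpace H M]
  [TopologicalSpace H'] [TopologicalSpace N] [ChartedSpace H' N]
variable {I : ModelWithCorners ℝ E H} {I' : ModelWithCorners ℝ E' H'} [I.Boundaryless]
  [I'.Boundaryless] {α : ℝ≥0}

theorem IsCkaLoc.of_contMDiff [IsManifold I ∞ M] [IsManifold I' ∞ N] (hα : α ≤ 1) {j : ℕ}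
    {f : M → N} (hf : ContMDiff I I' (j + 1 : ℕ) f) : IsCkaLoc I I' (j : ℕ∞) α f := by
  refine IsCkaLoc.of_ckaAt hf.continuous fun x => CkaAt.of_contDiffAt α.2 hα ?_
  have h := (contMDiffAt_iff.1 (hf x)).2
  rwa [I.range_eq_univ, contDiffWithinAt_univ] at h

theorem IsCkaLoc.top {f : M → N} (hf : ContMDiff I I' ((⊤ : ℕ∞) : ℕ∞ω) f) : IsCkaLoc I I' ⊤ α f :=
  ⟨hf, fun j hj => absurd hj (by simp)⟩

variable {Q Q' Q'' : Type*} [TopologicalSpace Q] [ChartedSpace E Q] [IsManifold 𝓘(ℝ, E) ∞ Q]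
  [TopologicalSpace Q'] [ChartedSpace E Q'] [IsManifold 𝓘(ℝ, E) ∞ Q']
  [TopologicalSpace Q''] [ChartedSpace E Q''] [IsManifold 𝓘(ℝ, E) ∞ Q'']

theorem IsCkaLoc.comp {k : ℕ∞} (hk : 1 ≤ k) (hα : α ≤ 1) {g : Q' → Q''} {f : Q → Q'}
    (hg : IsCkaLoc 𝓘(ℝ, E) 𝓘(ℝ, E) k α g) (hf : IsCkaLoc 𝓘(ℝ, E) 𝓘(ℝ, E) k α f) :
    IsCkaLoc 𝓘(ℝ, E) 𝓘(ℝ, E) k α (fun x => g (f x)) := by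
  induction k using ENat.recTopCoe with
  | top => exact IsCkaLoc.top (hg.1.comp hf.1)
  | coe j =>
    have hj : 1 ≤ j := by exact_mod_cast hk
    refine IsCkaLoc.of_ckaAt (hg.1.continuous.comp hf.1.continuous) fun x => ?_
    have hx : ContinuousAt (fun z => f ((extChartAt 𝓘(ℝ, E) x).symm z)) (extChartAt 𝓘(ℝ, E) x x) :=
      hf.1.continuous.continuousAt.comp (continuousAt_extChartAt_symm x)
    have h1 : CkaAt α j (fun z => extChartAt 𝓘(ℝ, E) (f x) (f ((extChartAt 𝓘(ℝ, E) x).symm z)))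
        (extChartAt 𝓘(ℝ, E) x x) := by
      refine hf.ckaAt hj hα (contMDiffAt_extChartAt_symm x) ?_
      rw [extChartAt_to_inv]
      exact contMDiffAt_extChartAt
    have h2 : CkaAt α j (fun z => extChartAt 𝓘(ℝ, E) (g (f x))
        (g ((extChartAt 𝓘(ℝ, E) (f x)).symm z))) (extChartAt 𝓘(ℝ, E) (f x) (f x)) := by
      refine hg.ckaAt hj hα (contMDiffAt_extChartAt_symm (f x)) ?_
      rw [extChartAt_to_inv]
      exact contMDiffAt_extChartAt
    have h3 : CkaAt α j (fun z => extChartAt 𝓘(ℝ, E) (g (f x))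
        (g ((extChartAt 𝓘(ℝ, E) (f x)).symm z)))
        (extChartAt 𝓘(ℝ, E) (f x) (f ((extChartAt 𝓘(ℝ, E) x).symm (extChartAt 𝓘(ℝ, E) x x)))) := by
      rw [extChartAt_to_inv]
      exact h2
    have h3 := CkaAt.comp α.2 hα hj
      (F := fun z => extChartAt 𝓘(ℝ, E) (f x) (f ((extChartAt 𝓘(ℝ, E) x).symm z))) h3 h1
    refine h3.congr ?_
    have h4 : ∀ᶠ z in 𝓝 (extChartAt 𝓘(ℝ, E) x x),
        f ((extChartAt 𝓘(ℝ, E) x).symm z) ∈ (extChartAt 𝓘(ℝ, E) (f x)).source := by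
      refine hx.eventually_mem ?_
      simp only [extChartAt_to_inv]
      exact extChartAt_source_mem_nhds (f x)
    filter_upwards [h4] with z hz
    rw [(extChartAt 𝓘(ℝ, E) (f x)).left_inv hz]

theorem IsCkaLoc.clm {k : ℕ∞} (hα : α ≤ 1) (L : E →L[ℝ] E) :
    IsCkaLoc 𝓘(ℝ, E) 𝓘(ℝ, E) k α L := by
  induction k using ENat.recTopCoe with
  | top => exact IsCkaLoc.top L.contDiff.contMDiff
  | coe j => exact IsCkaLoc.of_contMDiff hα L.contDiff.contMDiff

/-- The time-`t` maps of a flow are as regular as the flow. -/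
theorem IsCkaFlow.isCkaLoc {k : ℕ∞} (hk : 1 ≤ k) (hα : α ≤ 1) {Φ : Flow ℝ Q}
    (hΦ : IsCkaFlow E Φ k α) (t : ℝ) : IsCkaLoc 𝓘(ℝ, E) 𝓘(ℝ, E) k α (Φ t) := by
  induction k using ENat.recTopCoe with
  | top => exact IsCkaLoc.top (hΦ.1.comp (contMDiff_id.prodMk contMDiff_const))
  | coe j =>
    have hj : 1 ≤ j := by exact_mod_cast hk
    refine IsCkaLoc.of_ckaAt (Φ.continuous_toFun t) fun x => ?_
    refine IsCkaLoc.ckaAt (a := fun z => ((extChartAt 𝓘(ℝ, E) x).symm z, t))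
      (b := extChartAt 𝓘(ℝ, E) (Φ t x)) hj hα hΦ
      ((contMDiffAt_extChartAt_symm x).prodMk contMDiffAt_const) ?_
    rw [extChartAt_to_inv]
    exact contMDiffAt_extChartAt

end Composition

section Main

universe u

variable {E : Type u} [NormedAddCommGroup E] [NormedSpace ℝ E] [FiniteDimensional ℝ E]
  {Q : Type*} [TopologicalSpace Q] [ChartedSpace E Q] [IsManifold 𝓘(ℝ, E) ∞ Q] {x₀ : Q} {α : ℝ≥0}

/-- Lowering the order from `∞` to a finite one above the spectral spread, and `α` to `0`,
preserves the hypotheses. -/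
theorem SternbergCondition.of_top {Φ : Flow ℤ Q}
    (hS : SternbergCondition (E := E) Φ x₀ ⊤ α) {j : ℕ}
    (hj : spread (complexDeriv (E := E) (Φ 1) x₀) (complexDeriv (E := E) (Φ 1) x₀) < j) :
    SternbergCondition (E := E) Φ x₀ (j : ℕ∞) 0 where
  attracting := hS.attracting
  hyperbolic := hS.hyperbolic
  spread_lt := by
    rw [coe_natCast_add, NNReal.coe_zero, add_zero]
    exact_mod_cast hj
  nonresonant := fun μ hμ m h2 _ => hS.nonresonant μ hμ m h2 le_top

/-- For `k = ∞` the linearizations of all large finite orders coincide, by uniqueness. -/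
theorem hasUniqueLinearization_of_top {Φ : Flow ℤ Q} (hΦ : IsCkaCascade E Φ ⊤ α)
    (hS : SternbergCondition (E := E) Φ x₀ ⊤ α) : HasUniqueLinearization (E := E) Φ x₀ ⊤ α := by
  obtain ⟨i, hi⟩ :=
    exists_nat_gt (spread (complexDeriv (E := E) (Φ 1) x₀) (complexDeriv (E := E) (Φ 1) x₀))
  have hle : ∀ n : ℕ, ((n : ℕ) : ℕ∞ω) ≤ ((⊤ : ℕ∞) : ℕ∞ω) := fun n => by exact_mod_cast le_top
  have hfin : ∀ j, i < j → HasUniqueLinearization (E := E) Φ x₀ (j : ℕ∞) 0 := fun j hj =>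
    hasUniqueLinearization_of_finite (by omega) zero_le_one
      (fun n => IsCkaLoc.of_contMDiff zero_le_one ((hΦ n).1.of_le (hle _)))
      (hS.of_top (hi.trans (by exact_mod_cast hj)))
  obtain ⟨ψ, ⟨⟨-, g, hgl, hgr, -⟩, hlin⟩, huniq⟩ := hfin (i + 1) (by omega)
  have hall : ∀ j, i + 2 ≤ j → ContMDiff 𝓘(ℝ, E) 𝓘(ℝ, E) j ψ ∧ ContMDiff 𝓘(ℝ, E) 𝓘(ℝ, E) j g := by
    intro j hj
    obtain ⟨ψ', ⟨⟨hψ', g', hgl', hgr', hg'⟩, hlin'⟩, -⟩ := hfin j (by omega)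
    have hψ'c : ContMDiff 𝓘(ℝ, E) 𝓘(ℝ, E) j ψ' := hψ'.1
    have hg'c : ContMDiff 𝓘(ℝ, E) 𝓘(ℝ, E) j g' := hg'.1
    obtain rfl := huniq ψ'
      (IsCkaLoc.of_contMDiff zero_le_one (hψ'c.of_le (by exact_mod_cast hj))) hlin'
    obtain rfl : g' = g := by
      ext1 v
      rw [← hgl (g' v), hgr' v]
    exact ⟨hψ'c, hg'c⟩
  have htop : ContMDiff 𝓘(ℝ, E) 𝓘(ℝ, E) ((⊤ : ℕ∞) : ℕ∞ω) ψ ∧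
      ContMDiff 𝓘(ℝ, E) 𝓘(ℝ, E) ((⊤ : ℕ∞) : ℕ∞ω) g := by
    refine ⟨contMDiff_infty.2 fun n => ?_, contMDiff_infty.2 fun n => ?_⟩
    · exact (hall (i + 2 + n) (by omega)).1.of_le (by norm_cast; omega)
    · exact (hall (i + 2 + n) (by omega)).2.of_le (by norm_cast; omega)
  refine ⟨ψ, ⟨⟨IsCkaLoc.top htop.1, g, hgl, hgr, IsCkaLoc.top htop.2⟩, hlin⟩, fun ψ' h1 h2 => ?_⟩
  exact huniq ψ' (IsCkaLoc.of_contMDiff zero_le_one (h1.1.of_le (hle _))) h2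

theorem hasUniqueLinearization_int {k : ℕ∞} (hk : 1 ≤ k) (hα : α ≤ 1) {Φ : Flow ℤ Q}
    (hΦ : IsCkaCascade E Φ k α) (hS : SternbergCondition (E := E) Φ x₀ k α) :
    HasUniqueLinearization (E := E) Φ x₀ k α := by
  induction k using ENat.recTopCoe with
  | top => exact hasUniqueLinearization_of_top hΦ hS
  | coe j => exact hasUniqueLinearization_of_finite (by exact_mod_cast hk) hα hΦ hS

/-- The integer times of a flow. -/
def intFlow (Φ : Flow ℝ Q) : Flow ℤ Q where
  toFun n x := Φ (n : ℝ) x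
  cont' := Φ.cont'.comp
    ((continuous_of_discreteTopology (f := ((↑) : ℤ → ℝ))).prodMap continuous_id)
  map_add' m n x := by rw [Int.cast_add, Φ.map_add]
  map_zero' x := by rw [Int.cast_zero, Φ.map_zero_apply]

theorem intFlow_apply (Φ : Flow ℝ Q) (n : ℤ) : intFlow Φ n = Φ (n : ℝ) := rfl

theorem SternbergCondition.intFlow {k : ℕ∞} {Φ : Flow ℝ Q}
    (hS : SternbergCondition (E := E) Φ x₀ k α) :
    SternbergCondition (E := E) (intFlow Φ) x₀ k α := by
  have h1 : Sternberg.intFlow Φ 1 = Φ 1 := by rw [intFlow_apply, Int.cast_one]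
  refine ⟨⟨fun t => hS.attracting.fixed t, fun U hU => ?_, fun x => ?_⟩, ?_, ?_, ?_⟩
  · obtain ⟨V, hV, h⟩ := hS.attracting.stable U hU
    exact ⟨V, hV, fun x hx t ht => h x hx t (by exact_mod_cast ht)⟩
  · exact (hS.attracting.attracting x).comp tendsto_intCast_atTop_atTop
  · rw [IsHyperbolicFixedPoint, h1]; exact hS.hyperbolic
  · rw [h1]; exact hS.spread_lt
  · rw [h1]; exact hS.nonresonant

/-- The linearization `ψ` of `Φ¹` linearizes the flow, because `D Φ⁻ᵗ ∘ ψ ∘ Φᵗ` is another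
linearization of `Φ¹`. -/
theorem hasUniqueLinearization_real {k : ℕ∞} (hk : 1 ≤ k) (hα : α ≤ 1) {Φ : Flow ℝ Q}
    (hΦ : IsCkaFlow E Φ k α) (hS : SternbergCondition (E := E) Φ x₀ k α) :
    HasUniqueLinearization (E := E) Φ x₀ k α := by
  have hloc := hΦ.isCkaLoc hk hα
  have h0 := hS.attracting.fixed
  have hd : ∀ t, MDifferentiableAt 𝓘(ℝ, E) 𝓘(ℝ, E) (Φ t) x₀ := fun t =>
    (hloc t).mdifferentiableAt hk x₀
  have hadd := derivAtFixedPoint_add h0 hd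
  obtain ⟨ψ, ⟨hψ, hψl⟩, huniq⟩ := hasUniqueLinearization_int hk hα
    (Φ := intFlow Φ) (fun n => hloc n) hS.intFlow
  have hinv : ∀ t v, derivAtFixedPoint (E := E) (Φ t) x₀
      (derivAtFixedPoint (E := E) (Φ (-t)) x₀ v) = v := by
    intro t v
    rw [← mul_apply_eq_comp, ← hadd, add_neg_cancel, derivAtFixedPoint_zero]
    rfl
  have hconj : ∀ t : ℝ, (fun x => derivAtFixedPoint (E := E) (Φ (-t)) x₀ (ψ (Φ t x))) = ψ := by
    intro t
    have hψt : IsCkaLoc 𝓘(ℝ, E) 𝓘(ℝ, E) k α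
        (fun x => derivAtFixedPoint (E := E) (Φ (-t)) x₀ (ψ (Φ t x))) :=
      IsCkaLoc.comp hk hα (IsCkaLoc.clm hα _) (IsCkaLoc.comp hk hα hψ.1 (hloc t))
    refine huniq _ hψt ⟨fun n x => ?_, ?_⟩
    · have h1 : ψ (Φ t (Φ (n : ℝ) x)) = derivAtFixedPoint (E := E) (Φ (n : ℝ)) x₀ (ψ (Φ t x)) := by
        rw [← Φ.map_add, add_comm, Φ.map_add]
        exact hψl.1 n (Φ t x)
      change derivAtFixedPoint (E := E) (Φ (-t)) x₀ (ψ (Φ t (Φ (n : ℝ) x))) =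
        derivAtFixedPoint (E := E) (Φ (n : ℝ)) x₀
          (derivAtFixedPoint (E := E) (Φ (-t)) x₀ (ψ (Φ t x)))
      rw [h1, ← mul_apply_eq_comp, ← mul_apply_eq_comp, ← hadd, ← hadd, add_comm]
    · have h1 := hasFDerivAt_comp_ofCoord (hψt.mdifferentiableAt hk x₀)
      have h2 := hasFDerivAt_comp_ofCoord (hψ.1.mdifferentiableAt hk x₀)
      rw [show derivToModel ψ x₀ = 1 from hψl.2] at h2
      have h3 : HasFDerivAt (fun z : E => derivAtFixedPoint (E := E) (Φ (-t)) x₀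
          (ψ (ofCoord x₀ (coordMap x₀ (Φ t) z)))) (1 : E →L[ℝ] E) 0 := by
        have h4 := HasFDerivAt.comp (0 : E) (g := fun z : E => ψ (ofCoord x₀ z))
          (by rwa [coordMap_zero (h0 t)]) (hasFDerivAt_coordMap (hd t) (h0 t))
        have h5 := (derivAtFixedPoint (E := E) (Φ (-t)) x₀).hasFDerivAt.comp (0 : E) h4
        have h6 : (derivAtFixedPoint (E := E) (Φ (-t)) x₀).comp ((1 : E →L[ℝ] E).comp
            (derivAtFixedPoint (E := E) (Φ t) x₀)) = 1 := by
          change derivAtFixedPoint (E := E) (Φ (-t)) x₀ * (1 *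
            (derivAtFixedPoint (E := E) (Φ t) x₀)) = 1
          rw [one_mul, ← hadd, neg_add_cancel, derivAtFixedPoint_zero]
        rwa [h6] at h5
      refine h1.unique (h3.congr_of_eventuallyEq ?_)
      have hc : Tendsto (fun z : E => Φ t (ofCoord x₀ z)) (𝓝 0) (𝓝 x₀) := by
        have h1 : Tendsto (Φ t) (𝓝 x₀) (𝓝 (Φ t x₀)) := (Φ.continuous_toFun t).continuousAt
        rw [h0] at h1
        exact h1.comp continuousAt_ofCoord
      filter_upwards [hc.eventually (eventually_ofCoord_toCoord (E := E))] with z hz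
      rw [coordMap, hz]
  refine ⟨ψ, ⟨hψ, fun t x => ?_, hψl.2⟩, fun ψ' h1 h2 => huniq ψ' h1 ⟨fun n x => h2.1 n x, h2.2⟩⟩
  rw [← congrFun (hconj t) x, hinv]

end Main

end Sternberg

theorem mainTheorem3
    {E : Type*} [NormedAddCommGroup E] [NormedSpace ℝ E] [FiniteDimensional ℝ E]
    {Q : Type*} [TopologicalSpace Q] [ChartedSpace E Q] [IsManifold 𝓘(ℝ, E) ∞ Q]
    [T2Space Q] [SecondCountableTopology Q]
    (k : ℕ∞) (hk : 1 ≤ k) (α : ℝ≥0) (hα : α ≤ 1) (x₀ : Q) :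
    (∀ Φ : Flow ℤ Q, Sternberg.IsCkaCascade E Φ k α →
      Sternberg.SternbergCondition (E := E) Φ x₀ k α →
        Sternberg.HasUniqueLinearization (E := E) Φ x₀ k α) ∧
    (∀ Φ : Flow ℝ Q, Sternberg.IsCkaFlow E Φ k α →
      Sternberg.SternbergCondition (E := E) Φ x₀ k α →
        Sternberg.HasUniqueLinearization (E := E) Φ x₀ k α) :=
  ⟨fun _ hΦ hS => Sternberg.hasUniqueLinearization_int hk hα hΦ hS,
    fun _ hΦ hS => Sternberg.hasUniqueLinearization_real hk hα hΦ hS⟩
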